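/- Let $F\subset \mathrm{Sym}^2(\mathbf R^n)$ be a closed set of symmetric matrices such that $A+P\in F$ whenever $A\in F$ and $P\ge 0$ (a subequation), $tF\subset F$ for all $t\ge 0$, $F$ is convex, and $F$ is invariant under $A\mapsto gAg^{t}$ for all $g$ in some subgroup $G\subset \mathrm O(n)$ acting transitively on the unit sphere. For a unit vector $e$ let $P_e$ and $P_{e^\perp}=I-P_e$ be the orthogonal projections onto the line of $e$ and its complement, and assume that the Riesz characteristic $p=\sup\{\bar p\in\mathbf R : P_{e^\perp}-(\bar p-1)P_e\in F \text{ for all unit } e\}$ is finite. An upper semicontinuous function $u:X\to[-\infty,\infty)$ on an open set $X\subset\mathbf R^n$ is $F$-subharmonic if $D^2_x\varphi\in F$ whenever $x\in X$ and $\varphi$ is $C^2$ near $x$ with $u\le\varphi$ near $x$ and $u(x)=\varphi(x)$. It is $F$-harmonic if $u$ is $F$-subharmonic and $-u$ is $\widetilde F$-subharmonic, where $\widetilde F=\mathrm{Sym}^2(\mathbf R^n)\setminus(-\mathrm{Int}\,F)$ (in particular $u$ is then finite and continuous). An $F$-subharmonic $u$ on $X$ is $F$-maximal on $X$ if for every $F$-subharmonic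 $v$ on $X$ and every compact $K\subset X$, $v\le u$ on $X\setminus K$ implies $v\le u$ on $X$. Let $u$ be $F$-subharmonic on a ball about $0$, and for $r>0$ set $u_r(x)=r^{p-2}u(rx)$ if $p>2$, $u_r(x)=r^{-(2-p)}\,[u(rx)-u(0)]$ if $p<2$, and $u_r(x)=u(rx)-\sup_{|y|\le r}u(y)$ if $p=2$. A tangent to $u$ at $0$ is a function $U(x)=\lim_{s\downarrow 0}\operatorname{ess\,sup}_{B_s(x)}\overline U$, where $\overline U=\lim_{j} u_{r_j}$ in $L^1_{\rm loc}(\mathbf R^n)$ for some sequence of positive numbers $r_j\to 0$. Then for every tangent $U$ to $u$ at $0$: (1) $U$ is $F$-maximal on $\mathbf R^n\setminus\{0\}$; (2) if $U$ is finite-valued and continuous on $\mathbf R^n\setminus\{0\}$, then $U$ is $F$-harmonic on $\mathbf R^n\setminus\{0\}$; (3) if $p<2$, then $U$ is continuous and $F$-harmonic on $\mathbf R^n\setminus\{0\}$. -/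

import Mathlib

open Set Filter Topology MeasureTheory

/-- Euclidean `n`-space. -/
abbrev Euc (n : ℕ) : Type := EuclideanSpace ℝ (Fin n)

/-- Real `n × n` matrices. -/
abbrev Mat (n : ℕ) : Type := Matrix (Fin n) (Fin n) ℝ

/-- The space of symmetric matrices, as a set of matrices. -/
def symMat (n : ℕ) : Set (Mat n) := {A | A.IsSymm}

/-- A (constant coefficient, pure second-order) subequation: a closed set of symmetric matrices
that is stable under the addition of positive semidefinite matrices. -/
structure IsSubequation {n : ℕ} (F : Set (Mat n)) : Prop where
  subset_sym : F ⊆ symMat n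
  closed : IsClosed F
  positivity : ∀ A ∈ F, ∀ P : Mat n, P.PosSemidef → A + P ∈ F

/-- The cone property. -/
def IsConeSet {n : ℕ} (F : Set (Mat n)) : Prop :=
  ∀ t : ℝ, 0 ≤ t → ∀ A ∈ F, t • A ∈ F

/-- Spherical transitivity: `F` is invariant (under `A ↦ g A gᵀ`) for all `g` in some subgroup of
`O(n)` that acts transitively on the unit sphere. -/
def IsSTInvariant {n : ℕ} (F : Set (Mat n)) : Prop :=
  ∃ G : Subgroup (Matrix.orthogonalGroup (Fin n) ℝ),
    (∀ x y : Euc n, ‖x‖ = 1 → ‖y‖ = 1 →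
      ∃ g ∈ G, Matrix.mulVec (g : Mat n) x.ofLp = y.ofLp) ∧
    ∀ g ∈ G, ∀ A ∈ F, (g : Mat n) * A * (g : Mat n).transpose ∈ F

/-- The matrix `e eᵀ`; for a unit vector `e`, the orthogonal projection onto the line of `e`. -/
def projLine {n : ℕ} (e : Euc n) : Mat n := Matrix.of fun i j => e i * e j

/-- The (increasing) Riesz characteristic
`sup {p : P_{e^⊥} - (p - 1) P_e ∈ F for all unit vectors e}`, as an extended real. -/
noncomputable def rieszChar {n : ℕ} (F : Set (Mat n)) : EReal :=
  sSup {q : EReal | ∃ p : ℝ, q = (p : EReal) ∧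
    ∀ e : Euc n, ‖e‖ = 1 → (1 - projLine e) - (p - 1) • projLine e ∈ F}

/-- The Hessian matrix of `φ` at `x`. -/
noncomputable def hessian {n : ℕ} (φ : Euc n → ℝ) (x : Euc n) : Mat n :=
  Matrix.of fun i j =>
    fderiv ℝ (fderiv ℝ φ) x (EuclideanSpace.single i 1) (EuclideanSpace.single j 1)

/-- `u` is `F`-subharmonic on `X` (intended for open `X`): it is upper semicontinuous on `X` with
values in `[-∞, ∞)`, and every `C²` function touching `u` from above at a point of `X` has its
Hessian at that point in `F`. -/
structure IsSubharmonicOn {n : ℕ} (F : Set (Mat n)) (X : Set (Euc n)) (u : Euc n → EReal) :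
    Prop where
  usc : UpperSemicontinuousOn u X
  ne_top : ∀ x ∈ X, u x ≠ ⊤
  viscosity : ∀ x ∈ X, ∀ φ : Euc n → ℝ, ContDiffAt ℝ 2 φ x → u x = (φ x : EReal) →
    (∀ᶠ y in 𝓝 x, u y ≤ (φ y : EReal)) → hessian φ x ∈ F

/-- The dual subequation, the complement of `-Int F`; interior and complement are taken in the
space of symmetric matrices. -/
def dualSubequation {n : ℕ} (F : Set (Mat n)) : Set (Mat n) :=
  {A | A ∈ symMat n ∧ ¬ (F ∈ 𝓝[symMat n] (-A))}

/-- `u` is `F`-harmonic on `X`: `u` is `F`-subharmonic and `-u` is subharmonic for the dual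
subequation. In particular such a `u` is finite and continuous on an open `X`. -/
def IsHarmonicOn {n : ℕ} (F : Set (Mat n)) (X : Set (Euc n)) (u : Euc n → EReal) : Prop :=
  IsSubharmonicOn F X u ∧ IsSubharmonicOn (dualSubequation F) X (fun x => -u x)

/-- `u` is `F`-maximal on `X`. -/
def IsMaximalOn {n : ℕ} (F : Set (Mat n)) (X : Set (Euc n)) (u : Euc n → EReal) : Prop :=
  IsSubharmonicOn F X u ∧
    ∀ v : Euc n → EReal, IsSubharmonicOn F X v →
      ∀ K : Set (Euc n), IsCompact K → K ⊆ X →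
        (∀ x ∈ X \ K, v x ≤ u x) → ∀ x ∈ X, v x ≤ u x

/-- `M(u, r) = sup_{|x| ≤ r} u`. -/
noncomputable def ballMax {n : ℕ} (u : Euc n → EReal) (r : ℝ) : EReal :=
  ⨆ x ∈ Metric.closedBall (0 : Euc n) r, u x

/-- The tangential `p`-flow `u_r` at the origin. -/
noncomputable def tangentialFlow {n : ℕ} (p : ℝ) (u : Euc n → EReal) (r : ℝ) (x : Euc n) :
    EReal :=
  if 2 < p then ((r ^ (p - 2) : ℝ) : EReal) * u (r • x)
  else if p < 2 then ((1 / r ^ (2 - p) : ℝ) : EReal) * (u (r • x) - u 0)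
  else u (r • x) - ballMax u r

/-- `f j → g` in `L¹_loc(ℝⁿ)`. `EReal.abs` takes the value `⊤` at `±∞`, so that a function that is
infinite on a set of positive measure is at infinite distance from `g`. -/
def TendstoL1Loc {n : ℕ} (f : ℕ → Euc n → EReal) (g : Euc n → ℝ) : Prop :=
  LocallyIntegrable g volume ∧
    ∀ R : ℝ, 0 < R →
      Tendsto (fun j => ∫⁻ x in Metric.closedBall (0 : Euc n) R, (f j x - (g x : EReal)).abs)
        atTop (𝓝 0)

/-- `U` is a tangent to `u` at the origin (for the flow of exponent `p`): for some sequence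
`r j → 0` of positive numbers the functions `u_{r j}` converge in `L¹_loc(ℝⁿ)`, and `U` is the
representative `U(x) = lim_{s → 0} ess sup_{B_s(x)} Ubar` of the limit `Ubar`. -/
def IsTangentAtZero {n : ℕ} (p : ℝ) (u U : Euc n → EReal) : Prop :=
  ∃ (r : ℕ → ℝ) (Ubar : Euc n → ℝ),
    (∀ j, 0 < r j) ∧ Tendsto r atTop (𝓝 0) ∧
    TendstoL1Loc (fun j => tangentialFlow p u (r j)) Ubar ∧
    ∀ x : Euc n,
      Tendsto (fun s : ℝ =>
          essSup (fun y => (Ubar y : EReal)) (volume.restrict (Metric.closedBall x s)))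
        (𝓝[>] 0) (𝓝 (U x))

/-!
The stabilizer of `F` in `O(n)` is compact and transitive on spheres. Averaging an `F`-subharmonic
function over its orbits, with respect to Haar measure, produces a radial function which is a
convex function of the Riesz kernel `K_p(|x|)`. Indeed `P_{e^⊥} - (p - 1) P_e` lies on the
boundary of the convex cone `F`, so that some linear functional `ℓ` which is nonnegative on `F`
almost annihilates it, and `φ ↦ ℓ (D²φ)` almost annihilates `K_p(|x|)` at the points of the line
of `e`. Now `F`-subharmonic functions satisfy the submean inequality for the `ℓ`-harmonic measure
of a ball, this inequality survives averaging, and it excludes a touching from below by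
`α K_p(|x|) + ε |x|² + c` of the averages of a negated `F`-subharmonic function.

By the homogeneity of the tangential flow, the convex profile of a tangent `U` has the same slope
at every scale, so that the orbit mean of `U` is exactly `Θ K_p(|x|) + c`. If `v` is
`F`-subharmonic and `v ≤ U` off a compact set, then the orbit mean of `w = max U v` is a convex
function of `K_p(|x|)` which agrees with an affine one near `0` and near `∞`, hence lies below it.
Thus `U ≤ w` have equal orbit means, so `w = U` almost everywhere, and therefore everywhere. This
is maximality. A maximal `U` that is continuous is `F`-harmonic, as otherwise a test function
touching it from below could be raised to a larger competitor. For `p < 2`, comparison with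
`C |x - y| ^ (2 - q)`, `p < q < 2`, makes every `F`-subharmonic function continuous.
-/

open scoped ENNReal NNReal

variable {n : ℕ} {F : Set (Mat n)} {p : ℝ}

/-! ### Convex cone subequations and the Riesz characteristic -/

/-- The matrix `P_{e^⊥} - (q - 1) P_e` occurring in the definition of the Riesz characteristic. -/
def rieszMat (e : Euc n) (q : ℝ) : Mat n := (1 - projLine e) - (q - 1) • projLine e

lemma rieszMat_eq (e : Euc n) (q : ℝ) : rieszMat e q = 1 - q • projLine e := by
  unfold rieszMat; module

lemma projLine_eq_vecMulVec (e : Euc n) : projLine e = Matrix.vecMulVec e.ofLp e.ofLp := rfl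

lemma dotProduct_projLine_mulVec (e : Euc n) (v w : Fin n → ℝ) :
    v ⬝ᵥ (projLine e).mulVec w = (e.ofLp ⬝ᵥ v) * (e.ofLp ⬝ᵥ w) := by
  rw [projLine_eq_vecMulVec, Matrix.vecMulVec_mulVec, dotProduct_smul, dotProduct_comm v,
    op_smul_eq_mul]

lemma posSemidef_projLine (e : Euc n) : (projLine e).PosSemidef := by
  simpa [projLine_eq_vecMulVec] using Matrix.posSemidef_vecMulVec_self_star e.ofLp

lemma inner_eq_dotProduct (v w : Euc n) : inner ℝ v w = v.ofLp ⬝ᵥ w.ofLp := by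
  simp [EuclideanSpace.inner_eq_star_dotProduct, dotProduct_comm]

lemma posSemidef_one_sub_projLine {e : Euc n} (he : ‖e‖ = 1) : (1 - projLine e).PosSemidef := by
  refine Matrix.PosSemidef.of_dotProduct_mulVec_nonneg
    (Matrix.isHermitian_one.sub (posSemidef_projLine e).1) fun x => ?_
  have hcs := real_inner_mul_inner_self_le e (WithLp.toLp 2 x : Euc n)
  rw [real_inner_self_eq_norm_sq e, he, inner_eq_dotProduct, inner_eq_dotProduct] at hcs
  rw [star_trivial, Matrix.sub_mulVec, Matrix.one_mulVec, dotProduct_sub,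
    dotProduct_projLine_mulVec]
  linarith

lemma exists_norm_eq_one (hn : 0 < n) : ∃ e : Euc n, ‖e‖ = 1 :=
  ⟨EuclideanSpace.single ⟨0, hn⟩ 1, by simp⟩

lemma mul_transpose_orthogonal (g : Matrix.orthogonalGroup (Fin n) ℝ) :
    (g : Mat n) * (g : Mat n).transpose = 1 :=
  (Matrix.mem_orthogonalGroup_iff (Fin n) ℝ).1 g.2

lemma coe_inv_orthogonal (g : Matrix.orthogonalGroup (Fin n) ℝ) :
    ((g⁻¹ : Matrix.orthogonalGroup (Fin n) ℝ) : Mat n) = (g : Mat n).transpose := rfl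

/-- The stabilizer of `F` in the orthogonal group acting by `A ↦ g A gᵀ`. -/
def orthogonalStabilizer (F : Set (Mat n)) : Subgroup (Matrix.orthogonalGroup (Fin n) ℝ) where
  carrier := {g | ∀ A ∈ F, (g : Mat n) * A * (g : Mat n).transpose ∈ F ∧
    (g : Mat n).transpose * A * (g : Mat n) ∈ F}
  mul_mem' {g h} hg hh A hA := by
    constructor
    · simpa [Matrix.mul_assoc] using (hg _ (hh A hA).1).1
    · simpa [Matrix.mul_assoc] using (hh _ (hg A hA).2).2
  one_mem' A hA := by simpa using hA
  inv_mem' {g} hg A hA := by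
    rw [coe_inv_orthogonal, Matrix.transpose_transpose]
    exact (hg A hA).symm

lemma IsSTInvariant.exists_orthogonalStabilizer (h : IsSTInvariant F) {x y : Euc n}
    (hx : ‖x‖ = 1) (hy : ‖y‖ = 1) :
    ∃ g ∈ orthogonalStabilizer F, (g : Mat n).mulVec x.ofLp = y.ofLp := by
  obtain ⟨G, hG, hGF⟩ := h
  obtain ⟨g, hg, hxy⟩ := hG x y hx hy
  refine ⟨g, fun A hA => ⟨hGF g hg A hA, ?_⟩, hxy⟩
  have := hGF g⁻¹ (G.inv_mem hg) A hA
  rwa [coe_inv_orthogonal, Matrix.transpose_transpose] at this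

lemma conj_rieszMat (g : Matrix.orthogonalGroup (Fin n) ℝ) {x y : Euc n}
    (h : (g : Mat n).mulVec x.ofLp = y.ofLp) (q : ℝ) :
    (g : Mat n) * rieszMat x q * (g : Mat n).transpose = rieszMat y q := by
  rw [rieszMat_eq, rieszMat_eq, mul_sub, sub_mul, mul_one, mul_transpose_orthogonal,
    projLine_eq_vecMulVec, projLine_eq_vecMulVec, mul_smul_comm, smul_mul_assoc,
    Matrix.mul_vecMulVec, Matrix.vecMulVec_mul, h, Matrix.vecMul_transpose, h]

/-- The standing assumptions on `F`: it is a convex, spherically transitive cone subequation of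
finite Riesz characteristic `p`. -/
structure IsRieszCone (F : Set (Mat n)) (p : ℝ) : Prop where
  isSubequation : IsSubequation F
  isConeSet : IsConeSet F
  isSTInvariant : IsSTInvariant F
  convex : Convex ℝ F
  rieszChar_eq : rieszChar F = p

lemma dim_pos_of_rieszChar_eq (h : rieszChar F = p) : 0 < n := by
  by_contra hn
  obtain rfl : n = 0 := by lia
  have hle : ((p + 1 : ℝ) : EReal) ≤ rieszChar F := by
    refine le_sSup ⟨p + 1, rfl, fun e he => ?_⟩
    rw [Subsingleton.elim e 0, norm_zero] at he
    exact absurd he zero_ne_one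
  rw [h, EReal.coe_le_coe_iff] at hle
  linarith

lemma IsSubequation.rieszMat_mem_of_lt (hF : IsSubequation F) {q : ℝ}
    (hq : (q : EReal) < rieszChar F) {e : Euc n} (he : ‖e‖ = 1) : rieszMat e q ∈ F := by
  obtain ⟨_, ⟨r, rfl, hr⟩, hqr⟩ := lt_sSup_iff.1 hq
  have hqr' : q < r := EReal.coe_lt_coe_iff.1 hqr
  have hsum : rieszMat e q = rieszMat e r + (r - q) • projLine e := by
    rw [rieszMat_eq, rieszMat_eq]; module
  rw [hsum]
  exact hF.positivity _ (hr e he) _ ((posSemidef_projLine e).smul (by linarith))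

lemma IsSubequation.rieszMat_mem (hF : IsSubequation F) (hp : rieszChar F = p) {e : Euc n}
    (he : ‖e‖ = 1) : rieszMat e p ∈ F := by
  have hcont : Continuous (rieszMat e) := by
    simp only [funext (rieszMat_eq e)]; fun_prop
  refine hF.closed.mem_of_tendsto (hcont.continuousWithinAt (s := Iio p) (x := p))
    (eventually_mem_nhdsWithin.mono fun q hq => hF.rieszMat_mem_of_lt ?_ he)
  rw [hp]; exact EReal.coe_lt_coe_iff.2 hq

lemma IsSTInvariant.rieszMat_notMem (hF : IsSTInvariant F) {q : ℝ} (hq : rieszChar F < q)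
    {e : Euc n} (he : ‖e‖ = 1) : rieszMat e q ∉ F := by
  refine fun hmem => hq.not_ge (le_sSup ⟨q, rfl, fun e' he' => ?_⟩)
  obtain ⟨g, hg, hge⟩ := hF.exists_orthogonalStabilizer he he'
  have := (hg _ hmem).1
  rwa [conj_rieszMat g hge] at this

lemma IsConeSet.zero_mem (hF : IsConeSet F) (hne : F.Nonempty) : (0 : Mat n) ∈ F := by
  obtain ⟨A, hA⟩ := hne
  simpa using hF 0 le_rfl A hA

lemma IsSubequation.posSemidef_mem (hF : IsSubequation F) (h0 : (0 : Mat n) ∈ F) {P : Mat n}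
    (hP : P.PosSemidef) : P ∈ F := by
  simpa using hF.positivity 0 h0 P hP

namespace IsRieszCone

lemma dim_pos (hF : IsRieszCone F p) : 0 < n := dim_pos_of_rieszChar_eq hF.rieszChar_eq

lemma rieszMat_mem (hF : IsRieszCone F p) {e : Euc n} (he : ‖e‖ = 1) : rieszMat e p ∈ F :=
  hF.isSubequation.rieszMat_mem hF.rieszChar_eq he

lemma rieszMat_notMem (hF : IsRieszCone F p) {q : ℝ} (hq : p < q) {e : Euc n} (he : ‖e‖ = 1) :
    rieszMat e q ∉ F :=
  hF.isSTInvariant.rieszMat_notMem (by rw [hF.rieszChar_eq]; exact EReal.coe_lt_coe_iff.2 hq) he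

lemma zero_mem (hF : IsRieszCone F p) : (0 : Mat n) ∈ F := by
  obtain ⟨e, he⟩ := exists_norm_eq_one hF.dim_pos
  exact hF.isConeSet.zero_mem ⟨_, hF.rieszMat_mem he⟩

lemma posSemidef_mem (hF : IsRieszCone F p) {P : Mat n} (hP : P.PosSemidef) : P ∈ F :=
  hF.isSubequation.posSemidef_mem hF.zero_mem hP

lemma one_le (hF : IsRieszCone F p) : 1 ≤ p := by
  by_contra! hlt
  obtain ⟨e, he⟩ := exists_norm_eq_one hF.dim_pos
  refine hF.rieszMat_notMem hlt he (hF.posSemidef_mem ?_)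
  rw [rieszMat_eq, one_smul]
  exact posSemidef_one_sub_projLine he

end IsRieszCone

lemma IsConeSet.exists_separating (hF : IsConeSet F) (hconv : Convex ℝ F) (hcl : IsClosed F)
    (hne : F.Nonempty) {A : Mat n} (hA : A ∉ F) :
    ∃ f : Mat n →L[ℝ] ℝ, (∀ B ∈ F, 0 ≤ f B) ∧ f A < 0 := by
  have : LocallyConvexSpace ℝ (Mat n) :=
    inferInstanceAs (LocallyConvexSpace ℝ (Fin n → Fin n → ℝ))
  obtain ⟨f, c, hfA, hf⟩ := geometric_hahn_banach_point_closed hconv hcl hA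
  have hc : c < 0 := by simpa using hf 0 (hF.zero_mem hne)
  refine ⟨f, fun B hB => ?_, hfA.trans hc⟩
  by_contra! hneg
  have := hf _ (hF (c / f B) (div_nonneg_of_nonpos hc.le hneg.le) B hB)
  rw [map_smul, smul_eq_mul, div_mul_cancel₀ _ hneg.ne] at this
  exact lt_irrefl _ this

/-- `ℓ` is an element of the polar cone of `F` that annihilates `P_{e^⊥} - (p - 1) P_e` up to an
error `δ`, normalized by `ℓ (P_e) = 1`. -/
structure IsSupportFunctional (F : Set (Mat n)) (p δ : ℝ) (e : Euc n) (ℓ : Mat n →L[ℝ] ℝ) :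
    Prop where
  nonneg : ∀ A ∈ F, 0 ≤ ℓ A
  map_projLine : ℓ (projLine e) = 1
  le_map_one : p ≤ ℓ 1
  map_one_lt : ℓ 1 < p + δ

lemma IsRieszCone.exists_isSupportFunctional (hF : IsRieszCone F p) {δ : ℝ} (hδ : 0 < δ)
    {e : Euc n} (he : ‖e‖ = 1) : ∃ ℓ, IsSupportFunctional F p δ e ℓ := by
  obtain ⟨f, hf, hlt⟩ := hF.isConeSet.exists_separating hF.convex hF.isSubequation.closed
    ⟨0, hF.zero_mem⟩ (hF.rieszMat_notMem (show p < p + δ by linarith) he)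
  have hge := hf _ (hF.rieszMat_mem he)
  rw [rieszMat_eq, map_sub, map_smul, smul_eq_mul] at hge hlt
  have hproj := hf _ (hF.posSemidef_mem (posSemidef_projLine e))
  have hone := hf _ (hF.posSemidef_mem Matrix.PosSemidef.one)
  have hpos : 0 < f (projLine e) := hproj.lt_of_ne fun h0 => by
    rw [← h0, mul_zero, sub_zero] at hlt; linarith
  refine ⟨(f (projLine e))⁻¹ • f, fun A hA => ?_, ?_, ?_, ?_⟩
  · simpa using mul_nonneg (inv_nonneg.2 hproj) (hf A hA)
  · simp [hpos.ne']
  · rw [FunLike.coe_smul, Pi.smul_apply, smul_eq_mul, inv_mul_eq_div,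
      le_div_iff₀ hpos]; linarith
  · rw [FunLike.coe_smul, Pi.smul_apply, smul_eq_mul, inv_mul_eq_div,
      div_lt_iff₀ hpos]; linarith

/-! ### Hessians -/

section Fderiv

variable {E E' G : Type*} [NormedAddCommGroup E] [NormedSpace ℝ E] [NormedAddCommGroup E']
  [NormedSpace ℝ E'] [NormedAddCommGroup G] [NormedSpace ℝ G]

lemma differentiableAt_fderiv_of_contDiffAt_two {φ : E → G} {x : E} (h : ContDiffAt ℝ 2 φ x) :
    DifferentiableAt ℝ (fderiv ℝ φ) x :=
  (h.fderiv_right (m := 1) (by norm_num)).differentiableAt (by norm_num)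

lemma eventually_differentiableAt_of_contDiffAt_two {φ : E → G} {x : E}
    (h : ContDiffAt ℝ 2 φ x) : ∀ᶠ y in 𝓝 x, DifferentiableAt ℝ φ y :=
  (h.eventually (by simp)).mono fun _ hy => hy.differentiableAt (by norm_num)

lemma fderiv_comp_affine (φ : E' → G) (T : E ≃L[ℝ] E') (b : E') (y : E) :
    fderiv ℝ (fun y => φ (T y + b)) y = (fderiv ℝ φ (T y + b)).comp (T : E →L[ℝ] E') := by
  have h := T.comp_right_fderiv (f := fun z => φ (z + b)) (x := y)
  rwa [show fderiv ℝ (fun z => φ (z + b)) (T y) = fderiv ℝ φ (T y + b) from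
    fderiv_comp_add_right b] at h

lemma fderiv_fderiv_comp_affine {φ : E' → G} (T : E ≃L[ℝ] E') {b : E'} {x : E}
    (h : ContDiffAt ℝ 2 φ (T x + b)) (v w : E) :
    fderiv ℝ (fderiv ℝ (fun y => φ (T y + b))) x v w =
      fderiv ℝ (fderiv ℝ φ) (T x + b) (T v) (T w) := by
  have hT : HasFDerivAt (fun y => T y + b) (T : E →L[ℝ] E') x := T.hasFDerivAt.add_const b
  have hφ := (differentiableAt_fderiv_of_contDiffAt_two h).hasFDerivAt.comp x hT
  have hcomp := hφ.clm_comp (hasFDerivAt_const (T : E →L[ℝ] E') x)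
  rw [funext (fderiv_comp_affine φ T b)]
  refine (congrArg (fun S => S v w) hcomp.fderiv).trans ?_
  simp

lemma contDiffAt_comp_affine {φ : E' → G} (T : E ≃L[ℝ] E') {b : E'} {x : E}
    (h : ContDiffAt ℝ 2 φ (T x + b)) : ContDiffAt ℝ 2 (fun y => φ (T y + b)) x :=
  h.comp x (T.contDiff.contDiffAt.add contDiffAt_const)

end Fderiv

lemma fderiv_fderiv_eq_dotProduct_hessian (φ : Euc n → ℝ) (x v w : Euc n) :
    fderiv ℝ (fderiv ℝ φ) x v w = v.ofLp ⬝ᵥ (hessian φ x).mulVec w.ofLp := by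
  have hsum : ∀ v : Euc n, v = ∑ i, v i • EuclideanSpace.single i (1 : ℝ) := by
    intro v; ext j; simp [Finset.sum_apply, Pi.single_apply]
  conv_lhs => rw [hsum v, hsum w]
  simp only [map_sum, map_smul, FunLike.coe_sum, Finset.sum_apply, FunLike.coe_smul,
    Pi.smul_apply, smul_eq_mul, dotProduct, Matrix.mulVec, hessian, Matrix.of_apply,
    Finset.mul_sum]
  rw [Finset.sum_comm]
  exact Finset.sum_congr rfl fun i _ => Finset.sum_congr rfl fun j _ => by ring

lemma hessian_eq_of_fderiv_fderiv {φ : Euc n → ℝ} {x : Euc n} {A : Mat n}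
    (h : ∀ v w : Euc n, fderiv ℝ (fderiv ℝ φ) x v w = v.ofLp ⬝ᵥ A.mulVec w.ofLp) :
    hessian φ x = A := by
  ext i j
  simp [hessian, h]

lemma isSymm_hessian {φ : Euc n → ℝ} {x : Euc n} (h : ContDiffAt ℝ 2 φ x) :
    (hessian φ x).IsSymm := by
  ext i j
  simpa [hessian] using (h.isSymmSndFDerivAt (by simp)).eq _ _

lemma continuousAt_hessian {φ : Euc n → ℝ} {x : Euc n} (h : ContDiffAt ℝ 2 φ x) :
    ContinuousAt (hessian φ) x := by
  have hcont : ContinuousAt (fderiv ℝ (fderiv ℝ φ)) x :=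
    ((h.fderiv_right (m := 1) (by norm_num)).fderiv_right (m := 0) (by norm_num)).continuousAt
  exact tendsto_pi_nhds.2 fun i => tendsto_pi_nhds.2 fun j =>
    (hcont.clm_apply continuousAt_const).clm_apply continuousAt_const

lemma hessian_add {φ ψ : Euc n → ℝ} {x : Euc n} (hφ : ContDiffAt ℝ 2 φ x)
    (hψ : ContDiffAt ℝ 2 ψ x) :
    hessian (fun y => φ y + ψ y) x = hessian φ x + hessian ψ x := by
  have hev : fderiv ℝ (fun y => φ y + ψ y) =ᶠ[𝓝 x] fun y => fderiv ℝ φ y + fderiv ℝ ψ y := by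
    filter_upwards [eventually_differentiableAt_of_contDiffAt_two hφ,
      eventually_differentiableAt_of_contDiffAt_two hψ] with y hy hy'
    exact fderiv_fun_add hy hy'
  ext i j
  simp only [hessian, Matrix.of_apply, Matrix.add_apply]
  rw [hev.fderiv_eq, fderiv_fun_add (differentiableAt_fderiv_of_contDiffAt_two hφ)
    (differentiableAt_fderiv_of_contDiffAt_two hψ)]
  rfl

lemma hessian_const_mul {φ : Euc n → ℝ} {x : Euc n} (h : ContDiffAt ℝ 2 φ x) (c : ℝ) :
    hessian (fun y => c * φ y) x = c • hessian φ x := by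
  have hev : fderiv ℝ (fun y => c * φ y) =ᶠ[𝓝 x] fun y => c • fderiv ℝ φ y :=
    (eventually_differentiableAt_of_contDiffAt_two h).mono fun y hy => fderiv_const_mul hy c
  ext i j
  simp only [hessian, Matrix.of_apply, Matrix.smul_apply]
  rw [hev.fderiv_eq, fderiv_fun_const_smul (differentiableAt_fderiv_of_contDiffAt_two h)]
  rfl

lemma hessian_const (c : ℝ) (x : Euc n) : hessian (fun _ => c) x = 0 := by
  ext i j
  simp [hessian]

lemma hessian_add_const (φ : Euc n → ℝ) (c : ℝ) (x : Euc n) :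
    hessian (fun y => φ y + c) x = hessian φ x := by
  unfold hessian
  rw [show fderiv ℝ (fun y => φ y + c) = fderiv ℝ φ from funext fun y => fderiv_add_const c]

lemma hessian_neg (φ : Euc n → ℝ) (x : Euc n) :
    hessian (fun y => -φ y) x = -hessian φ x := by
  ext i j
  simp [hessian, funext fun y => fderiv_fun_neg (𝕜 := ℝ) (f := φ) (x := y), fderiv_fun_neg]

lemma hessian_smul_add {φ : Euc n → ℝ} {c : ℝ} (hc : c ≠ 0) {b x : Euc n}
    (h : ContDiffAt ℝ 2 φ (c • x + b)) :
    hessian (fun y => φ (c • y + b)) x = c ^ 2 • hessian φ (c • x + b) := by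
  refine hessian_eq_of_fderiv_fderiv fun v w => ?_
  have := fderiv_fderiv_comp_affine
    (ContinuousLinearEquiv.smulLeft (Units.mk0 c hc) : Euc n ≃L[ℝ] Euc n) (b := b) (x := x) h v w
  simp only [ContinuousLinearEquiv.smulLeft_apply_apply, Units.smul_mk0] at this
  simp only [this, map_smul, FunLike.coe_smul, Pi.smul_apply, smul_eq_mul,
    fderiv_fderiv_eq_dotProduct_hessian, Matrix.smul_mulVec, dotProduct_smul]
  ring

lemma hessian_comp_normSq_sub {k k₁ : ℝ → ℝ} {k₂ : ℝ} {c x : Euc n}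
    (hk : ∀ᶠ t in 𝓝 (‖x - c‖ ^ 2), HasDerivAt k (k₁ t) t)
    (hk₁ : HasDerivAt k₁ k₂ (‖x - c‖ ^ 2)) :
    hessian (fun y => k (‖y - c‖ ^ 2)) x =
      (2 * k₁ (‖x - c‖ ^ 2)) • (1 : Mat n) + (4 * k₂) • projLine (x - c) := by
  have hsq : ∀ y : Euc n, HasFDerivAt (fun y : Euc n => ‖y - c‖ ^ 2)
      ((2 : ℕ) • innerSL ℝ (y - c)) y := fun y => by
    simpa using ((hasFDerivAt_id y).sub_const c).norm_sq
  have hcont : ContinuousAt (fun y : Euc n => ‖y - c‖ ^ 2) x := by fun_prop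
  have hfirst : fderiv ℝ (fun y => k (‖y - c‖ ^ 2)) =ᶠ[𝓝 x] fun y =>
      k₁ (‖y - c‖ ^ 2) • ((2 : ℕ) • innerSL ℝ (y - c)) :=
    (hcont.eventually hk).mono fun y hy => (hy.comp_hasFDerivAt y (hsq y)).fderiv
  have hinner : HasFDerivAt (fun y : Euc n => (2 : ℕ) • innerSL ℝ (y - c))
      ((2 : ℕ) • (innerSL ℝ : Euc n →L[ℝ] Euc n →L[ℝ] ℝ)) x :=
    (((innerSL ℝ : Euc n →L[ℝ] Euc n →L[ℝ] ℝ).hasFDerivAt (x := x - c)).comp x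
      (hasFDerivAt_sub_const c)).const_smul (2 : ℕ)
  have hsecond := ((hk₁.comp_hasFDerivAt x (hsq x)).smul hinner).fderiv
  refine hessian_eq_of_fderiv_fderiv fun v w => ?_
  rw [hfirst.fderiv_eq]
  refine (congrArg (fun S => S v w) hsecond).trans ?_
  rw [Matrix.add_mulVec, Matrix.smul_mulVec, Matrix.smul_mulVec, Matrix.one_mulVec,
    dotProduct_add, dotProduct_smul, dotProduct_smul, dotProduct_projLine_mulVec,
    ← inner_eq_dotProduct, ← inner_eq_dotProduct, ← inner_eq_dotProduct]
  have hvw : (innerSL ℝ v) w = inner ℝ v w := rfl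
  simp only [Function.comp_apply, add_apply, smul_apply, ContinuousLinearMap.smulRight_apply,
    nsmul_eq_mul, Nat.cast_ofNat, smul_eq_mul, hvw, coe_innerSL_apply]
  ring

lemma contDiffAt_comp_normSq_sub {k : ℝ → ℝ} {c x : Euc n}
    (hk : ContDiffAt ℝ 2 k (‖x - c‖ ^ 2)) : ContDiffAt ℝ 2 (fun y => k (‖y - c‖ ^ 2)) x :=
  hk.comp x ((contDiff_id.sub contDiff_const).norm_sq ℝ).contDiffAt

lemma hessian_const_mul_normSq_sub (ε : ℝ) (c x : Euc n) :
    hessian (fun y => ε * ‖y - c‖ ^ 2) x = (2 * ε) • (1 : Mat n) := by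
  simpa using hessian_comp_normSq_sub (k := fun t => ε * t) (k₁ := fun _ => ε) (k₂ := 0)
    (Eventually.of_forall fun t => by simpa using (hasDerivAt_id t).const_mul ε)
    (hasDerivAt_const (‖x - c‖ ^ 2) ε)

lemma contDiffAt_const_mul_normSq_sub (ε : ℝ) (c x : Euc n) :
    ContDiffAt ℝ 2 (fun y => ε * ‖y - c‖ ^ 2) x :=
  contDiffAt_comp_normSq_sub (k := fun t => ε * t) (by fun_prop)

lemma second_deriv_nonneg_of_isLocalMin {f f' : ℝ → ℝ} {f'' a : ℝ}
    (hf : ∀ᶠ t in 𝓝 a, HasDerivAt f (f' t) t) (hf' : HasDerivAt f' f'' a)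
    (hmin : IsLocalMin f a) : 0 ≤ f'' := by
  by_contra! hneg
  have hderiv : deriv (-f) =ᶠ[𝓝 a] -f' := hf.mono fun t ht => ht.neg.deriv
  have hmax : IsLocalMin (-f) a := isLocalMin_of_deriv_deriv_pos
    (by rw [hderiv.deriv_eq, hf'.neg.deriv]; linarith)
    (by rw [hf.self_of_nhds.neg.deriv, hmin.hasDerivAt_eq_zero hf.self_of_nhds, neg_zero])
    hf.self_of_nhds.continuousAt.neg
  have hconst : f =ᶠ[𝓝 a] fun _ => f a := by
    filter_upwards [hmin, hmax] with t h1 h2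
    exact le_antisymm (neg_le_neg_iff.1 h2) h1
  have hzero : f' =ᶠ[𝓝 a] fun _ => 0 := by
    filter_upwards [hf, hconst.eventually_nhds] with t ht htc
    exact ht.unique ((hasDerivAt_const t (f a)).congr_of_eventuallyEq htc)
  exact hneg.ne (hf'.unique ((hasDerivAt_const a (0 : ℝ)).congr_of_eventuallyEq hzero))

lemma posSemidef_hessian_of_isLocalMin {φ : Euc n → ℝ} {x : Euc n} (h : ContDiffAt ℝ 2 φ x)
    (hmin : IsLocalMin φ x) : (hessian φ x).PosSemidef := by
  refine Matrix.PosSemidef.of_dotProduct_mulVec_nonneg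
    (Matrix.isHermitian_iff_isSymm.2 (isSymm_hessian h)) fun v => ?_
  obtain ⟨w, rfl⟩ : ∃ w : Euc n, w.ofLp = v := ⟨WithLp.toLp 2 v, rfl⟩
  rw [star_trivial, ← fderiv_fderiv_eq_dotProduct_hessian]
  have hline : ∀ t, HasDerivAt (fun t : ℝ => x + t • w) w t := fun t => by
    simpa using ((hasDerivAt_id t).smul_const w).const_add x
  have hzero : x + (0 : ℝ) • w = x := by simp
  have htend : Tendsto (fun t : ℝ => x + t • w) (𝓝 0) (𝓝 x) := by
    simpa only [hzero] using (hline 0).continuousAt.tendsto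
  have hfirst : ∀ᶠ t in 𝓝 (0 : ℝ),
      HasDerivAt (fun t : ℝ => φ (x + t • w)) (fderiv ℝ φ (x + t • w) w) t := by
    filter_upwards [htend.eventually (eventually_differentiableAt_of_contDiffAt_two h)] with t ht
    exact ht.hasFDerivAt.comp_hasDerivAt t (hline t)
  have hsecond : HasDerivAt (fun t : ℝ => fderiv ℝ φ (x + t • w) w)
      (fderiv ℝ (fderiv ℝ φ) x w w) 0 := by
    have hd : HasFDerivAt (fderiv ℝ φ) (fderiv ℝ (fderiv ℝ φ) x) (x + (0 : ℝ) • w) := by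
      rw [hzero]; exact (differentiableAt_fderiv_of_contDiffAt_two h).hasFDerivAt
    have hcomp := hd.comp_hasDerivAt (0 : ℝ) (hline 0)
    simpa using hcomp.clm_apply (hasDerivAt_const (0 : ℝ) w)
  refine second_deriv_nonneg_of_isLocalMin hfirst hsecond ?_
  simpa only [IsLocalMin, IsMinFilter, hzero] using htend.eventually hmin

/-! ### Operations on subharmonic functions -/

namespace IsSubharmonicOn

variable {X Y : Set (Euc n)} {u v : Euc n → EReal}

lemma mono (h : IsSubharmonicOn F X u) (hY : Y ⊆ X) : IsSubharmonicOn F Y u :=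
  ⟨h.usc.mono hY, fun x hx => h.ne_top x (hY hx), fun x hx => h.viscosity x (hY hx)⟩

lemma mono_subequation {F' : Set (Mat n)} (h : IsSubharmonicOn F X u) (hF : F ⊆ F') :
    IsSubharmonicOn F' X u :=
  ⟨h.usc, h.ne_top, fun x hx φ hφ heq hle => hF (h.viscosity x hx φ hφ heq hle)⟩

lemma sup (hu : IsSubharmonicOn F X u) (hv : IsSubharmonicOn F X v) :
    IsSubharmonicOn F X (fun x => max (u x) (v x)) := by
  refine ⟨hu.usc.sup hv.usc, fun x hx => ?_, fun x hx φ hφ heq hle => ?_⟩ <;>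
    rcases max_choice (u x) (v x) with h | h
  · rw [h]; exact hu.ne_top x hx
  · rw [h]; exact hv.ne_top x hx
  · exact hu.viscosity x hx φ hφ (h ▸ heq) (hle.mono fun y hy => (le_max_left _ _).trans hy)
  · exact hv.viscosity x hx φ hφ (h ▸ heq) (hle.mono fun y hy => (le_max_right _ _).trans hy)

lemma of_locally_eq
    (h : ∀ x ∈ X, ∃ w : Euc n → EReal, ∃ V ∈ 𝓝 x, IsSubharmonicOn F V w ∧ u =ᶠ[𝓝 x] w) :
    IsSubharmonicOn F X u := by
  refine ⟨fun x hx => ?_, fun x hx => ?_, fun x hx φ hφ heq hle => ?_⟩ <;>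
    obtain ⟨w, V, hV, hw, huw⟩ := h x hx
  · have hwx : UpperSemicontinuousAt w x := fun y hy => by
      have := hw.usc x (mem_of_mem_nhds hV) y hy
      rwa [nhdsWithin_eq_nhds.2 hV] at this
    refine UpperSemicontinuousAt.upperSemicontinuousWithinAt _ fun y hy => ?_
    have hy' : w x < y := huw.self_of_nhds ▸ hy
    filter_upwards [hwx y hy', huw] with z hz hz'
    rwa [hz']
  · rw [huw.self_of_nhds]; exact hw.ne_top x (mem_of_mem_nhds hV)
  · refine hw.viscosity x (mem_of_mem_nhds hV) φ hφ (huw.self_of_nhds ▸ heq) ?_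
    filter_upwards [hle, huw] with z hz hz'
    rwa [← hz']

lemma comp_affine (hu : IsSubharmonicOn F X u) (T : Euc n ≃L[ℝ] Euc n) (b : Euc n)
    (hT : ∀ (ψ : Euc n → ℝ) (x : Euc n), ContDiffAt ℝ 2 ψ (T x + b) →
      hessian ψ (T x + b) ∈ F → hessian (fun y => ψ (T y + b)) x ∈ F) :
    IsSubharmonicOn F ((fun y => T y + b) ⁻¹' X) (fun y => u (T y + b)) := by
  have hcont : Continuous fun y => T y + b := by fun_prop
  refine ⟨fun x hx y hy => ?_, fun x hx => hu.ne_top _ hx, fun x hx φ hφ heq hle => ?_⟩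
  · exact (hcont.continuousWithinAt.tendsto_nhdsWithin fun z hz => hz).eventually
      (hu.usc _ hx y hy)
  let S : Euc n → Euc n := fun z => T.symm z + -T.symm b
  have hST : ∀ y, S (T y + b) = y := fun y => by simp [S]
  have hTS : ∀ z, T (S z) + b = z := fun z => by simp [S]
  have hψ : ContDiffAt ℝ 2 (fun z => φ (S z)) (T x + b) :=
    contDiffAt_comp_affine T.symm (by rwa [show T.symm (T x + b) + -T.symm b = x from hST x])
  have htend : Tendsto S (𝓝 (T x + b)) (𝓝 x) := by
    have : ContinuousAt S (T x + b) := by fun_prop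
    simpa only [hST] using this.tendsto
  have hmem : hessian (fun z => φ (S z)) (T x + b) ∈ F := by
    refine hu.viscosity _ hx _ hψ (by simpa only [hST] using heq) ?_
    filter_upwards [htend.eventually hle] with z hz
    rwa [hTS] at hz
  simpa only [hST] using hT (fun z => φ (S z)) x hψ hmem

lemma comp_smul_add (hu : IsSubharmonicOn F X u) (hF : IsConeSet F) {c : ℝ} (hc : c ≠ 0)
    (b : Euc n) : IsSubharmonicOn F ((fun y => c • y + b) ⁻¹' X) (fun y => u (c • y + b)) := by
  refine hu.comp_affine (ContinuousLinearEquiv.smulLeft (Units.mk0 c hc) : Euc n ≃L[ℝ] Euc n) b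
    fun ψ x hψ hmem => ?_
  change hessian (fun y => ψ (c • y + b)) x ∈ F
  rw [hessian_smul_add hc hψ]
  exact hF _ (by positivity) _ hmem

end IsSubharmonicOn

/-- The linear isometry of Euclidean space given by an orthogonal matrix. -/
noncomputable def rot : Matrix.orthogonalGroup (Fin n) ℝ →* (Euc n ≃ₗᵢ[ℝ] Euc n) where
  toFun g := Unitary.linearIsometryEquiv ⟨Matrix.toEuclideanCLM (n := Fin n) (𝕜 := ℝ) g,
    Unitary.map_mem (Matrix.toEuclideanCLM (n := Fin n) (𝕜 := ℝ)) g.2⟩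
  map_one' := LinearIsometryEquiv.ext fun x => by
    change Matrix.toEuclideanCLM (n := Fin n) (𝕜 := ℝ) 1 x = x
    simp
  map_mul' g h := LinearIsometryEquiv.ext fun x => by
    change Matrix.toEuclideanCLM (n := Fin n) (𝕜 := ℝ) ((g : Mat n) * (h : Mat n)) x =
      Matrix.toEuclideanCLM (n := Fin n) (𝕜 := ℝ) (g : Mat n)
        (Matrix.toEuclideanCLM (n := Fin n) (𝕜 := ℝ) (h : Mat n) x)
    simp

lemma ofLp_rot (g : Matrix.orthogonalGroup (Fin n) ℝ) (x : Euc n) :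
    (rot g x).ofLp = (g : Mat n).mulVec x.ofLp := rfl

lemma hessian_comp_rot_add {ψ : Euc n → ℝ} (g : Matrix.orthogonalGroup (Fin n) ℝ) {b x : Euc n}
    (h : ContDiffAt ℝ 2 ψ (rot g x + b)) :
    hessian (fun y => ψ (rot g y + b)) x =
      (g : Mat n).transpose * hessian ψ (rot g x + b) * (g : Mat n) := by
  refine hessian_eq_of_fderiv_fderiv fun v w => ?_
  have hcomp := fderiv_fderiv_comp_affine (rot g).toContinuousLinearEquiv h v w
  simp only [LinearIsometryEquiv.coe_toContinuousLinearEquiv] at hcomp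
  rw [hcomp, fderiv_fderiv_eq_dotProduct_hessian, ofLp_rot, ofLp_rot, ← Matrix.mulVec_mulVec,
    ← Matrix.mulVec_mulVec, Matrix.dotProduct_mulVec v.ofLp, Matrix.vecMul_transpose]

lemma IsSubharmonicOn.comp_rot_add {X : Set (Euc n)} {u : Euc n → EReal}
    (hu : IsSubharmonicOn F X u) {g : Matrix.orthogonalGroup (Fin n) ℝ}
    (hg : g ∈ orthogonalStabilizer F) (b : Euc n) :
    IsSubharmonicOn F ((fun y => rot g y + b) ⁻¹' X) (fun y => u (rot g y + b)) :=
  hu.comp_affine (rot g).toContinuousLinearEquiv b fun ψ x hψ hmem => by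
    have := hessian_comp_rot_add g hψ
    exact this ▸ (hg _ hmem).2

lemma ereal_mul_add_le_coe_iff {a b : ℝ} (ha : 0 < a) (x : EReal) (y : ℝ) :
    (a : EReal) * x + b ≤ y ↔ x ≤ ((y - b) / a : ℝ) := by
  induction x with
  | bot => simp [EReal.coe_mul_bot_of_pos ha]
  | top => simp [EReal.coe_mul_top_of_pos ha, -EReal.coe_sub]
  | coe x =>
    norm_cast
    rw [le_div_iff₀ ha]
    constructor <;> intro h <;> linarith

lemma ereal_mul_add_eq_coe_iff {a b : ℝ} (ha : 0 < a) (x : EReal) (y : ℝ) :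
    (a : EReal) * x + b = y ↔ x = ((y - b) / a : ℝ) := by
  induction x with
  | bot => simp [EReal.coe_mul_bot_of_pos ha, -EReal.coe_sub]
  | top => simp [EReal.coe_mul_top_of_pos ha, -EReal.coe_sub]
  | coe x =>
    norm_cast
    rw [eq_div_iff ha.ne']
    constructor <;> intro h <;> linarith

lemma continuous_ereal_mul_add (a b : ℝ) : Continuous fun t : EReal => (a : EReal) * t + b := by
  have hmul : Continuous fun t : EReal => (a : EReal) * t :=
    continuous_iff_continuousAt.2 fun t => EReal.Tendsto.const_mul tendsto_id
      (Or.inl (EReal.coe_ne_bot a)) (Or.inl (EReal.coe_ne_top a))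
  refine continuous_iff_continuousAt.2 fun t => ?_
  have hadd : ContinuousAt (fun q : EReal × EReal => q.1 + q.2) ((a : EReal) * t, (b : EReal)) :=
    EReal.continuousAt_add (by simp) (by simp)
  exact hadd.comp (f := fun t : EReal => ((a : EReal) * t, (b : EReal)))
    (hmul.continuousAt.prodMk continuousAt_const)

lemma IsSubharmonicOn.mul_add_const {X : Set (Euc n)} {u : Euc n → EReal}
    (hu : IsSubharmonicOn F X u) (hF : IsConeSet F) {a : ℝ} (ha : 0 < a) (b : ℝ) :
    IsSubharmonicOn F X (fun y => (a : EReal) * u y + b) := by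
  refine ⟨fun x hx => ?_, fun x hx => ?_, fun x hx φ hφ heq hle => ?_⟩
  · exact (continuous_ereal_mul_add a b).continuousAt.comp_upperSemicontinuousWithinAt
      (hu.usc x hx) fun s t hst =>
        add_le_add_left (mul_le_mul_of_nonneg_left hst (EReal.coe_nonneg.2 ha.le)) _
  · induction h : u x with
    | bot => simp [EReal.coe_mul_bot_of_pos ha]
    | top => exact absurd h (hu.ne_top x hx)
    | coe t => norm_cast; exact EReal.coe_ne_top _
  · have hφb : ContDiffAt ℝ 2 (fun y => φ y + -b) x := hφ.add contDiffAt_const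
    have hmem := hu.viscosity x hx (fun y => a⁻¹ * (φ y + -b)) (contDiffAt_const.mul hφb) ?_ ?_
    · rw [hessian_const_mul hφb, hessian_add_const] at hmem
      simpa [smul_smul, mul_inv_cancel₀ ha.ne'] using hF a ha.le _ hmem
    · rw [(ereal_mul_add_eq_coe_iff ha _ _).1 heq, div_eq_inv_mul, sub_eq_add_neg]
    · filter_upwards [hle] with y hy
      rw [← sub_eq_add_neg, ← div_eq_inv_mul]
      exact (ereal_mul_add_le_coe_iff ha _ _).1 hy

lemma isSubharmonicOn_of_hessian_mem (hF : IsSubequation F) {X : Set (Euc n)} {f : Euc n → ℝ}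
    (hf : ∀ x ∈ X, ContDiffAt ℝ 2 f x) (hmem : ∀ x ∈ X, hessian f x ∈ F) :
    IsSubharmonicOn F X (fun x => (f x : EReal)) := by
  refine ⟨fun x hx => ?_, fun x _ => EReal.coe_ne_top _, fun x hx φ hφ heq hle => ?_⟩
  · have : ContinuousAt (fun x => (f x : EReal)) x :=
      continuous_coe_real_ereal.continuousAt.comp (hf x hx).continuousAt
    exact this.upperSemicontinuousAt.upperSemicontinuousWithinAt _
  · have hneg : ContDiffAt ℝ 2 (fun y => -f y) x := (hf x hx).neg
    have hmin : IsLocalMin (fun y => φ y + -f y) x := by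
      filter_upwards [hle] with y hy
      have hy' : f y ≤ φ y := EReal.coe_le_coe_iff.1 hy
      have hx' : f x = φ x := EReal.coe_injective heq
      linarith
    have hpsd := posSemidef_hessian_of_isLocalMin (hφ.add hneg) hmin
    rw [hessian_add hφ hneg, hessian_neg] at hpsd
    simpa using hF.positivity _ (hmem x hx) _ hpsd

/-! ### Comparison -/

lemma exists_touching {E : Type*} [TopologicalSpace E] {C : Set E} (hC : IsCompact C)
    {u : E → EReal} (husc : UpperSemicontinuousOn u C) (hne : ∀ x ∈ C, u x ≠ ⊤) {ψ : E → ℝ}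
    (hψ : ContinuousOn ψ C) {x₁ : E} (hx₁ : x₁ ∈ C) (hbot : u x₁ ≠ ⊥) :
    ∃ y ∈ C, ∃ t : ℝ, u y = t ∧ ∀ z ∈ C, u z ≤ ((ψ z + (t - ψ y) : ℝ) : EReal) := by
  have husc' : UpperSemicontinuousOn (fun y => u y + ((-ψ y : ℝ) : EReal)) C :=
    husc.add' (continuous_coe_real_ereal.comp_continuousOn hψ.neg).upperSemicontinuousOn
      fun y _ => EReal.continuousAt_add (by simp) (by simp)
  obtain ⟨y, hy, hmax⟩ := husc'.exists_isMaxOn ⟨x₁, hx₁⟩ hC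
  have hy_bot : u y ≠ ⊥ := fun hbot' => by
    have := hmax hx₁
    simp only [hbot', EReal.bot_add, Set.mem_ofPred_eq, le_bot_iff, EReal.add_eq_bot_iff,
      EReal.coe_ne_bot, or_false] at this
    exact hbot this
  obtain ⟨t, ht⟩ : ∃ t : ℝ, u y = t := ⟨_, (EReal.coe_toReal (hne y hy) hy_bot).symm⟩
  refine ⟨y, hy, t, ht, fun z hz => ?_⟩
  have := hmax hz
  simp only [Set.mem_ofPred_eq, ht] at this
  induction huz : u z with
  | bot => simp
  | top => exact absurd huz (hne z hz)
  | coe s => rw [huz] at this; norm_cast at this ⊢; linarith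

lemma IsSubharmonicOn.le_of_hessian_notMem {C : Set (Euc n)} (hC : IsCompact C)
    {V : Set (Euc n)} (hV : IsOpen V) (hVC : V ⊆ C) {u : Euc n → EReal}
    (hu : IsSubharmonicOn F C u) {ψ : Euc n → ℝ} (hψ : ContinuousOn ψ C)
    (hψ₂ : ∀ x ∈ V, ContDiffAt ℝ 2 ψ x) (hF : ∀ x ∈ V, hessian ψ x ∉ F)
    (hbd : ∀ x ∈ C \ V, u x ≤ ψ x) : ∀ x ∈ C, u x ≤ ψ x := by
  intro x hx
  by_contra! hlt
  obtain ⟨y, hy, t, ht, hmax⟩ := exists_touching hC hu.usc hu.ne_top hψ hx (ne_bot_of_gt hlt)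
  have hpos : ψ y < t := by
    have := EReal.coe_lt_coe_iff.1 (hlt.trans_le (hmax x hx))
    linarith
  have hyC : y ∈ V := by
    by_contra hyC
    have := hbd y ⟨hy, hyC⟩
    rw [ht, EReal.coe_le_coe_iff] at this
    linarith
  refine hF y hyC ?_
  rw [← hessian_add_const ψ (t - ψ y)]
  refine hu.viscosity y hy _ ((hψ₂ y hyC).add contDiffAt_const) (by rw [ht]; congr 1; ring) ?_
  filter_upwards [hV.mem_nhds hyC] with z hz
  exact hmax z (hVC hz)

/-- The half-space of symmetric matrices on which `ℓ` is nonnegative: the subequation of the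
linear operator `φ ↦ ℓ (D²φ)`. -/
def halfSpace (ℓ : Mat n →L[ℝ] ℝ) : Set (Mat n) := {A | A.IsSymm ∧ 0 ≤ ℓ A}

lemma isSubequation_halfSpace {ℓ : Mat n →L[ℝ] ℝ} (hℓ : ∀ P : Mat n, P.PosSemidef → 0 ≤ ℓ P) :
    IsSubequation (halfSpace ℓ) where
  subset_sym _ hA := hA.1
  closed := (isClosed_eq (f := fun A : Mat n => A.transpose) (by fun_prop) continuous_id).inter
    (isClosed_le continuous_const ℓ.continuous)
  positivity A hA P hP := ⟨hA.1.add (Matrix.isHermitian_iff_isSymm.1 hP.1), by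
    rw [map_add]; exact add_nonneg hA.2 (hℓ P hP)⟩

lemma isConeSet_halfSpace (ℓ : Mat n →L[ℝ] ℝ) : IsConeSet (halfSpace ℓ) :=
  fun t ht A hA => ⟨hA.1.smul t, by simpa using mul_nonneg ht hA.2⟩

lemma IsSubequation.subset_halfSpace (hF : IsSubequation F) {ℓ : Mat n →L[ℝ] ℝ}
    (hℓ : ∀ A ∈ F, 0 ≤ ℓ A) : F ⊆ halfSpace ℓ :=
  fun A hA => ⟨hF.subset_sym hA, hℓ A hA⟩

lemma IsSubharmonicOn.le_of_halfSpace {ℓ : Mat n →L[ℝ] ℝ} (hℓ : 0 < ℓ 1) {C : Set (Euc n)}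
    (hC : IsCompact C) {u : Euc n → EReal} (hu : IsSubharmonicOn (halfSpace ℓ) C u)
    {h : Euc n → ℝ} (hh : ContDiff ℝ 2 h) (hle : ∀ x ∈ interior C, ℓ (hessian h x) ≤ 0)
    (hbd : ∀ x ∈ C \ interior C, u x ≤ h x) : ∀ x ∈ C, u x ≤ h x := by
  obtain ⟨R, hR⟩ := hC.isBounded.subset_closedBall (0 : Euc n)
  have hstrict : ∀ ε > 0, ∀ x ∈ C, u x ≤ ((h x + (-ε * ‖x - 0‖ ^ 2 + ε * R ^ 2) : ℝ) : EReal) := by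
    intro ε hε
    have hquad : ∀ x, ContDiffAt ℝ 2 (fun y : Euc n => -ε * ‖y - 0‖ ^ 2 + ε * R ^ 2) x :=
      fun x => (contDiffAt_const_mul_normSq_sub _ _ _).add contDiffAt_const
    have hψ : ∀ x, ContDiffAt ℝ 2 (fun y => h y + (-ε * ‖y - 0‖ ^ 2 + ε * R ^ 2)) x :=
      fun x => hh.contDiffAt.add (hquad x)
    refine hu.le_of_hessian_notMem hC isOpen_interior interior_subset
      (fun x _ => (hψ x).continuousAt.continuousWithinAt) (fun x _ => hψ x)
      (fun x hx hmem => ?_) fun x hx => (hbd x hx).trans ?_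
    · have hnonneg := hmem.2
      rw [hessian_add hh.contDiffAt (hquad x), hessian_add_const, hessian_const_mul_normSq_sub,
        map_add, map_smul, smul_eq_mul] at hnonneg
      nlinarith [hle x hx, mul_pos hε hℓ]
    · have hxR : ‖x - 0‖ ≤ R := mem_closedBall_iff_norm.1 (hR hx.1)
      have := pow_le_pow_left₀ (norm_nonneg _) hxR 2
      exact EReal.coe_le_coe_iff.2 (by nlinarith)
  intro x hx
  refine ge_of_tendsto (x := 𝓝[>] (0 : ℝ)) ?_ (eventually_mem_nhdsWithin.mono fun ε hε =>
    hstrict ε hε x hx)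
  have hcont : Continuous fun ε : ℝ => ((h x + (-ε * ‖x - 0‖ ^ 2 + ε * R ^ 2) : ℝ) : EReal) :=
    continuous_coe_real_ereal.comp (by fun_prop)
  simpa using (hcont.tendsto 0).mono_left nhdsWithin_le_nhds

/-! ### The Dirichlet problem with polynomial data -/

/-- The polynomial functions on Euclidean space. -/
noncomputable def polyFun : MvPolynomial (Fin n) ℝ →ₐ[ℝ] C(Euc n, ℝ) :=
  MvPolynomial.aeval fun i => ⟨fun x => x i, by fun_prop⟩

@[simp] lemma polyFun_X (i : Fin n) (x : Euc n) : polyFun (MvPolynomial.X i) x = x i := by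
  simp [polyFun]

lemma polyFun_apply (P : MvPolynomial (Fin n) ℝ) (x : Euc n) :
    polyFun P x = MvPolynomial.eval x.ofLp P := by
  have : (ContinuousMap.evalAlgHom ℝ ℝ x).comp polyFun = MvPolynomial.aeval x.ofLp :=
    MvPolynomial.algHom_ext fun i => by simp
  simpa [MvPolynomial.coe_aeval_eq_eval] using AlgHom.congr_fun this P

lemma eq_zero_of_polyFun_eq_zero_on_nhds {P : MvPolynomial (Fin n) ℝ} {V : Set (Euc n)} {x : Euc n}
    (hV : V ∈ 𝓝 x) (h : ∀ y ∈ V, polyFun P y = 0) : P = 0 := by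
  have hV' : WithLp.toLp 2 ⁻¹' V ∈ 𝓝 x.ofLp :=
    (PiLp.continuous_toLp 2 _).continuousAt.preimage_mem_nhds hV
  rw [nhds_pi, Filter.mem_pi] at hV'
  obtain ⟨I, -, t, ht, htV⟩ := hV'
  refine MvPolynomial.funext_set t (fun i => infinite_of_mem_nhds _ (ht i)) fun y hy => ?_
  rw [map_zero, ← h (WithLp.toLp 2 y) (htV fun i _ => hy i (mem_univ i)), polyFun_apply]

lemma hasFDerivAt_polyFun (P : MvPolynomial (Fin n) ℝ) (x : Euc n) :
    HasFDerivAt (polyFun P) (∑ i, polyFun (MvPolynomial.pderiv i P) x •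
      (EuclideanSpace.proj i : Euc n →L[ℝ] ℝ)) x := by
  induction P using MvPolynomial.induction_on with
  | C a =>
    change HasFDerivAt (fun y => polyFun (MvPolynomial.C a) y) _ x
    simpa using hasFDerivAt_const a x
  | add P Q hP hQ =>
    rw [map_add]
    exact (hP.add hQ).congr_fderiv (by simp [add_smul, Finset.sum_add_distrib])
  | mul_X P j hP =>
    have hX : HasFDerivAt (polyFun (MvPolynomial.X j)) (EuclideanSpace.proj j : Euc n →L[ℝ] ℝ) x :=
      (EuclideanSpace.proj j : Euc n →L[ℝ] ℝ).hasFDerivAt.congr_of_eventuallyEq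
        (Eventually.of_forall fun y => polyFun_X j y)
    rw [map_mul]
    refine (hP.mul hX).congr_fderiv ?_
    ext v
    have hsingle : ∀ i, polyFun ((Pi.single i 1 : Fin n → MvPolynomial (Fin n) ℝ) j) x =
        if j = i then 1 else 0 := fun i => by
      rw [Pi.single_apply]; split_ifs <;> simp
    simp [MvPolynomial.pderiv_X, hsingle, add_mul, Finset.sum_add_distrib, Finset.mul_sum,
      mul_assoc]

lemma contDiff_polyFun (P : MvPolynomial (Fin n) ℝ) : ContDiff ℝ 2 (polyFun P) := by
  induction P using MvPolynomial.induction_on with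
  | C a =>
    change ContDiff ℝ 2 fun x => polyFun (MvPolynomial.C a) x
    simpa using contDiff_const
  | add P Q hP hQ => rw [map_add]; exact hP.add hQ
  | mul_X P j hP =>
    rw [map_mul]
    refine hP.mul ?_
    change ContDiff ℝ 2 fun x => polyFun (MvPolynomial.X j) x
    simpa using (EuclideanSpace.proj j : Euc n →L[ℝ] ℝ).contDiff

lemma hessian_polyFun (P : MvPolynomial (Fin n) ℝ) (x : Euc n) :
    hessian (polyFun P) x =
      Matrix.of fun i j => polyFun (MvPolynomial.pderiv i (MvPolynomial.pderiv j P)) x := by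
  have hfderiv : fderiv ℝ (polyFun P) = fun y => ∑ i, polyFun (MvPolynomial.pderiv i P) y •
      (EuclideanSpace.proj i : Euc n →L[ℝ] ℝ) := by
    ext1 y; exact (hasFDerivAt_polyFun P y).fderiv
  have hfderiv₂ := HasFDerivAt.fun_sum (u := Finset.univ) fun i _ =>
    (hasFDerivAt_polyFun (MvPolynomial.pderiv i P) x).smul_const
      (EuclideanSpace.proj i : Euc n →L[ℝ] ℝ)
  ext i j
  simp only [hessian, Matrix.of_apply]
  rw [hfderiv, hfderiv₂.fderiv]
  simp

/-- The operator `φ ↦ ℓ (D²φ)` on polynomials. -/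
noncomputable def polyOp (ℓ : Mat n →L[ℝ] ℝ) :
    MvPolynomial (Fin n) ℝ →ₗ[ℝ] MvPolynomial (Fin n) ℝ :=
  ∑ i, ∑ j, ℓ (Matrix.single i j 1) •
    ((MvPolynomial.pderiv i).toLinearMap ∘ₗ (MvPolynomial.pderiv j).toLinearMap)

@[simp] lemma polyOp_C (ℓ : Mat n →L[ℝ] ℝ) (c : ℝ) : polyOp ℓ (MvPolynomial.C c) = 0 := by
  simp [polyOp]

lemma map_hessian_polyFun (ℓ : Mat n →L[ℝ] ℝ) (P : MvPolynomial (Fin n) ℝ) (x : Euc n) :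
    ℓ (hessian (polyFun P) x) = polyFun (polyOp ℓ P) x := by
  have hsingle : ∀ i j : Fin n, ∀ c : ℝ,
      ℓ (Matrix.single i j c) = ℓ (Matrix.single i j 1) * c := fun i j c => by
    rw [← mul_one c, ← smul_eq_mul c 1, ← Matrix.smul_single, map_smul, smul_eq_mul, smul_eq_mul,
      mul_one, mul_comm]
  rw [hessian_polyFun, Matrix.matrix_eq_sum_single (Matrix.of _)]
  simp [polyOp, hsingle _ _ (polyFun _ _)]

lemma totalDegree_pderiv_le {σ R : Type*} [CommSemiring R] (i : σ) (P : MvPolynomial σ R) :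
    (MvPolynomial.pderiv i P).totalDegree ≤ P.totalDegree - 1 := by
  refine Finset.sup_le fun m hm => ?_
  have hmem : m + Finsupp.single i 1 ∈ P.support := by
    rw [MvPolynomial.mem_support_iff, MvPolynomial.coeff_pderiv] at hm
    rw [MvPolynomial.mem_support_iff]
    exact left_ne_zero_of_mul hm
  have hdeg := MvPolynomial.le_totalDegree hmem
  rw [Finsupp.sum_add_index' (by simp) (by simp), Finsupp.sum_single_index rfl] at hdeg
  exact Nat.le_sub_of_add_le hdeg

lemma totalDegree_polyOp_le (ℓ : Mat n →L[ℝ] ℝ) (P : MvPolynomial (Fin n) ℝ) :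
    (polyOp ℓ P).totalDegree ≤ P.totalDegree - 2 := by
  simp only [polyOp, LinearMap.coe_sum, Finset.sum_apply, LinearMap.smul_apply]
  refine MvPolynomial.totalDegree_finsetSum_le fun i _ =>
    MvPolynomial.totalDegree_finsetSum_le fun j _ => (MvPolynomial.totalDegree_smul_le _ _).trans ?_
  exact (totalDegree_pderiv_le i (MvPolynomial.pderiv j P)).trans
    (Nat.sub_le_sub_right (totalDegree_pderiv_le j P) 1)

/-- The polynomial `1 - |x|²`, which vanishes exactly on the unit sphere. -/
noncomputable def ballPoly (n : ℕ) : MvPolynomial (Fin n) ℝ :=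
  1 - ∑ i, MvPolynomial.X i ^ 2

@[simp] lemma polyFun_ballPoly (x : Euc n) : polyFun (ballPoly n) x = 1 - ‖x‖ ^ 2 := by
  simp [ballPoly, EuclideanSpace.real_norm_sq_eq]

lemma totalDegree_ballPoly_le : (ballPoly n).totalDegree ≤ 2 := by
  refine (MvPolynomial.totalDegree_sub _ _).trans (max_le (by simp) ?_)
  refine MvPolynomial.totalDegree_finsetSum_le fun i _ => ?_
  exact (MvPolynomial.totalDegree_pow _ _).trans (by simp)

/-- The operator `φ ↦ ℓ (D²φ)` is (possibly degenerate) elliptic, with positive trace. -/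
structure IsElliptic (ℓ : Mat n →L[ℝ] ℝ) : Prop where
  nonneg : ∀ P : Mat n, P.PosSemidef → 0 ≤ ℓ P
  one_pos : 0 < ℓ 1

namespace IsElliptic

variable {ℓ : Mat n →L[ℝ] ℝ} {H : MvPolynomial (Fin n) ℝ} {c : ℝ}

lemma polyFun_le_of_sphere (hℓ : IsElliptic ℓ) (hH : polyOp ℓ H = 0)
    (hs : ∀ x ∈ Metric.sphere (0 : Euc n) 1, polyFun H x ≤ c) {x : Euc n}
    (hx : x ∈ Metric.closedBall (0 : Euc n) 1) : polyFun H x ≤ c := by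
  have hsub : IsSubharmonicOn (halfSpace ℓ) (Metric.closedBall 0 1)
      (fun x => (polyFun H x : EReal)) :=
    isSubharmonicOn_of_hessian_mem (isSubequation_halfSpace hℓ.nonneg)
      (fun x _ => (contDiff_polyFun H).contDiffAt) fun x _ =>
        ⟨isSymm_hessian (contDiff_polyFun H).contDiffAt, by simp [map_hessian_polyFun, hH]⟩
  refine EReal.coe_le_coe_iff.1 <| hsub.le_of_halfSpace hℓ.one_pos (isCompact_closedBall 0 1)
    (h := fun _ => c) contDiff_const (fun x _ => by simp [hessian_const]) (fun x hx => ?_) x hx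
  rw [interior_closedBall _ one_ne_zero, Metric.closedBall_sdiff_ball] at hx
  exact EReal.coe_le_coe_iff.2 (hs x hx)

lemma le_polyFun_of_sphere (hℓ : IsElliptic ℓ) (hH : polyOp ℓ H = 0)
    (hs : ∀ x ∈ Metric.sphere (0 : Euc n) 1, c ≤ polyFun H x) {x : Euc n}
    (hx : x ∈ Metric.closedBall (0 : Euc n) 1) : c ≤ polyFun H x := by
  have := hℓ.polyFun_le_of_sphere (H := -H) (c := -c) (by simp [hH]) (by simpa using hs) hx
  simpa using this

lemma eq_zero_of_polyOp_ballPoly_mul (hℓ : IsElliptic ℓ) {Q : MvPolynomial (Fin n) ℝ}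
    (hQ : polyOp ℓ (ballPoly n * Q) = 0) : Q = 0 := by
  have hsphere : ∀ x ∈ Metric.sphere (0 : Euc n) 1, polyFun (ballPoly n * Q) x = 0 := by
    intro x hx
    simp [mem_sphere_zero_iff_norm.1 hx]
  refine eq_zero_of_polyFun_eq_zero_on_nhds (Metric.ball_mem_nhds 0 zero_lt_one) fun x hx => ?_
  have hx' := Metric.ball_subset_closedBall hx
  have hprod : polyFun (ballPoly n * Q) x = 0 :=
    (hℓ.polyFun_le_of_sphere hQ (fun y hy => (hsphere y hy).le) hx').antisymm
      (hℓ.le_polyFun_of_sphere hQ (fun y hy => (hsphere y hy).ge) hx')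
  have hne : 1 - ‖x‖ ^ 2 ≠ 0 := by
    have := mem_ball_zero_iff.1 hx
    nlinarith [norm_nonneg x]
  simpa [hne] using hprod

/- `Q ↦ ℓ (D²((1 - |x|²) Q))` maps the polynomials of degree at most `deg P` injectively into
themselves, hence onto. -/
lemma exists_harmonic_extension (hℓ : IsElliptic ℓ) (P : MvPolynomial (Fin n) ℝ) :
    ∃ H : MvPolynomial (Fin n) ℝ, polyOp ℓ H = 0 ∧
      ∀ x ∈ Metric.sphere (0 : Euc n) 1, polyFun H x = polyFun P x := by
  let V := MvPolynomial.restrictTotalDegree (Fin n) ℝ P.totalDegree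
  let T : MvPolynomial (Fin n) ℝ →ₗ[ℝ] MvPolynomial (Fin n) ℝ :=
    polyOp ℓ ∘ₗ LinearMap.mulLeft ℝ (ballPoly n)
  have hT : ∀ Q ∈ V, T Q ∈ V := by
    intro Q hQ
    rw [MvPolynomial.mem_restrictTotalDegree] at hQ ⊢
    refine (totalDegree_polyOp_le ℓ (ballPoly n * Q)).trans ?_
    have := MvPolynomial.totalDegree_mul (ballPoly n) Q
    have := totalDegree_ballPoly_le (n := n)
    omega
  have hinj : Function.Injective (T.restrict hT) := by
    refine (injective_iff_map_eq_zero _).2 fun Q hQ => ?_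
    exact Subtype.ext (hℓ.eq_zero_of_polyOp_ballPoly_mul (congrArg Subtype.val hQ))
  have hP : polyOp ℓ P ∈ V := (MvPolynomial.mem_restrictTotalDegree _ _ _).2
    ((totalDegree_polyOp_le ℓ P).trans (Nat.sub_le _ _))
  obtain ⟨Q, hQ⟩ := LinearMap.injective_iff_surjective.1 hinj ⟨polyOp ℓ P, hP⟩
  have hQ' : polyOp ℓ (ballPoly n * Q) = polyOp ℓ P := congrArg Subtype.val hQ
  refine ⟨P - ballPoly n * Q, by rw [map_sub, hQ', sub_self], fun x hx => ?_⟩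
  simp [mem_sphere_zero_iff_norm.1 hx]

end IsElliptic

/-! ### Harmonic measures -/

lemma exists_nonneg_extension {X E : Type*} [TopologicalSpace X] [CompactSpace X] [AddCommGroup E]
    [Module ℝ E] (Φ : E →ₗ[ℝ] C(X, ℝ)) (L : E →ₗ[ℝ] ℝ) (hL : ∀ v, 0 ≤ Φ v → 0 ≤ L v)
    {e : E} (he : Φ e = 1) :
    ∃ g : C(X, ℝ) →ₗ[ℝ] ℝ, (∀ φ, 0 ≤ φ → 0 ≤ g φ) ∧ ∀ v, g (Φ v) = L v := by
  have hker : LinearMap.ker Φ ≤ LinearMap.ker L := fun v (hv : Φ v = 0) =>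
    (neg_nonneg.1 (by simpa using hL (-v) (by simp [hv]))).antisymm (hL v hv.ge)
  let f : C(X, ℝ) →ₗ.[ℝ] ℝ :=
    { domain := LinearMap.range Φ
      toFun := (LinearMap.ker Φ).liftQ L hker ∘ₗ Φ.quotKerEquivRange.symm.toLinearMap }
  have hf : ∀ v, f ⟨Φ v, LinearMap.mem_range_self Φ v⟩ = L v := fun v => by
    change (LinearMap.ker Φ).liftQ L hker
      (Φ.quotKerEquivRange.symm ⟨Φ v, LinearMap.mem_range_self Φ v⟩) = L v
    rw [LinearMap.quotKerEquivRange_symm_apply_image, Submodule.mkQ_apply, Submodule.liftQ_apply]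
  have hnonneg : ∀ φ : f.domain, (φ : C(X, ℝ)) ∈ PointedCone.positive ℝ C(X, ℝ) → 0 ≤ f φ := by
    rintro ⟨_, v, rfl⟩ hv
    exact (hf v).symm ▸ hL v hv
  obtain ⟨g, hgf, hg⟩ := riesz_extension (PointedCone.positive ℝ C(X, ℝ)) f hnonneg fun φ => by
    refine ⟨⟨Φ (‖φ‖ • e), LinearMap.mem_range_self Φ _⟩, fun x => ?_⟩
    have : 0 ≤ ‖φ‖ + φ x := by linarith [(abs_le.1 (φ.norm_coe_le_norm x)).1]
    simpa [he] using this
  exact ⟨g, hg, fun v => (hgf ⟨Φ v, LinearMap.mem_range_self Φ v⟩).trans (hf v)⟩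

open scoped CompactlySupported in
lemma exists_measure_of_nonneg {X : Type*} [TopologicalSpace X] [CompactSpace X] [T2Space X]
    [MeasurableSpace X] [BorelSpace X] (g : C(X, ℝ) →ₗ[ℝ] ℝ) (hg : ∀ φ, 0 ≤ φ → 0 ≤ g φ) :
    ∃ μ : Measure X, ∀ φ : C(X, ℝ), ∫ x, φ x ∂μ = g φ := by
  let Λ₀ : C_c(X, ℝ) →ₗ[ℝ] ℝ :=
    { toFun φ := g φ.toContinuousMap
      map_add' _ _ := g.map_add _ _
      map_smul' _ _ := g.map_smul _ _ }
  let Λ : C_c(X, ℝ) →ₚ[ℝ] ℝ := PositiveLinearMap.mk₀ Λ₀ fun φ hφ => hg _ fun x => hφ x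
  exact ⟨RealRMK.rieszMeasure Λ, fun φ =>
    RealRMK.integral_rieszMeasure Λ (CompactlySupportedContinuousMap.continuousMapEquiv φ)⟩

/-- A harmonic measure of the centre of the unit ball, for the operator `φ ↦ ℓ (D²φ)`. -/
structure IsHarmonicMeasure (ℓ : Mat n →L[ℝ] ℝ) (μ : Measure (Euc n)) : Prop where
  isProbabilityMeasure : IsProbabilityMeasure μ
  ae_mem_sphere : ∀ᵐ y ∂μ, y ∈ Metric.sphere (0 : Euc n) 1
  integral_polyFun : ∀ H : MvPolynomial (Fin n) ℝ, polyOp ℓ H = 0 →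
    ∫ y, polyFun H y ∂μ = polyFun H 0

theorem IsElliptic.exists_isHarmonicMeasure {ℓ : Mat n →L[ℝ] ℝ} (hℓ : IsElliptic ℓ) :
    ∃ μ : Measure (Euc n), IsHarmonicMeasure ℓ μ := by
  let S := Metric.sphere (0 : Euc n) 1
  let res : C(Euc n, ℝ) →ₗ[ℝ] C(S, ℝ) :=
    (ContinuousMap.compRightAlgHom ℝ ℝ ⟨Subtype.val, continuous_subtype_val⟩).toLinearMap
  let Φ : LinearMap.ker (polyOp ℓ) →ₗ[ℝ] C(S, ℝ) :=
    res ∘ₗ polyFun.toLinearMap ∘ₗ (LinearMap.ker (polyOp ℓ)).subtype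
  let L : LinearMap.ker (polyOp ℓ) →ₗ[ℝ] ℝ :=
    (ContinuousMap.evalAlgHom ℝ ℝ (0 : Euc n)).toLinearMap ∘ₗ polyFun.toLinearMap ∘ₗ
      (LinearMap.ker (polyOp ℓ)).subtype
  have hL : ∀ H, 0 ≤ Φ H → 0 ≤ L H := fun H hH =>
    hℓ.le_polyFun_of_sphere H.2 (fun x hx => hH ⟨x, hx⟩) (by simp)
  have hone : polyOp ℓ 1 = 0 := polyOp_C ℓ 1
  obtain ⟨g, hg, hgΦ⟩ := exists_nonneg_extension Φ L hL (e := ⟨1, hone⟩) (by ext; simp [Φ, res])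
  obtain ⟨ν, hν⟩ := exists_measure_of_nonneg g hg
  have hint : ∀ H : MvPolynomial (Fin n) ℝ, polyOp ℓ H = 0 →
      ∫ y : S, polyFun H y ∂ν = polyFun H 0 := fun H hH => (hν (Φ ⟨H, hH⟩)).trans (hgΦ ⟨H, hH⟩)
  have hprob : IsProbabilityMeasure ν := by
    have := hint 1 hone
    simp only [map_one, ContinuousMap.one_apply, integral_const, smul_eq_mul, mul_one,
      measureReal_def] at this
    exact ⟨(ENNReal.toReal_eq_one_iff _).1 this⟩
  have hval : AEMeasurable Subtype.val ν := measurable_subtype_coe.aemeasurable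
  refine ⟨ν.map Subtype.val, Measure.isProbabilityMeasure_map hval, ?_, fun H hH => ?_⟩
  · exact (ae_map_iff hval Metric.isClosed_sphere.measurableSet).2
      (Eventually.of_forall fun y => y.2)
  · rw [integral_map hval (polyFun H).continuous.aestronglyMeasurable, hint H hH]

lemma exists_polyFun_near {K : Set (Euc n)} (hK : IsCompact K) (φ : C(Euc n, ℝ)) {ε : ℝ}
    (hε : 0 < ε) : ∃ P : MvPolynomial (Fin n) ℝ, ∀ x ∈ K, |polyFun P x - φ x| < ε := by
  have hsep : (polyFun (n := n)).range.SeparatesPoints := by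
    intro x y hxy
    obtain ⟨i, hi⟩ : ∃ i, x i ≠ y i := by
      by_contra! h
      exact hxy (by ext i; exact h i)
    exact ⟨_, ⟨polyFun (MvPolynomial.X i), ⟨_, rfl⟩, rfl⟩, by simpa using hi⟩
  obtain ⟨_, ⟨P, rfl⟩, hP⟩ :=
    ContinuousMap.exists_mem_subalgebra_near_continuous_of_isCompact_of_separatesPoints hsep φ hK hε
  exact ⟨P, hP⟩

namespace IsHarmonicMeasure

variable {ℓ : Mat n →L[ℝ] ℝ} {μ : Measure (Euc n)}

lemma integrable_of_continuous (hμ : IsHarmonicMeasure ℓ μ) {f : Euc n → ℝ} (hf : Continuous f) :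
    Integrable f μ := by
  have := hμ.isProbabilityMeasure
  obtain ⟨C, hC⟩ := (isCompact_sphere (0 : Euc n) 1).exists_bound_of_continuousOn hf.continuousOn
  exact Integrable.of_bound hf.aestronglyMeasurable C (hμ.ae_mem_sphere.mono hC)

lemma le_integral (hμ : IsHarmonicMeasure ℓ μ) (hℓ : IsElliptic ℓ) {u : Euc n → EReal}
    (hu : IsSubharmonicOn (halfSpace ℓ) (Metric.closedBall 0 1) u) (φ : C(Euc n, ℝ))
    (hφ : ∀ x ∈ Metric.sphere (0 : Euc n) 1, u x ≤ φ x) : u 0 ≤ ((∫ y, φ y ∂μ : ℝ) : EReal) := by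
  have := hμ.isProbabilityMeasure
  refine EReal.le_of_forall_lt_iff_le.1 fun z hz => ?_
  obtain ⟨ε, hε, hεz⟩ : ∃ ε > 0, ∫ y, φ y ∂μ + 2 * ε ≤ z :=
    ⟨(z - ∫ y, φ y ∂μ) / 2, by linarith [EReal.coe_lt_coe_iff.1 hz], by linarith⟩
  obtain ⟨P, hP⟩ := exists_polyFun_near (isCompact_sphere (0 : Euc n) 1) φ hε
  obtain ⟨H, hH, hHP⟩ := hℓ.exists_harmonic_extension P
  have hHφ : ∀ x ∈ Metric.sphere (0 : Euc n) 1, |polyFun H x - φ x| < ε := fun x hx =>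
    hHP x hx ▸ hP x hx
  have hH₀ : polyFun H 0 ≤ ∫ y, φ y ∂μ + ε := by
    rw [← hμ.integral_polyFun H hH]
    calc ∫ y, polyFun H y ∂μ ≤ ∫ y, (φ y + ε) ∂μ := by
          refine integral_mono_ae (hμ.integrable_of_continuous (polyFun H).continuous)
            (hμ.integrable_of_continuous (by fun_prop)) ?_
          filter_upwards [hμ.ae_mem_sphere] with y hy
          linarith [(abs_lt.1 (hHφ y hy)).2]
      _ = ∫ y, φ y ∂μ + ε := by
          rw [integral_add (hμ.integrable_of_continuous φ.continuous) (integrable_const _)]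
          simp
  have hcmp : u 0 ≤ ((polyFun H 0 + ε : ℝ) : EReal) := by
    refine hu.le_of_halfSpace hℓ.one_pos (isCompact_closedBall 0 1)
      ((contDiff_polyFun H).add contDiff_const) (fun x _ => ?_) (fun x hx => ?_) 0 (by simp)
    · rw [hessian_add_const, map_hessian_polyFun, hH]
      simp
    · rw [interior_closedBall _ one_ne_zero, Metric.closedBall_sdiff_ball] at hx
      refine (hφ x hx).trans (EReal.coe_le_coe_iff.2 ?_)
      linarith [(abs_lt.1 (hHφ x hx)).1]
  exact hcmp.trans (EReal.coe_le_coe_iff.2 (by linarith))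

end IsHarmonicMeasure

lemma exists_monotone_continuous_iSup_eq {α : Type*} [PseudoEMetricSpace α] {v : α → ℝ≥0∞}
    (hv : LowerSemicontinuous v) :
    ∃ f : ℕ → α → ℝ≥0∞, (∀ k, Continuous (f k)) ∧ (∀ k x, f k x ≤ k) ∧ Monotone f ∧
      ∀ x, ⨆ k, f k x = v x := by
  -- Inf-convolution: the largest `k`-Lipschitz function below `min v k`.
  let f : ℕ → α → ℝ≥0∞ := fun k x => ⨅ y, (min (v y) k + k * edist x y)
  refine ⟨f, fun k => ?_, fun k x => ?_, fun k l hkl x => ?_, fun x => le_antisymm ?_ ?_⟩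
  · refine continuous_of_le_add_edist (k : ℝ≥0∞) (by simp) fun x y => ?_
    rw [ENNReal.iInf_add]
    refine le_iInf fun z => (iInf_le _ z).trans ?_
    rw [add_assoc, ← mul_add]
    gcongr
    rw [add_comm]
    exact edist_triangle x y z
  · exact (iInf_le _ x).trans (by simp)
  · refine iInf_mono fun y => ?_
    gcongr
  · exact iSup_le fun k => (iInf_le _ x).trans (by simp)
  · refine le_of_forall_lt fun t ht => ?_
    obtain ⟨t', htt', ht'⟩ := exists_between ht
    refine htt'.trans_le ?_
    obtain ⟨δ, hδ, hball⟩ := EMetric.mem_nhds_iff.1 (hv x t' ht')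
    obtain ⟨k₁, hk₁⟩ := ENNReal.exists_nat_gt ht'.ne_top
    obtain ⟨k₂, hk₂⟩ := ENNReal.exists_nat_mul_gt hδ.ne' ht'.ne_top
    refine le_iSup_of_le (max k₁ k₂) (le_iInf fun y => ?_)
    rcases lt_or_ge (edist x y) δ with hy | hy
    · have hty : t' < v y := hball (by rwa [Metric.mem_eball, edist_comm])
      refine (le_min hty.le (hk₁.le.trans ?_)).trans le_self_add
      exact_mod_cast le_max_left k₁ k₂
    · calc t' ≤ k₂ * δ := hk₂.le
        _ ≤ (max k₁ k₂ : ℕ) * edist x y := by gcongr; exact le_max_right _ _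
        _ ≤ _ := le_add_self

lemma lintegral_le_of_forall_continuous_le {α : Type*} [PseudoEMetricSpace α] [MeasurableSpace α]
    [OpensMeasurableSpace α] {μ : Measure α} {v : α → ℝ≥0∞} (hv : LowerSemicontinuous v)
    {c : ℝ≥0∞} (h : ∀ φ : C(α, ℝ≥0), (∀ x, φ x ≤ v x) → ∫⁻ x, φ x ∂μ ≤ c) :
    ∫⁻ x, v x ∂μ ≤ c := by
  obtain ⟨f, hf, hfk, hmono, hsup⟩ := exists_monotone_continuous_iSup_eq hv
  simp_rw [← hsup]
  rw [lintegral_iSup (fun k => (hf k).measurable) hmono]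
  refine iSup_le fun k => ?_
  have hfin : ∀ x, f k x ≠ ⊤ := fun x =>
    ne_top_of_le_ne_top (ENNReal.natCast_ne_top k) (hfk k x)
  have hcoe : ∀ x, ((f k x).toNNReal : ℝ≥0∞) = f k x := fun x => ENNReal.coe_toNNReal (hfin x)
  rw [← lintegral_congr hcoe]
  refine h ⟨fun x => (f k x).toNNReal, ?_⟩ fun x => ?_
  · exact ENNReal.continuousOn_toNNReal.comp_continuous (hf k) hfin
  · exact (hcoe x).trans_le ((le_iSup (fun k => f k x) k).trans_eq (hsup x))

section Deficit

variable {α : Type*} {Ω : Set α} {M : ℝ} {u w : α → EReal} {x : α}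

/-- The function `M - u` on `Ω`, extended by `0`: for `u ≤ M` it turns integrals of the
`EReal`-valued `u` into lower Lebesgue integrals. -/
noncomputable def deficit (Ω : Set α) (M : ℝ) (u : α → EReal) : α → ℝ≥0∞ :=
  Ω.indicator fun x => ((M : EReal) - u x).toENNReal

lemma deficit_of_mem (hx : x ∈ Ω) : deficit Ω M u x = ((M : EReal) - u x).toENNReal :=
  indicator_of_mem hx _

lemma deficit_of_notMem (hx : x ∉ Ω) : deficit Ω M u x = 0 :=
  indicator_of_notMem hx _

lemma deficit_of_eq_coe {t : ℝ} (hx : x ∈ Ω) (h : u x = t) :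
    deficit Ω M u x = ENNReal.ofReal (M - t) := by
  rw [deficit_of_mem hx, h, ← EReal.coe_sub, EReal.real_coe_toENNReal]

lemma ofReal_le_deficit_iff (hx : x ∈ Ω) (hM : u x ≤ M) (c : ℝ) :
    ENNReal.ofReal c ≤ deficit Ω M u x ↔ u x ≤ ((M - c : ℝ) : EReal) := by
  induction h : u x with
  | bot => simp [deficit_of_mem hx, h]
  | top => simp [h] at hM
  | coe t =>
    have ht : t ≤ M := EReal.coe_le_coe_iff.1 (h ▸ hM)
    rw [deficit_of_eq_coe hx h, ENNReal.ofReal_le_ofReal_iff (by linarith), EReal.coe_le_coe_iff]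
    constructor <;> intro h <;> linarith

lemma deficit_anti (h : x ∈ Ω → u x ≤ w x) : deficit Ω M w x ≤ deficit Ω M u x := by
  by_cases hx : x ∈ Ω
  · rw [deficit_of_mem hx, deficit_of_mem hx]
    exact EReal.toENNReal_le_toENNReal (EReal.sub_le_sub le_rfl (h hx))
  · simp only [deficit_of_notMem hx, le_refl]

lemma continuous_toENNReal_coe_sub (M : ℝ) :
    Continuous fun t : EReal => ((M : EReal) - t).toENNReal := by
  refine EReal.continuous_toENNReal.comp (continuous_iff_continuousAt.2 fun t => ?_)
  exact (EReal.continuousAt_add (p := ((M : EReal), -t)) (by simp) (by simp)).comp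
    (f := fun t : EReal => ((M : EReal), -t))
    (continuousAt_const.prodMk continuous_neg.continuousAt)

lemma lowerSemicontinuous_deficit [TopologicalSpace α] (hΩ : IsOpen Ω) (M : ℝ)
    (hu : UpperSemicontinuousOn u Ω) : LowerSemicontinuous (deficit Ω M u) := by
  intro x y hy
  by_cases hx : x ∈ Ω
  · have hanti : Antitone fun t : EReal => ((M : EReal) - t).toENNReal := fun s t hst =>
      EReal.toENNReal_le_toENNReal (EReal.sub_le_sub le_rfl hst)
    rw [deficit_of_mem hx] at hy
    have hev := (continuous_toENNReal_coe_sub M).continuousAt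
      |>.comp_upperSemicontinuousWithinAt_antitone (hu x hx) hanti y hy
    rw [hΩ.nhdsWithin_eq hx] at hev
    filter_upwards [hev, hΩ.mem_nhds hx] with z hz hzΩ
    rwa [deficit_of_mem hzΩ]
  · simp [deficit_of_notMem hx] at hy

end Deficit

namespace IsHarmonicMeasure

variable {ℓ : Mat n →L[ℝ] ℝ} {μ : Measure (Euc n)} {Ω : Set (Euc n)} {u : Euc n → EReal} {M : ℝ}

lemma lintegral_deficit_le_unit (hμ : IsHarmonicMeasure ℓ μ) (hℓ : IsElliptic ℓ) (hΩ : IsOpen Ω)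
    (hball : Metric.closedBall 0 1 ⊆ Ω) (hu : IsSubharmonicOn (halfSpace ℓ) Ω u)
    (hM : ∀ x ∈ Ω, u x ≤ M) : ∫⁻ y, deficit Ω M u y ∂μ ≤ deficit Ω M u 0 := by
  have := hμ.isProbabilityMeasure
  have h₀ : (0 : Euc n) ∈ Ω := hball (by simp)
  refine lintegral_le_of_forall_continuous_le (lowerSemicontinuous_deficit hΩ M hu.usc)
    fun φ hφ => ?_
  have hφ_int : Integrable (fun y => (φ y : ℝ)) μ := hμ.integrable_of_continuous (by fun_prop)
  have hle := hμ.le_integral hℓ (hu.mono hball) ⟨fun y => M - φ y, by fun_prop⟩ fun x hx => by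
    have hxΩ := hball (Metric.sphere_subset_closedBall hx)
    refine (ofReal_le_deficit_iff hxΩ (hM x hxΩ) (φ x)).1 ?_
    simpa using hφ x
  rw [lintegral_coe_eq_integral _ hφ_int, ofReal_le_deficit_iff h₀ (hM 0 h₀)]
  simpa [integral_sub (integrable_const M) hφ_int] using hle

lemma lintegral_deficit_le (hμ : IsHarmonicMeasure ℓ μ) (hℓ : IsElliptic ℓ) (hΩ : IsOpen Ω)
    {x : Euc n} {s : ℝ} (hs : 0 < s) (hball : Metric.closedBall x s ⊆ Ω)
    (hu : IsSubharmonicOn (halfSpace ℓ) Ω u) (hM : ∀ x ∈ Ω, u x ≤ M) :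
    ∫⁻ y, deficit Ω M u (s • y + x) ∂μ ≤ deficit Ω M u x := by
  have hsub : Metric.closedBall 0 1 ⊆ (fun y => s • y + x) ⁻¹' Ω := fun y hy => hball <| by
    rw [mem_closedBall_zero_iff] at hy
    rw [mem_closedBall_iff_norm, add_sub_cancel_right, norm_smul, Real.norm_of_nonneg hs.le]
    exact mul_le_of_le_one_right hs.le hy
  have h := hμ.lintegral_deficit_le_unit hℓ (hΩ.preimage (by fun_prop)) hsub
    (hu.comp_smul_add (isConeSet_halfSpace ℓ) hs.ne' x) fun y hy => hM _ hy
  calc _ ≤ deficit Ω M u (s • (0 : Euc n) + x) := h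
    _ = deficit Ω M u x := by rw [smul_zero, zero_add]

end IsHarmonicMeasure

/-! ### Averages over the orbits of the stabilizer -/

lemma isCompact_orthogonalGroup : IsCompact (Matrix.orthogonalGroup (Fin n) ℝ : Set (Mat n)) := by
  have hbox : IsCompact (univ.pi fun _ : Fin n => univ.pi fun _ : Fin n => Icc (-1 : ℝ) 1) :=
    isCompact_univ_pi fun _ => isCompact_univ_pi fun _ => isCompact_Icc
  have hclosed : IsClosed (Matrix.orthogonalGroup (Fin n) ℝ : Set (Mat n)) := by
    have : (Matrix.orthogonalGroup (Fin n) ℝ : Set (Mat n)) = {g | g * star g = 1} :=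
      Set.ext fun g => Matrix.mem_orthogonalGroup_iff (Fin n) ℝ
    exact this ▸ isClosed_eq (by fun_prop) continuous_const
  exact IsCompact.of_isClosed_subset (X := Mat n) hbox hclosed fun g hg i _ j _ =>
    abs_le.1 (entry_norm_bound_of_unitary (𝕜 := ℝ) hg i j)

lemma isClosed_orthogonalStabilizer (hF : IsClosed F) :
    IsClosed (orthogonalStabilizer F : Set (Matrix.orthogonalGroup (Fin n) ℝ)) := by
  have : (orthogonalStabilizer F : Set (Matrix.orthogonalGroup (Fin n) ℝ)) =
      ⋂ A ∈ F, {g : Matrix.orthogonalGroup (Fin n) ℝ | (g : Mat n) * A * (g : Mat n).transpose ∈ F ∧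
        (g : Mat n).transpose * A * (g : Mat n) ∈ F} := by
    ext g
    simp only [mem_iInter]
    rfl
  rw [this]
  exact isClosed_biInter fun A _ => (hF.preimage (by fun_prop)).inter (hF.preimage (by fun_prop))

lemma compactSpace_orthogonalStabilizer (hF : IsClosed F) :
    CompactSpace (orthogonalStabilizer F) := by
  have : CompactSpace (Matrix.orthogonalGroup (Fin n) ℝ) :=
    isCompact_iff_compactSpace.1 isCompact_orthogonalGroup
  exact isCompact_iff_compactSpace.1 (isClosed_orthogonalStabilizer hF).isCompact

instance : MeasurableSpace (orthogonalStabilizer F) := borel _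

instance : BorelSpace (orthogonalStabilizer F) := ⟨rfl⟩

instance : SecondCountableTopology (orthogonalStabilizer F) :=
  have : SecondCountableTopology (Mat n) :=
    inferInstanceAs (SecondCountableTopology (Fin n → Fin n → ℝ))
  (IsEmbedding.subtypeVal.comp IsEmbedding.subtypeVal).secondCountableTopology (β := Mat n)

theorem exists_isMulRightInvariant (hF : IsClosed F) :
    ∃ ν : Measure (orthogonalStabilizer F), IsProbabilityMeasure ν ∧ ν.IsMulRightInvariant := by
  have := compactSpace_orthogonalStabilizer hF
  let ν : Measure (orthogonalStabilizer F) := Measure.haarMeasure ⊤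
  have hν : ν univ = 1 :=
    Measure.haarMeasure_self (K₀ := (⊤ : TopologicalSpace.PositiveCompacts _))
  exact ⟨ν.inv, ⟨by simp [hν]⟩, inferInstance⟩

section OrbitAverage

lemma continuous_rot_apply {X : Type*} [TopologicalSpace X]
    {g : X → Matrix.orthogonalGroup (Fin n) ℝ} {f : X → Euc n} (hg : Continuous g)
    (hf : Continuous f) : Continuous fun x => rot (g x) (f x) :=
  (PiLp.continuous_toLp 2 _).comp <| Continuous.matrix_mulVec
    (continuous_subtype_val.comp hg) ((PiLp.continuous_ofLp 2 _).comp hf)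

lemma IsSTInvariant.exists_rot_eq (hST : IsSTInvariant F) {x y : Euc n} (h : ‖x‖ = ‖y‖) :
    ∃ g ∈ orthogonalStabilizer F, rot g x = y := by
  rcases eq_or_ne x 0 with rfl | hx
  · exact ⟨1, one_mem _, by simp [norm_eq_zero.1 (h.symm.trans norm_zero)]⟩
  have hx₀ : ‖x‖ ≠ 0 := norm_ne_zero_iff.2 hx
  have hy₀ : ‖y‖ ≠ 0 := h ▸ hx₀
  obtain ⟨g, hg, hgxy⟩ := hST.exists_orthogonalStabilizer (x := ‖x‖⁻¹ • x) (y := ‖y‖⁻¹ • y)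
    (by simp [norm_smul, hx₀]) (by simp [norm_smul, hy₀])
  refine ⟨g, hg, ?_⟩
  have hrot : rot g (‖x‖⁻¹ • x) = ‖y‖⁻¹ • y := WithLp.ofLp_injective 2 hgxy
  rw [map_smul, h] at hrot
  exact smul_right_injective _ (inv_ne_zero hy₀) hrot

/-- The average of a function over the orbits of the stabilizer of `F`. -/
noncomputable def orbitAvg (ν : Measure (orthogonalStabilizer F)) (v : Euc n → ℝ≥0∞) (x : Euc n) :
    ℝ≥0∞ := ∫⁻ g, v (rot g.1 x) ∂ν

variable {ν : Measure (orthogonalStabilizer F)} {v : Euc n → ℝ≥0∞}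

lemma orbitAvg_radial [ν.IsMulRightInvariant] (hST : IsSTInvariant F) {x y : Euc n}
    (h : ‖x‖ = ‖y‖) : orbitAvg ν v x = orbitAvg ν v y := by
  obtain ⟨g, hg, rfl⟩ := hST.exists_rot_eq h
  rw [orbitAvg, ← lintegral_mul_right_eq_self _ (⟨g, hg⟩ : orthogonalStabilizer F)]
  simp only [Subgroup.coe_mul, map_mul, LinearIsometryEquiv.coe_mul, Function.comp_apply, orbitAvg]

variable [IsProbabilityMeasure ν]

lemma measurePreserving_rot_apply (ν : Measure (orthogonalStabilizer F))
    [IsProbabilityMeasure ν] :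
    MeasurePreserving (fun q : Euc n × orthogonalStabilizer F => rot q.2.1 q.1)
      (volume.prod ν) volume := by
  have hmeas : Measurable fun q : Euc n × orthogonalStabilizer F => rot q.2.1 q.1 :=
    (continuous_rot_apply (by fun_prop) (by fun_prop)).measurable
  refine ⟨hmeas, Measure.ext fun s hs => ?_⟩
  have hslice : ∀ g : orthogonalStabilizer F, volume (rot g.1 ⁻¹' s) = volume s := fun g =>
    (rot g.1).measurePreserving.measure_preimage hs.nullMeasurableSet
  rw [Measure.map_apply hmeas hs, Measure.prod_apply_symm (hmeas hs)]
  exact (lintegral_congr hslice).trans (by simp)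

lemma lintegral_orbitAvg (hv : AEMeasurable v) : ∫⁻ x, orbitAvg ν v x = ∫⁻ x, v x := by
  have hact := measurePreserving_rot_apply ν
  have hprod : ∫⁻ x, v x = ∫⁻ q, v (rot q.2.1 q.1) ∂(volume.prod ν) := by
    conv_lhs => rw [← hact.map_eq]
    exact lintegral_map' (by rwa [hact.map_eq]) hact.measurable.aemeasurable
  rw [hprod]
  exact (lintegral_prod _ (hv.comp_quasiMeasurePreserving hact.quasiMeasurePreserving)).symm

lemma orbitAvg_zero : orbitAvg ν v 0 = v 0 := by
  simp [orbitAvg]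

lemma lowerSemicontinuous_orbitAvg (hv : LowerSemicontinuous v) :
    LowerSemicontinuous (orbitAvg ν v) := by
  obtain ⟨f, hf, hfk, hmono, hsup⟩ := exists_monotone_continuous_iSup_eq hv
  have hrot : ∀ x, Continuous fun g : orthogonalStabilizer F => rot g.1 x := fun x =>
    continuous_rot_apply continuous_subtype_val continuous_const
  have heq : orbitAvg ν v = fun x => ⨆ k, ∫⁻ g, f k (rot g.1 x) ∂ν := by
    ext x
    simp_rw [orbitAvg, ← hsup]
    exact lintegral_iSup (fun k => ((hf k).comp (hrot _)).measurable)
      fun k l hkl g => hmono hkl _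
  rw [heq]
  refine lowerSemicontinuous_iSup fun k => Continuous.lowerSemicontinuous ?_
  refine continuous_iff_continuousAt.2 fun x => ?_
  refine tendsto_lintegral_filter_of_dominated_convergence (fun _ => (k : ℝ≥0∞))
    (Eventually.of_forall fun y => ((hf k).comp (hrot _)).measurable)
    (Eventually.of_forall fun y => Eventually.of_forall fun g => hfk k _) ?_
    (Eventually.of_forall fun g => ((hf k).comp (rot g.1).continuous).continuousAt)
  simp

variable {Ω : Set (Euc n)} {u : Euc n → EReal} {M : ℝ}

lemma lintegral_orbitAvg_deficit_le {ℓ : Mat n →L[ℝ] ℝ} {μ : Measure (Euc n)}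
    (hμ : IsHarmonicMeasure ℓ μ) (hℓ : IsElliptic ℓ) (hFℓ : F ⊆ halfSpace ℓ) (hΩ : IsOpen Ω)
    (hu : IsSubharmonicOn F Ω u) (hM : ∀ x ∈ Ω, u x ≤ M) {x : Euc n} {s : ℝ} (hs : 0 < s)
    (hball : ∀ g ∈ orthogonalStabilizer F, Metric.closedBall (rot g x) s ⊆ Ω) :
    ∫⁻ y, orbitAvg ν (deficit Ω M u) (s • y + x) ∂μ ≤ orbitAvg ν (deficit Ω M u) x := by
  have := hμ.isProbabilityMeasure
  have hmeas : Measurable (deficit Ω M u) := (lowerSemicontinuous_deficit hΩ M hu.usc).measurable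
  have hact : Continuous fun q : Euc n × orthogonalStabilizer F => rot q.2.1 (s • q.1 + x) :=
    continuous_rot_apply (by fun_prop) (by fun_prop)
  simp only [orbitAvg]
  refine (lintegral_lintegral_swap ?_).trans_le (lintegral_mono fun g => ?_)
  · exact (hmeas.comp hact.measurable).aemeasurable
  have hug : IsSubharmonicOn F ((fun y => rot g.1 y) ⁻¹' Ω) (fun y => u (rot g.1 y)) := by
    simpa only [add_zero] using hu.comp_rot_add g.2 0
  refine hμ.lintegral_deficit_le hℓ (hΩ.preimage (rot g.1).continuous) hs (fun y hy => ?_)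
    (hug.mono_subequation hFℓ) fun y hy => hM _ hy
  refine hball g.1 g.2 ?_
  rwa [Metric.mem_closedBall, (rot g.1).dist_map]

end OrbitAverage

theorem IsRieszCone.exists_isHarmonicMeasure (h : IsRieszCone F p) {δ : ℝ} (hδ : 0 < δ) {e : Euc n}
    (he : ‖e‖ = 1) : ∃ (ℓ : Mat n →L[ℝ] ℝ) (μ : Measure (Euc n)), IsElliptic ℓ ∧
      IsHarmonicMeasure ℓ μ ∧ F ⊆ halfSpace ℓ ∧ IsSupportFunctional F p δ e ℓ := by
  obtain ⟨ℓ, hℓ⟩ := h.exists_isSupportFunctional hδ he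
  have hell : IsElliptic ℓ :=
    ⟨fun P hP => hℓ.nonneg P (h.posSemidef_mem hP), by linarith [h.one_le, hℓ.le_map_one]⟩
  obtain ⟨μ, hμ⟩ := hell.exists_isHarmonicMeasure
  exact ⟨ℓ, μ, hell, hμ, h.isSubequation.subset_halfSpace hℓ.nonneg, hℓ⟩

section MeanValue

variable {ν : Measure (orthogonalStabilizer F)} [IsProbabilityMeasure ν] [ν.IsMulRightInvariant]
  {Ω : Set (Euc n)} {u : Euc n → EReal} {M : ℝ}

lemma IsRieszCone.orbitAvg_deficit_le_zero (h : IsRieszCone F p) (hΩ : IsOpen Ω)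
    (hu : IsSubharmonicOn F Ω u) (hM : ∀ x ∈ Ω, u x ≤ M) {z : Euc n}
    (hball : Metric.closedBall 0 ‖z‖ ⊆ Ω) :
    orbitAvg ν (deficit Ω M u) z ≤ deficit Ω M u 0 := by
  rcases eq_or_ne z 0 with rfl | hz
  · exact orbitAvg_zero.le
  obtain ⟨e, he⟩ := exists_norm_eq_one h.dim_pos
  obtain ⟨ℓ, μ, hℓ, hμ, hFℓ, -⟩ := h.exists_isHarmonicMeasure one_pos he
  have := hμ.isProbabilityMeasure
  have hradial : ∀ᵐ y ∂μ, orbitAvg ν (deficit Ω M u) (‖z‖ • y + 0) =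
      orbitAvg ν (deficit Ω M u) z := by
    filter_upwards [hμ.ae_mem_sphere] with y hy
    refine orbitAvg_radial h.isSTInvariant ?_
    rw [add_zero, norm_smul, norm_norm, mem_sphere_zero_iff_norm.1 hy, mul_one]
  calc orbitAvg ν (deficit Ω M u) z
      = ∫⁻ y, orbitAvg ν (deficit Ω M u) (‖z‖ • y + 0) ∂μ := by
        rw [lintegral_congr_ae hradial]; simp
    _ ≤ orbitAvg ν (deficit Ω M u) 0 :=
        lintegral_orbitAvg_deficit_le hμ hℓ hFℓ hΩ hu hM (norm_pos_iff.2 hz) fun g _ => by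
          rwa [map_zero]
    _ = deficit Ω M u 0 := orbitAvg_zero

lemma IsRieszCone.setLIntegral_deficit_le_zero (h : IsRieszCone F p) (hΩ : IsOpen Ω)
    (hu : IsSubharmonicOn F Ω u) (hM : ∀ x ∈ Ω, u x ≤ M) {s : ℝ}
    (hball : Metric.closedBall 0 s ⊆ Ω) :
    ∫⁻ z in Metric.closedBall 0 s, deficit Ω M u z ≤
      volume (Metric.closedBall (0 : Euc n) s) * deficit Ω M u 0 := by
  obtain ⟨ν, _, _⟩ := exists_isMulRightInvariant h.isSubequation.closed
  set V := deficit Ω M u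
  set B := Metric.closedBall (0 : Euc n) s
  have hB : MeasurableSet B := measurableSet_closedBall
  have hV : Measurable V := (lowerSemicontinuous_deficit hΩ M hu.usc).measurable
  have hle : ∀ z, orbitAvg ν (B.indicator V) z ≤ B.indicator (fun _ => V 0) z := fun z => by
    by_cases hz : z ∈ B
    · have hz' : Metric.closedBall 0 ‖z‖ ⊆ Ω :=
        (Metric.closedBall_subset_closedBall (mem_closedBall_zero_iff.1 hz)).trans hball
      rw [indicator_of_mem hz]
      exact (lintegral_mono fun g => indicator_le_self _ _ _).trans
        (h.orbitAvg_deficit_le_zero hΩ hu hM hz')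
    · have hrot : ∀ g : orthogonalStabilizer F, rot g.1 z ∉ B := fun g => by
        rwa [mem_closedBall_zero_iff, (rot g.1).norm_map, ← mem_closedBall_zero_iff]
      simp [orbitAvg, indicator_of_notMem, hz, hrot]
  calc ∫⁻ z in B, V z = ∫⁻ z, orbitAvg ν (B.indicator V) z := by
        rw [lintegral_orbitAvg (hV.indicator hB).aemeasurable, lintegral_indicator hB]
    _ ≤ ∫⁻ z, B.indicator (fun _ => V 0) z := lintegral_mono hle
    _ = volume B * V 0 := by rw [lintegral_indicator hB, setLIntegral_const, mul_comm]

theorem IsRieszCone.setLIntegral_deficit_le (h : IsRieszCone F p) (hΩ : IsOpen Ω)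
    (hu : IsSubharmonicOn F Ω u) (hM : ∀ x ∈ Ω, u x ≤ M) {x : Euc n} {s : ℝ}
    (hball : Metric.closedBall x s ⊆ Ω) :
    ∫⁻ z in Metric.closedBall x s, deficit Ω M u z ≤
      volume (Metric.closedBall x s) * deficit Ω M u x := by
  have hpre : (fun y => y + x) ⁻¹' Metric.closedBall x s = Metric.closedBall 0 s := by
    ext y
    simp
  have htrans : MeasurePreserving (fun y : Euc n => y + x) := measurePreserving_add_right volume x
  have hux : IsSubharmonicOn F ((fun y => y + x) ⁻¹' Ω) (fun y => u (y + x)) := by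
    simpa only [one_smul] using hu.comp_smul_add h.isConeSet one_ne_zero x
  have hzero := h.setLIntegral_deficit_le_zero (hΩ.preimage (by fun_prop)) hux (M := M)
    (fun y hy => hM _ hy) (hpre ▸ preimage_mono hball)
  have hx : deficit ((fun y => y + x) ⁻¹' Ω) M (fun y => u (y + x)) 0 = deficit Ω M u x := by
    change deficit Ω M u (0 + x) = _
    rw [zero_add]
  rw [← hpre, htrans.measure_preimage measurableSet_closedBall.nullMeasurableSet, hx] at hzero
  rwa [← htrans.setLIntegral_comp_preimage measurableSet_closedBall
    (lowerSemicontinuous_deficit hΩ M hu.usc).measurable]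

end MeanValue


/-! ### The Riesz kernel and concavity of the orbit averages -/

/-- A primitive of `t ^ (-p / 2)` on the half-line `t > 0`. -/
noncomputable def rieszProfile (p t : ℝ) : ℝ :=
  if p = 2 then Real.log t else t ^ (1 - p / 2) / (1 - p / 2)

/-- The Riesz kernel of characteristic `p` as a function of the radius, normalized so that it is
increasing; it is a positive multiple of `r ^ (2 - p)`, `log r`, `-r ^ (2 - p)` for `p < 2`,
`p = 2`, `p > 2` respectively. -/
noncomputable def rieszKernel (p r : ℝ) : ℝ := rieszProfile p (r ^ 2)

/-- The open annulus centred at the origin with radii `r` and `s`. -/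
def annulus (r s : ℝ) : Set (Euc n) := {x | r < ‖x‖ ∧ ‖x‖ < s}

lemma isOpen_annulus (r s : ℝ) : IsOpen (annulus r s : Set (Euc n)) :=
  (isOpen_lt continuous_const continuous_norm).inter (isOpen_lt continuous_norm continuous_const)

lemma isCompact_closedAnnulus {E : Type*} [SeminormedAddCommGroup E] [ProperSpace E] (r s : ℝ) :
    IsCompact {z : E | r ≤ ‖z‖ ∧ ‖z‖ ≤ s} :=
  (isCompact_closedBall (0 : E) s).of_isClosed_subset
    ((isClosed_le continuous_const continuous_norm).inter
      (isClosed_le continuous_norm continuous_const)) fun _ hz => mem_closedBall_zero_iff.2 hz.2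

lemma closedBall_rot_subset_annulus {r s t : ℝ} {x : Euc n}
    (hball : Metric.closedBall x t ⊆ annulus r s) (g : Matrix.orthogonalGroup (Fin n) ℝ) :
    Metric.closedBall (rot g x) t ⊆ annulus r s := by
  intro z hz
  rw [← (rot g).apply_symm_apply z, Metric.mem_closedBall, (rot g).dist_map] at hz
  simpa only [annulus, mem_ofPred_eq, (rot g).symm.norm_map] using hball hz

section RieszKernel

variable (p) {t : ℝ}

lemma hasDerivAt_rieszProfile (ht : 0 < t) :
    HasDerivAt (rieszProfile p) (t ^ (-(p / 2))) t := by
  unfold rieszProfile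
  split_ifs with h
  · simpa [h, Real.rpow_neg_one] using Real.hasDerivAt_log ht.ne'
  · have hne : 1 - p / 2 ≠ 0 := fun h' => h (by linarith)
    refine ((Real.hasDerivAt_rpow_const (p := 1 - p / 2) (Or.inl ht.ne')).div_const
      (1 - p / 2)).congr_deriv ?_
    rw [mul_div_assoc, mul_div_cancel₀ _ hne]
    ring_nf

lemma contDiffAt_rieszProfile (ht : 0 < t) : ContDiffAt ℝ 2 (rieszProfile p) t := by
  unfold rieszProfile
  split_ifs with h
  · exact Real.contDiffAt_log.2 ht.ne'
  · exact (Real.contDiffAt_rpow_const_of_ne ht.ne').div_const _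

lemma strictMonoOn_rieszKernel : StrictMonoOn (rieszKernel p) (Ioi 0) := by
  have hprofile : StrictMonoOn (rieszProfile p) (Ioi 0) := by
    refine strictMonoOn_of_deriv_pos (convex_Ioi 0)
      (fun t ht => (hasDerivAt_rieszProfile p ht).continuousAt.continuousWithinAt) fun t ht => ?_
    rw [interior_Ioi] at ht
    rw [(hasDerivAt_rieszProfile p ht).deriv]
    exact Real.rpow_pos_of_pos ht _
  intro x (hx : 0 < x) y _ hxy
  exact hprofile (pow_pos hx 2) (pow_pos (hx.trans hxy) 2) (by gcongr)

lemma rieszKernel_mul_sub {r s : ℝ} (hr : 0 < r) (hs : 0 < s) (ht : 0 < t) :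
    rieszKernel p (r * s) - rieszKernel p (r * t) =
      r ^ (2 - p) * (rieszKernel p s - rieszKernel p t) := by
  unfold rieszKernel rieszProfile
  split_ifs with h
  · rw [mul_pow, mul_pow, Real.log_mul (by positivity) (by positivity),
      Real.log_mul (by positivity) (by positivity)]
    simp [h]
  · have hpow : r ^ (2 - p) = (r ^ 2) ^ (1 - p / 2) := by
      rw [← Real.rpow_natCast_mul hr.le]
      push_cast
      ring_nf
    rw [mul_pow, mul_pow, Real.mul_rpow (by positivity) (by positivity),
      Real.mul_rpow (by positivity) (by positivity), hpow]
    ring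

lemma contDiffAt_rieszProfile_normSq_sub {x y : Euc n} (hxy : x ≠ y) :
    ContDiffAt ℝ 2 (fun z => rieszProfile p (‖z - y‖ ^ 2)) x :=
  contDiffAt_comp_normSq_sub <| contDiffAt_rieszProfile p <|
    pow_pos (norm_pos_iff.2 (sub_ne_zero.2 hxy)) 2

lemma hessian_rieszProfile_normSq_sub {x y : Euc n} (hxy : x ≠ y) :
    hessian (fun z => rieszProfile p (‖z - y‖ ^ 2)) x =
      (2 * (‖x - y‖ ^ 2) ^ (-(p / 2))) • rieszMat (‖x - y‖⁻¹ • (x - y)) p := by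
  have hs : 0 < ‖x - y‖ := norm_pos_iff.2 (sub_ne_zero.2 hxy)
  have hs₂ : 0 < ‖x - y‖ ^ 2 := by positivity
  have hproj : projLine (x - y) = ‖x - y‖ ^ 2 • projLine (‖x - y‖⁻¹ • (x - y)) := by
    ext i j
    simp only [projLine, Matrix.of_apply, Matrix.smul_apply, PiLp.smul_apply, smul_eq_mul]
    field_simp
  have hpow : (‖x - y‖ ^ 2) ^ (-(p / 2) - 1) * ‖x - y‖ ^ 2 = (‖x - y‖ ^ 2) ^ (-(p / 2)) := by
    rw [Real.rpow_sub_one hs₂.ne', div_mul_cancel₀ _ hs₂.ne']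
  rw [hessian_comp_normSq_sub ((lt_mem_nhds hs₂).mono fun t ht => hasDerivAt_rieszProfile p ht)
    (Real.hasDerivAt_rpow_const (Or.inl hs₂.ne')), rieszMat_eq, hproj, ← hpow]
  module

end RieszKernel

/-- The comparison functions `α K(|z|) + ε |z|² + c` for radial functions, `K` being the Riesz
kernel; the quadratic term makes them strictly subharmonic for suitable half-spaces. -/
noncomputable def rieszBarrier (p α ε c : ℝ) (z : Euc n) : ℝ :=
  α * rieszKernel p ‖z‖ + (ε * ‖z‖ ^ 2 + c)

lemma contDiffAt_rieszBarrier (p α ε c : ℝ) {y : Euc n} (hy : y ≠ 0) :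
    ContDiffAt ℝ 2 (rieszBarrier p α ε c) y := by
  have hK : ContDiffAt ℝ 2 (fun z : Euc n => rieszKernel p ‖z‖) y := by
    simpa only [sub_zero, rieszKernel] using contDiffAt_rieszProfile_normSq_sub p hy
  exact (contDiffAt_const.mul hK).add
    ((contDiffAt_const.mul (contDiff_norm_sq ℝ).contDiffAt).add contDiffAt_const)

lemma hessian_rieszBarrier (p α ε c : ℝ) {y : Euc n} (hy : y ≠ 0) :
    hessian (rieszBarrier p α ε c) y =
      (α * (2 * (‖y‖ ^ 2) ^ (-(p / 2)))) • rieszMat (‖y‖⁻¹ • y) p + (2 * ε) • 1 := by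
  have hK := contDiffAt_rieszProfile_normSq_sub p hy
  have hS := contDiffAt_const_mul_normSq_sub ε (0 : Euc n) y
  have hsum := hessian_add ((contDiffAt_const (c := α)).mul hK)
    (hS.add (contDiffAt_const (c := c)))
  rw [hessian_const_mul hK α, hessian_rieszProfile_normSq_sub p hy, hessian_add_const,
    hessian_const_mul_normSq_sub, smul_smul] at hsum
  unfold rieszBarrier rieszKernel
  simpa only [sub_zero] using hsum

theorem IsRieszCone.exists_map_hessian_pos (h : IsRieszCone F p) (α c : ℝ) {ε : ℝ} (hε : 0 < ε)
    {y : Euc n} (hy : y ≠ 0) : ∃ (ℓ : Mat n →L[ℝ] ℝ) (μ : Measure (Euc n)), IsElliptic ℓ ∧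
      IsHarmonicMeasure ℓ μ ∧ F ⊆ halfSpace ℓ ∧
      0 < ℓ (hessian (rieszBarrier p α ε c) y) := by
  set q : ℝ := (‖y‖ ^ 2) ^ (-(p / 2))
  have hunit : ‖‖y‖⁻¹ • y‖ = 1 := norm_smul_inv_norm (𝕜 := ℝ) hy
  obtain ⟨ℓ, μ, hℓ, hμ, hFℓ, hsupp⟩ := h.exists_isHarmonicMeasure
    (δ := ε / (|α| * q + 1)) (by positivity) hunit
  refine ⟨ℓ, μ, hℓ, hμ, hFℓ, ?_⟩
  have hgap : |α * (2 * q) * (ℓ 1 - p)| ≤ 2 * ε * (|α| * q / (|α| * q + 1)) := by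
    have hgap_nonneg : 0 ≤ ℓ 1 - p := sub_nonneg.2 hsupp.le_map_one
    have hgap_le : ℓ 1 - p ≤ ε / (|α| * q + 1) := by linarith [hsupp.map_one_lt]
    calc |α * (2 * q) * (ℓ 1 - p)| = |α| * (2 * q) * (ℓ 1 - p) := by
          rw [abs_mul, abs_mul, abs_of_nonneg hgap_nonneg,
            abs_of_nonneg (by positivity : 0 ≤ 2 * q)]
      _ ≤ |α| * (2 * q) * (ε / (|α| * q + 1)) := by gcongr
      _ = 2 * ε * (|α| * q / (|α| * q + 1)) := by ring
  have hfrac : |α| * q / (|α| * q + 1) < 1 := (div_lt_one (by positivity)).2 (lt_add_one _)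
  have hone : 1 ≤ ℓ 1 := h.one_le.trans hsupp.le_map_one
  rw [hessian_rieszBarrier p α ε c hy, rieszMat_eq]
  simp only [map_add, map_sub, map_smul, smul_eq_mul, hsupp.map_projLine]
  nlinarith [neg_le_of_abs_le hgap]

section TouchingBelow

variable {ℓ : Mat n →L[ℝ] ℝ} {μ : Measure (Euc n)} {f : Euc n → ℝ} {y : Euc n}

lemma IsHarmonicMeasure.eventually_lintegral_sub_le (hμ : IsHarmonicMeasure ℓ μ)
    (hℓ : IsElliptic ℓ) (hf : ContDiffAt ℝ 2 f y) (hpos : 0 < ℓ (hessian f y)) {N : ℝ}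
    (hN : f y < N) :
    ∀ᶠ s in 𝓝[>] (0 : ℝ),
      ∫⁻ z, ENNReal.ofReal (N - f (s • z + y)) ∂μ ≤ ENNReal.ofReal (N - f y) := by
  have hgood : ∀ᶠ z in 𝓝 y, ContDiffAt ℝ 2 f z ∧ 0 < ℓ (hessian f z) ∧ f z < N :=
    (hf.eventually (by simp)).and <|
      ((ℓ.continuous.continuousAt.comp (continuousAt_hessian hf)).eventually
        (lt_mem_nhds hpos)).and (hf.continuousAt.eventually (gt_mem_nhds hN))
  obtain ⟨r, hr, hball⟩ := Metric.mem_nhds_iff.1 hgood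
  have hsub : IsSubharmonicOn (halfSpace ℓ) (Metric.ball y r) (fun z => (f z : EReal)) :=
    isSubharmonicOn_of_hessian_mem (isSubequation_halfSpace hℓ.nonneg)
      (fun z hz => (hball hz).1) fun z hz => ⟨isSymm_hessian (hball hz).1, (hball hz).2.1.le⟩
  filter_upwards [Ioo_mem_nhdsGT hr] with s hs
  have hmean := hμ.lintegral_deficit_le hℓ Metric.isOpen_ball hs.1
    (Metric.closedBall_subset_ball hs.2) hsub (M := N)
    fun z hz => EReal.coe_le_coe_iff.2 (hball hz).2.2.le
  rw [deficit_of_eq_coe (u := fun z => (f z : EReal)) (Metric.mem_ball_self hr) rfl] at hmean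
  refine le_of_eq_of_le (lintegral_congr_ae ?_) hmean
  filter_upwards [hμ.ae_mem_sphere] with z hz
  refine (deficit_of_eq_coe (u := fun z => (f z : EReal)) ?_ rfl).symm
  rw [mem_ball_iff_norm, add_sub_cancel_right, norm_smul, mem_sphere_zero_iff_norm.1 hz, mul_one,
    Real.norm_of_nonneg hs.1.le]
  exact hs.2

lemma IsHarmonicMeasure.ofReal_le_lintegral_sub_add (hμ : IsHarmonicMeasure ℓ μ)
    {v : Euc n → ℝ≥0∞} (hv : Measurable v) {s : ℝ} (hs : 0 < s)
    (hle : ∀ z ∈ Metric.closedBall y s, ENNReal.ofReal (f z) ≤ v z) (N η : ℝ) :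
    ENNReal.ofReal (N + η * s ^ 2) ≤
      ∫⁻ z, ENNReal.ofReal (N - (f (s • z + y) + -η * ‖s • z + y - y‖ ^ 2)) ∂μ +
        ∫⁻ z, v (s • z + y) ∂μ := by
  have := hμ.isProbabilityMeasure
  calc ENNReal.ofReal (N + η * s ^ 2)
      = ∫⁻ _, ENNReal.ofReal (N + η * s ^ 2) ∂μ := by simp
    _ ≤ ∫⁻ z, ENNReal.ofReal (N - (f (s • z + y) + -η * ‖s • z + y - y‖ ^ 2)) +
          v (s • z + y) ∂μ := lintegral_mono_ae ?_
    _ = _ := lintegral_add_right _ (show Measurable fun z => v (s • z + y) by fun_prop)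
  filter_upwards [hμ.ae_mem_sphere] with z hz
  have hnorm : ‖s • z + y - y‖ = s := by
    rw [add_sub_cancel_right, norm_smul, mem_sphere_zero_iff_norm.1 hz, mul_one,
      Real.norm_of_nonneg hs.le]
  calc ENNReal.ofReal (N + η * s ^ 2)
      = ENNReal.ofReal (N - (f (s • z + y) + -η * ‖s • z + y - y‖ ^ 2) + f (s • z + y)) := by
        rw [hnorm]
        ring_nf
    _ ≤ ENNReal.ofReal (N - (f (s • z + y) + -η * ‖s • z + y - y‖ ^ 2)) +
          ENNReal.ofReal (f (s • z + y)) := ENNReal.ofReal_add_le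
    _ ≤ _ := by gcongr; exact hle _ (mem_closedBall_iff_norm.2 hnorm.le)

theorem IsHarmonicMeasure.map_hessian_nonpos (hμ : IsHarmonicMeasure ℓ μ) (hℓ : IsElliptic ℓ)
    {v : Euc n → ℝ≥0∞} (hv : Measurable v)
    (hmean : ∀ᶠ s in 𝓝[>] (0 : ℝ), ∫⁻ z, v (s • z + y) ∂μ ≤ v y)
    (hf : ContDiffAt ℝ 2 f y) (hle : ∀ᶠ z in 𝓝 y, ENNReal.ofReal (f z) ≤ v z)
    (heq : v y = ENNReal.ofReal (f y)) (hnonneg : 0 ≤ f y) : ℓ (hessian f y) ≤ 0 := by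
  by_contra! hpos
  obtain ⟨η, hη, hηℓ⟩ : ∃ η > 0, 0 < ℓ (hessian f y) - 2 * η * ℓ 1 := by
    have hone := hℓ.one_pos
    refine ⟨ℓ (hessian f y) / (4 * ℓ 1), by positivity, ?_⟩
    field_simp
    linarith
  set g : Euc n → ℝ := fun z => f z + -η * ‖z - y‖ ^ 2 with hg
  have hS := contDiffAt_const_mul_normSq_sub (-η) y y
  have hgy : g y = f y := by simp [hg]
  have hgpos : 0 < ℓ (hessian g y) := by
    rw [hg, hessian_add hf hS, hessian_const_mul_normSq_sub]
    simpa [sub_eq_add_neg] using hηℓ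
  obtain ⟨s, ⟨⟨⟨hvs, hgs⟩, hball⟩, hs⟩⟩ := (((hmean.and
    (hμ.eventually_lintegral_sub_le hℓ (hf.add hS) hgpos (by linarith : g y < f y + 1))).and
      (nhdsWithin_le_nhds (eventually_closedBall_subset hle))).and self_mem_nhdsWithin).exists
  have hint : ENNReal.ofReal (f y + 1 + η * s ^ 2) ≤ ENNReal.ofReal (f y + 1) := by
    calc _ ≤ ∫⁻ z, ENNReal.ofReal (f y + 1 - g (s • z + y)) ∂μ + ∫⁻ z, v (s • z + y) ∂μ :=
          hμ.ofReal_le_lintegral_sub_add hv hs hball (f y + 1) η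
      _ ≤ ENNReal.ofReal (f y + 1 - g y) + ENNReal.ofReal (f y) := heq ▸ add_le_add hgs hvs
      _ = ENNReal.ofReal (f y + 1) := by
          rw [← ENNReal.ofReal_add (by linarith) hnonneg, hgy]
          ring_nf
  rw [ENNReal.ofReal_le_ofReal_iff (by linarith)] at hint
  have : 0 < η * s ^ 2 := mul_pos hη (pow_pos hs 2)
  linarith

end TouchingBelow

lemma exists_touching_below {E : Type*} [TopologicalSpace E] {C : Set E} (hC : IsCompact C)
    {v : E → ℝ≥0∞} (hv : LowerSemicontinuous v) {ψ : E → ℝ} (hψ : ContinuousOn ψ C) {x : E}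
    (hx : x ∈ C) (hlt : v x < ENNReal.ofReal (ψ x)) :
    ∃ y ∈ C, ∃ d > 0, d ≤ ψ y ∧ v y = ENNReal.ofReal (ψ y - d) ∧
      ∀ z ∈ C, ENNReal.ofReal (ψ z - d) ≤ v z := by
  have hneg : UpperSemicontinuousOn (fun z => -(v z : EReal)) C := by
    have hcoe : LowerSemicontinuous fun z => (v z : EReal) :=
      continuous_coe_ennreal_ereal.comp_lowerSemicontinuous hv
        EReal.coe_ennreal_strictMono.monotone
    exact (continuous_neg.comp_lowerSemicontinuous_antitone hcoe
      fun s t hst => EReal.neg_le_neg_iff.2 hst).upperSemicontinuousOn _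
  have hcoe_le : ∀ (z : E) (c : ℝ), -(v z : EReal) ≤ ((-c : ℝ) : EReal) →
      ENNReal.ofReal c ≤ v z := fun z c hz => by
    rw [EReal.coe_neg, EReal.neg_le_neg_iff] at hz
    rw [← EReal.coe_ennreal_le_coe_ennreal_iff, EReal.coe_ennreal_ofReal]
    rcases le_total 0 c with hc | hc
    · rwa [max_eq_left hc]
    · rw [max_eq_right hc]
      exact EReal.coe_ennreal_nonneg _
  obtain ⟨y, hyC, t, hyt, hmax⟩ := exists_touching hC hneg
    (fun z _ => by simp [EReal.neg_eq_top_iff]) hψ.neg hx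
    (by simpa [EReal.neg_eq_bot_iff] using hlt.ne_top)
  have hvy : (v y : EReal) = ((-t : ℝ) : EReal) := by rw [EReal.coe_neg, ← hyt, neg_neg]
  have ht : 0 ≤ -t := EReal.coe_nonneg.1 (hvy ▸ EReal.coe_ennreal_nonneg _)
  have hvy' : v y = ENNReal.ofReal (ψ y - (ψ y + t)) := by
    rw [sub_add_cancel_left, ← EReal.coe_ennreal_eq_coe_ennreal_iff, hvy, EReal.coe_ennreal_ofReal,
      max_eq_left ht]
  have hle : ∀ z ∈ C, ENNReal.ofReal (ψ z - (ψ y + t)) ≤ v z := fun z hz =>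
    hcoe_le z _ ((hmax z hz).trans_eq (by congr 1; simp only [Pi.neg_apply]; ring))
  have hd : 0 < ψ y + t := by
    have := (hle x hx).trans_lt hlt
    have := (ENNReal.ofReal_lt_ofReal_iff').1 this
    linarith [this.1]
  exact ⟨y, hyC, ψ y + t, hd, by linarith, hvy', hle⟩

lemma exists_lt_ofReal_rieszBarrier {α β : ℝ} {t : ℝ≥0∞} {x : Euc n} (c : ℝ)
    (ht : t < ENNReal.ofReal (α * rieszKernel p ‖x‖ + β)) :
    ∃ ε > 0, t < ENNReal.ofReal (rieszBarrier p α ε (β - ε * c) x) := by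
  have hcont : Continuous fun ε => ENNReal.ofReal (rieszBarrier p α ε (β - ε * c) x) :=
    ENNReal.continuous_ofReal.comp (by unfold rieszBarrier; fun_prop)
  have hlim := (hcont.tendsto 0).eventually
    (lt_mem_nhds (a := t) (by simpa [rieszBarrier] using ht))
  obtain ⟨ε, hεt, hε⟩ := ((hlim.filter_mono nhdsWithin_le_nhds).and
    (self_mem_nhdsWithin (s := Ioi 0))).exists
  exact ⟨ε, hε, hεt⟩

section Concavity

variable {ν : Measure (orthogonalStabilizer F)} [IsProbabilityMeasure ν]
  {r₁ r₂ : ℝ} {u : Euc n → EReal} {M : ℝ}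

lemma IsRieszCone.orbitAvg_ne_rieszBarrier (h : IsRieszCone F p)
    (hu : IsSubharmonicOn F (annulus r₁ r₂) u) (hM : ∀ x ∈ annulus r₁ r₂, u x ≤ M)
    {α c ε : ℝ} (hε : 0 < ε) {y : Euc n} (hy₀ : y ≠ 0) (hy : y ∈ annulus r₁ r₂)
    (hle : ∀ᶠ z in 𝓝 y, ENNReal.ofReal (rieszBarrier p α ε c z) ≤
      orbitAvg ν (deficit (annulus r₁ r₂) M u) z)
    (hnonneg : 0 ≤ rieszBarrier p α ε c y) :
    orbitAvg ν (deficit (annulus r₁ r₂) M u) y ≠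
      ENNReal.ofReal (rieszBarrier p α ε c y) := by
  intro heq
  obtain ⟨ℓ, μ, hℓ, hμ, hFℓ, hpos⟩ := h.exists_map_hessian_pos α c hε hy₀
  have hΩ := isOpen_annulus (n := n) r₁ r₂
  have hlsc := lowerSemicontinuous_orbitAvg (ν := ν) (lowerSemicontinuous_deficit hΩ M hu.usc)
  refine hpos.not_ge (hμ.map_hessian_nonpos hℓ hlsc.measurable ?_
    (contDiffAt_rieszBarrier p α ε c hy₀) hle heq hnonneg)
  filter_upwards [self_mem_nhdsWithin,
    nhdsWithin_le_nhds (eventually_closedBall_subset (hΩ.mem_nhds hy))] with s hs hball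
  exact lintegral_orbitAvg_deficit_le hμ hℓ hFℓ hΩ hu hM hs fun g _ =>
    closedBall_rot_subset_annulus hball g

theorem IsRieszCone.orbitAvg_deficit_concave [ν.IsMulRightInvariant] (h : IsRieszCone F p)
    (hr₁ : 0 ≤ r₁) (hu : IsSubharmonicOn F (annulus r₁ r₂) u) (hM : ∀ x ∈ annulus r₁ r₂, u x ≤ M)
    {α β : ℝ} {a b x : Euc n} (ha : r₁ < ‖a‖) (hax : ‖a‖ < ‖x‖) (hxb : ‖x‖ < ‖b‖) (hb : ‖b‖ < r₂)
    (hva : ENNReal.ofReal (α * rieszKernel p ‖a‖ + β) ≤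
      orbitAvg ν (deficit (annulus r₁ r₂) M u) a)
    (hvb : ENNReal.ofReal (α * rieszKernel p ‖b‖ + β) ≤
      orbitAvg ν (deficit (annulus r₁ r₂) M u) b) :
    ENNReal.ofReal (α * rieszKernel p ‖x‖ + β) ≤
      orbitAvg ν (deficit (annulus r₁ r₂) M u) x := by
  set v := orbitAvg ν (deficit (annulus r₁ r₂) M u)
  have ha₀ : 0 < ‖a‖ := hr₁.trans_lt ha
  by_contra! hlt
  -- a strictly convex term makes the comparison function strictly subharmonic
  obtain ⟨ε, hε, hεx⟩ := exists_lt_ofReal_rieszBarrier (‖b‖ ^ 2) hlt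
  set ψ : Euc n → ℝ := rieszBarrier p α ε (β - ε * ‖b‖ ^ 2) with hψ_def
  have hlsc : LowerSemicontinuous v :=
    lowerSemicontinuous_orbitAvg (lowerSemicontinuous_deficit (isOpen_annulus r₁ r₂) M hu.usc)
  have hψ : ContinuousOn ψ {z | ‖a‖ ≤ ‖z‖ ∧ ‖z‖ ≤ ‖b‖} := fun z hz =>
    (contDiffAt_rieszBarrier p α ε _
      (norm_pos_iff.1 (ha₀.trans_le hz.1))).continuousAt.continuousWithinAt
  obtain ⟨y, hyC, d, hd, hdy, heq, hle⟩ :=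
    exists_touching_below (isCompact_closedAnnulus ‖a‖ ‖b‖) hlsc hψ ⟨hax.le, hxb.le⟩ hεx
  have hbdry : ∀ w : Euc n, ENNReal.ofReal (α * rieszKernel p ‖w‖ + β) ≤ v w → ‖w‖ ≠ ‖y‖ := by
    intro w hw hwy
    have hvw : v w = v y := orbitAvg_radial h.isSTInvariant hwy
    have hψy : ψ y ≤ α * rieszKernel p ‖y‖ + β := by
      have : ε * ‖y‖ ^ 2 ≤ ε * ‖b‖ ^ 2 := by gcongr; exact hyC.2
      simp only [hψ_def, rieszBarrier]
      linarith
    rw [hvw, heq, hwy, ENNReal.ofReal_le_ofReal_iff (sub_nonneg.2 hdy)] at hw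
    linarith
  have hay : ‖a‖ < ‖y‖ := hyC.1.lt_of_ne (hbdry a hva)
  have hyb : ‖y‖ < ‖b‖ := hyC.2.lt_of_ne (hbdry b hvb).symm
  have hsub : ∀ z, ψ z - d = rieszBarrier p α ε (β - ε * ‖b‖ ^ 2 - d) z := fun z => by
    simp only [hψ_def, rieszBarrier]
    ring
  simp only [hsub] at heq hle
  refine h.orbitAvg_ne_rieszBarrier hu hM hε (norm_pos_iff.1 (ha₀.trans hay))
    ⟨ha.trans hay, hyb.trans hb⟩ ?_ (hsub y ▸ sub_nonneg.2 hdy) heq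
  filter_upwards [(isOpen_annulus ‖a‖ ‖b‖).mem_nhds ⟨hay, hyb⟩] with z hz
  exact hle z ⟨hz.1.le, hz.2.le⟩

end Concavity

/-! ### Fast `L¹_loc` limits of subharmonic functions -/

lemma exists_real_upper_bound {E : Type*} [TopologicalSpace E] {C : Set E} (hC : IsCompact C)
    {u : E → EReal} (hu : UpperSemicontinuousOn u C) (hne : ∀ x ∈ C, u x ≠ ⊤) :
    ∃ M : ℝ, ∀ x ∈ C, u x ≤ M := by
  rcases C.eq_empty_or_nonempty with rfl | hCne
  · exact ⟨0, by simp⟩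
  obtain ⟨y, hy, hmax⟩ := hu.exists_isMaxOn hCne hC
  obtain ⟨M, hM, -⟩ := EReal.lt_iff_exists_real_btwn.1 (lt_top_iff_ne_top.2 (hne y hy))
  exact ⟨M, fun x hx => (hmax hx).trans hM.le⟩

lemma aemeasurable_restrict_of_upperSemicontinuousOn {α β : Type*} [TopologicalSpace α]
    [MeasurableSpace α] [OpensMeasurableSpace α] [TopologicalSpace β] [MeasurableSpace β]
    [BorelSpace β] [LinearOrder β] [OrderTopology β] [SecondCountableTopology β] {f : α → β}
    {s : Set α} (hs : MeasurableSet s) (hf : UpperSemicontinuousOn f s) (μ : Measure α) :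
    AEMeasurable f (μ.restrict s) :=
  aemeasurable_restrict_of_measurable_subtype hs
    (upperSemicontinuousOn_iff_restrict.2 hf : UpperSemicontinuous (s.domRestrict f)).measurable

lemma ereal_abs_sub_coe (x : EReal) (c : ℝ) :
    (x - c).abs = if x = ⊥ ∨ x = ⊤ then ⊤ else ENNReal.ofReal |x.toReal - c| := by
  induction x with
  | bot => simp
  | top => simp
  | coe t => simp [← EReal.coe_sub, EReal.abs_def]

lemma measurable_ereal_abs_sub_coe :
    Measurable fun q : EReal × ℝ => (q.1 - (q.2 : EReal)).abs := by
  have hdiff : Measurable fun q : EReal × ℝ => q.1.toReal - q.2 :=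
    measurable_fst.ereal_toReal.sub measurable_snd
  simp_rw [ereal_abs_sub_coe]
  exact .ite (((measurableSet_singleton ⊥).preimage measurable_fst).union
    ((measurableSet_singleton ⊤).preimage measurable_fst)) measurable_const
    (continuous_abs.measurable.comp hdiff).ennreal_ofReal

lemma tendsto_coe_of_tendsto_abs_sub {ι : Type*} {l : Filter ι} {x : ι → EReal} {c : ℝ}
    (h : Tendsto (fun i => (x i - (c : EReal)).abs) l (𝓝 0)) : Tendsto x l (𝓝 (c : EReal)) := by
  have hfin : ∀ᶠ i in l, x i ≠ ⊥ ∧ x i ≠ ⊤ := by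
    filter_upwards [h.eventually (gt_mem_nhds ENNReal.zero_lt_top)] with i hi
    by_contra hnot
    rw [ereal_abs_sub_coe, if_pos (by tauto)] at hi
    exact lt_irrefl _ hi
  have hreal : Tendsto (fun i => |(x i).toReal - c|) l (𝓝 0) := by
    refine ((ENNReal.tendsto_toReal ENNReal.zero_ne_top).comp h).congr' ?_
    filter_upwards [hfin] with i hi
    rw [Function.comp_apply, ereal_abs_sub_coe, if_neg (by tauto),
      ENNReal.toReal_ofReal (abs_nonneg _)]
  refine (continuous_coe_real_ereal.tendsto c |>.comp
    (tendsto_iff_norm_sub_tendsto_zero.2 hreal)).congr' ?_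
  filter_upwards [hfin] with i hi using EReal.coe_toReal hi.2 hi.1

lemma ofReal_sub_le_toENNReal_add_abs (x : EReal) (M c : ℝ) :
    ENNReal.ofReal (M - c) ≤ ((M : EReal) - x).toENNReal + (x - c).abs := by
  induction x with
  | bot => simp
  | top => simp
  | coe t =>
    rw [← EReal.coe_sub, ← EReal.coe_sub, EReal.real_coe_toENNReal, EReal.abs_def]
    refine le_trans (ENNReal.ofReal_le_ofReal ?_) ENNReal.ofReal_add_le
    linarith [le_abs_self (t - c)]

lemma ae_tendsto_zero_of_lintegral_le_two_inv_pow {α : Type*} [MeasurableSpace α] {μ : Measure α}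
    {f : ℕ → α → ℝ≥0∞} (hf : ∀ k, AEMeasurable (f k) μ)
    (hle : ∀ k, ∫⁻ x, f k x ∂μ ≤ (2⁻¹ : ℝ≥0∞) ^ k) :
    ∀ᵐ x ∂μ, Tendsto (fun k => f k x) atTop (𝓝 0) := by
  have hsum : ∫⁻ x, ∑' k, f k x ∂μ ≠ ⊤ := by
    rw [lintegral_tsum hf]
    exact ne_top_of_le_ne_top (by simp) (ENNReal.tsum_le_tsum hle)
  filter_upwards [ae_lt_top' (AEMeasurable.tsum hf) hsum] with x hx
  exact ENNReal.tendsto_atTop_zero_of_tsum_ne_top hx.ne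

/-- A sequence of `F`-subharmonic functions on growing balls that converges to `Ubar` in
`L¹_loc` at a geometric rate, so that it also converges almost everywhere. -/
structure IsFastSeq (F : Set (Mat n)) (uk : ℕ → Euc n → EReal) (Ubar : Euc n → ℝ) : Prop where
  locallyIntegrable : LocallyIntegrable Ubar volume
  isSubharmonicOn : ∀ k : ℕ, IsSubharmonicOn F (Metric.ball 0 (k + 1)) (uk k)
  setLIntegral_abs_sub_le : ∀ k : ℕ,
    ∫⁻ x in Metric.closedBall (0 : Euc n) k, (uk k x - (Ubar x : EReal)).abs ≤
      (2⁻¹ : ℝ≥0∞) ^ k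

section FastSequence

variable {uk : ℕ → Euc n → EReal} {Ubar : Euc n → ℝ}

lemma eventually_norm_add_le {E : Type*} [SeminormedAddCommGroup E] (x : E) (s : ℝ) :
    ∀ᶠ k : ℕ in atTop, ‖x‖ + s ≤ k :=
  tendsto_natCast_atTop_atTop.eventually_ge_atTop _

/-- The error `|u_k - Ubar|` on the ball where a fast sequence controls it, extended by `0`. -/
noncomputable def truncError (uk : ℕ → Euc n → EReal) (Ubar : Euc n → ℝ) (k : ℕ) : Euc n → ℝ≥0∞ :=
  (Metric.closedBall 0 (k : ℝ)).indicator fun x => (uk k x - (Ubar x : EReal)).abs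

lemma truncError_of_norm_le {k : ℕ} {x : Euc n} (hx : ‖x‖ ≤ k) :
    truncError uk Ubar k x = (uk k x - (Ubar x : EReal)).abs :=
  indicator_of_mem (mem_closedBall_zero_iff.2 hx) _

lemma IsFastSeq.aemeasurable_truncError (h : IsFastSeq F uk Ubar) (k : ℕ) :
    AEMeasurable (truncError uk Ubar k) := by
  unfold truncError
  rw [aemeasurable_indicator_iff measurableSet_closedBall]
  have huk := aemeasurable_restrict_of_upperSemicontinuousOn measurableSet_closedBall
    ((h.isSubharmonicOn k).usc.mono (Metric.closedBall_subset_ball (lt_add_one (k : ℝ)))) volume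
  exact measurable_ereal_abs_sub_coe.comp_aemeasurable
    (huk.prodMk h.locallyIntegrable.aestronglyMeasurable.aemeasurable.restrict)

lemma IsFastSeq.lintegral_truncError_le (h : IsFastSeq F uk Ubar) (k : ℕ) :
    ∫⁻ x, truncError uk Ubar k x ≤ (2⁻¹ : ℝ≥0∞) ^ k := by
  unfold truncError
  rw [lintegral_indicator measurableSet_closedBall]
  exact h.setLIntegral_abs_sub_le k

lemma IsFastSeq.ae_tendsto (h : IsFastSeq F uk Ubar) :
    ∀ᵐ x, Tendsto (fun k => uk k x) atTop (𝓝 (Ubar x : EReal)) := by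
  filter_upwards [ae_tendsto_zero_of_lintegral_le_two_inv_pow h.aemeasurable_truncError
    h.lintegral_truncError_le] with x hx
  refine tendsto_coe_of_tendsto_abs_sub (hx.congr' ?_)
  filter_upwards [eventually_norm_add_le x 0] with k hk
  exact truncError_of_norm_le (by linarith)

lemma ofReal_integral_le_lintegral_ofReal {α : Type*} [MeasurableSpace α] {μ : Measure α}
    {f : α → ℝ} (hf : Integrable f μ) :
    ENNReal.ofReal (∫ x, f x ∂μ) ≤ ∫⁻ x, ENNReal.ofReal (f x) ∂μ := by
  rw [integral_eq_lintegral_pos_part_sub_lintegral_neg_part hf]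
  exact (ENNReal.ofReal_le_ofReal (sub_le_self _ ENNReal.toReal_nonneg)).trans
    ENNReal.ofReal_toReal_le

lemma le_average_add_of_lintegral_ofReal_sub_le {α : Type*} [MeasurableSpace α] {μ : Measure α}
    [IsFiniteMeasure μ] [NeZero μ] {f : α → ℝ} (hf : Integrable f μ) {M t C : ℝ} (htM : t ≤ M)
    (hC : 0 ≤ C) (h : ∫⁻ x, ENNReal.ofReal (M - f x) ∂μ ≤
      μ univ * ENNReal.ofReal (M - t) + ENNReal.ofReal C) :
    t ≤ (⨍ x, f x ∂μ) + C / μ.real univ := by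
  have hV : 0 < μ.real univ := measureReal_univ_pos
  have hMt : 0 ≤ μ.real univ * (M - t) := mul_nonneg hV.le (sub_nonneg.2 htM)
  rw [← ofReal_measureReal, ← ENNReal.ofReal_mul hV.le, ← ENNReal.ofReal_add hMt hC] at h
  have hint := (ENNReal.ofReal_le_ofReal_iff (add_nonneg hMt hC)).1
    ((ofReal_integral_le_lintegral_ofReal ((integrable_const M).sub hf)).trans h)
  simp only [Pi.sub_apply, integral_sub (integrable_const M) hf, integral_const, smul_eq_mul]
    at hint
  rw [average_eq, smul_eq_mul, inv_mul_eq_div, ← add_div, le_div_iff₀ hV]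
  linarith

lemma IsFastSeq.setLIntegral_ofReal_sub_le (h : IsFastSeq F uk Ubar) (hF : IsRieszCone F p)
    {k : ℕ} {y : Euc n} {s M : ℝ} (hball : Metric.closedBall y s ⊆ Metric.closedBall 0 (k : ℝ))
    {Ω : Set (Euc n)} (hΩ : IsOpen Ω) (hkΩ : Metric.closedBall y s ⊆ Ω)
    (hu : IsSubharmonicOn F Ω (uk k)) (hM : ∀ x ∈ Ω, uk k x ≤ M) :
    ∫⁻ z in Metric.closedBall y s, ENNReal.ofReal (M - Ubar z) ≤
      volume (Metric.closedBall y s) * deficit Ω M (uk k) y + (2⁻¹ : ℝ≥0∞) ^ k :=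
  calc ∫⁻ z in Metric.closedBall y s, ENNReal.ofReal (M - Ubar z)
      ≤ ∫⁻ z in Metric.closedBall y s,
          (deficit Ω M (uk k) z + (uk k z - (Ubar z : EReal)).abs) := by
        refine setLIntegral_mono' measurableSet_closedBall fun z hz => ?_
        rw [deficit_of_mem (hkΩ hz)]
        exact ofReal_sub_le_toENNReal_add_abs _ _ _
    _ = (∫⁻ z in Metric.closedBall y s, deficit Ω M (uk k) z) +
          ∫⁻ z in Metric.closedBall y s, (uk k z - (Ubar z : EReal)).abs :=
        lintegral_add_left (lowerSemicontinuous_deficit hΩ M hu.usc).measurable _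
    _ ≤ _ := add_le_add (hF.setLIntegral_deficit_le hΩ hu hM hkΩ)
        ((lintegral_mono_set hball).trans (h.setLIntegral_abs_sub_le k))

lemma IsFastSeq.le_setAverage_add (h : IsFastSeq F uk Ubar) (hF : IsRieszCone F p)
    {k : ℕ} {y : Euc n} {s : ℝ} (hs : 0 < s) (hys : ‖y‖ + s ≤ k) :
    uk k y ≤ (((⨍ z in Metric.closedBall y s, Ubar z) +
      2⁻¹ ^ k / volume.real (Metric.closedBall (0 : Euc n) s) : ℝ) : EReal) := by
  set Ω := Metric.ball (0 : Euc n) (k + 1 / 2)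
  have hsub : Metric.closedBall (0 : Euc n) (k + 1 / 2) ⊆ Metric.ball 0 (k + 1) :=
    Metric.closedBall_subset_ball (by linarith)
  obtain ⟨M, hM⟩ := exists_real_upper_bound (isCompact_closedBall (0 : Euc n) (k + 1 / 2))
    ((h.isSubharmonicOn k).usc.mono hsub) fun x hx => (h.isSubharmonicOn k).ne_top x (hsub hx)
  have hball : Metric.closedBall y s ⊆ Metric.closedBall 0 (k : ℝ) :=
    Metric.closedBall_subset_closedBall' (by rw [dist_zero_right]; linarith)
  have hballΩ : Metric.closedBall y s ⊆ Ω :=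
    hball.trans (Metric.closedBall_subset_ball (by linarith))
  have hyΩ : y ∈ Ω := hballΩ (Metric.mem_closedBall_self hs.le)
  have hMΩ : ∀ x ∈ Ω, uk k x ≤ M := fun x hx => hM x (Metric.ball_subset_closedBall hx)
  have hlint := h.setLIntegral_ofReal_sub_le hF hball Metric.isOpen_ball hballΩ
    ((h.isSubharmonicOn k).mono (Metric.ball_subset_closedBall.trans hsub)) hMΩ
  induction hu : uk k y with
  | bot => exact bot_le
  | top =>
    exact absurd hu ((h.isSubharmonicOn k).ne_top y (hsub (Metric.ball_subset_closedBall hyΩ)))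
  | coe t =>
    have hpow : (2⁻¹ : ℝ≥0∞) ^ k = ENNReal.ofReal (2⁻¹ ^ k) := by
      rw [ENNReal.ofReal_pow (by norm_num), ENNReal.ofReal_inv_of_pos (by norm_num),
        ENNReal.ofReal_ofNat]
    have : NeZero (volume.restrict (Metric.closedBall y s)) :=
      ⟨Measure.restrict_eq_zero.not.2 (Metric.measure_closedBall_pos volume y hs).ne'⟩
    have : IsFiniteMeasure (volume.restrict (Metric.closedBall y s)) :=
      ⟨by simpa using measure_closedBall_lt_top⟩
    rw [deficit_of_eq_coe hyΩ hu, hpow, ← Measure.restrict_apply_univ] at hlint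
    have hle := le_average_add_of_lintegral_ofReal_sub_le
      (h.locallyIntegrable.integrableOn_isCompact (isCompact_closedBall y s))
      (EReal.coe_le_coe_iff.1 (hu ▸ hMΩ y hyΩ)) (by positivity) hlint
    rwa [measureReal_restrict_apply_univ, Measure.addHaar_real_closedBall_center,
      ← EReal.coe_le_coe_iff] at hle

end FastSequence

lemma eventually_indicator_closedBall_eq {E G : Type*} [PseudoMetricSpace E] [Zero G] {y z : E}
    {s : ℝ} (hz : z ∉ Metric.sphere y s) (f : E → G) :
    ∀ᶠ w in 𝓝 y, (Metric.closedBall w s).indicator f z = (Metric.closedBall y s).indicator f z := by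
  have hdist : ContinuousAt (fun w => dist z w) y := by fun_prop
  rcases lt_or_gt_of_ne (Metric.mem_sphere.not.1 hz) with hlt | hgt
  · filter_upwards [hdist.eventually (gt_mem_nhds hlt)] with w hw
    rw [indicator_of_mem (Metric.mem_closedBall.2 hlt.le),
      indicator_of_mem (Metric.mem_closedBall.2 (le_of_lt hw))]
  · filter_upwards [hdist.eventually (lt_mem_nhds hgt)] with w hw
    rw [indicator_of_notMem (by simpa using hw), indicator_of_notMem (by simpa using hgt)]

lemma continuous_setIntegral_closedBall {E G : Type*} [NormedAddCommGroup E] [NormedSpace ℝ E]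
    [FiniteDimensional ℝ E] [MeasurableSpace E] [BorelSpace E] [NormedAddCommGroup G]
    [NormedSpace ℝ G] {μ : Measure E} [μ.IsAddHaarMeasure] {f : E → G}
    (hf : LocallyIntegrable f μ) {s : ℝ} (hs : s ≠ 0) :
    Continuous fun y => ∫ z in Metric.closedBall y s, f z ∂μ := by
  have : ProperSpace E := FiniteDimensional.proper ℝ E
  refine continuous_iff_continuousAt.2 fun y => ?_
  simp_rw [← integral_indicator measurableSet_closedBall]
  have hint : Integrable ((Metric.closedBall y (s + 1)).indicator f) μ :=
    (integrable_indicator_iff measurableSet_closedBall).2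
      (hf.integrableOn_isCompact (isCompact_closedBall y (s + 1)))
  refine tendsto_integral_filter_of_dominated_convergence _
    (.of_forall fun w => hf.aestronglyMeasurable.indicator measurableSet_closedBall) ?_
    hint.norm ?_
  · filter_upwards [Metric.ball_mem_nhds y one_pos] with w hw
    refine .of_forall fun z => norm_indicator_le_of_subset
      (Metric.closedBall_subset_closedBall' ?_) f z
    linarith [Metric.mem_ball.1 hw]
  · filter_upwards [measure_eq_zero_iff_ae_notMem.1
      (Measure.addHaar_sphere_of_ne_zero μ y hs)] with z hz
    exact tendsto_const_nhds.congr' ((eventually_indicator_closedBall_eq hz f).mono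
      fun w hw => hw.symm)

lemma continuous_setAverage_closedBall {E G : Type*} [NormedAddCommGroup E] [NormedSpace ℝ E]
    [FiniteDimensional ℝ E] [MeasurableSpace E] [BorelSpace E] [NormedAddCommGroup G]
    [NormedSpace ℝ G] {μ : Measure E} [μ.IsAddHaarMeasure] {f : E → G}
    (hf : LocallyIntegrable f μ) {s : ℝ} (hs : s ≠ 0) :
    Continuous fun y => ⨍ z in Metric.closedBall y s, f z ∂μ := by
  simp_rw [setAverage_eq, Measure.addHaar_real_closedBall_center]
  exact (continuous_setIntegral_closedBall hf hs).const_smul _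

/-! ### Essential upper semicontinuous representatives -/

/-- `U` is the representative `U(x) = lim_{s → 0} ess sup_{B_s(x)} Ubar` of the class of `Ubar`. -/
def IsEssRep (Ubar : Euc n → ℝ) (U : Euc n → EReal) : Prop :=
  ∀ x : Euc n, Tendsto (fun s : ℝ =>
      essSup (fun y => (Ubar y : EReal)) (volume.restrict (Metric.closedBall x s)))
    (𝓝[>] 0) (𝓝 (U x))

section EssRep

variable {uk : ℕ → Euc n → EReal} {Ubar : Euc n → ℝ} {U : Euc n → EReal}

lemma IsEssRep.exists_ae_lt (hU : IsEssRep Ubar U) {x : Euc n} {c : EReal} (hc : U x < c) :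
    ∃ t > 0, ∀ᵐ y ∂volume.restrict (Metric.closedBall x t), (Ubar y : EReal) < c := by
  obtain ⟨t, hlt, ht⟩ :=
    (((hU x).eventually (gt_mem_nhds hc)).and self_mem_nhdsWithin).exists
  exact ⟨t, ht, ae_lt_of_essSup_lt hlt⟩

lemma IsEssRep.le_of_ae_le (hU : IsEssRep Ubar U) {x : Euc n} {c : EReal} {δ : ℝ} (hδ : 0 < δ)
    (h : ∀ᵐ y ∂volume.restrict (Metric.closedBall x δ), (Ubar y : EReal) ≤ c) : U x ≤ c := by
  refine le_of_tendsto (hU x) ?_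
  filter_upwards [Ioo_mem_nhdsGT hδ] with t ht
  exact essSup_le_of_ae_le c
    (ae_mono (Measure.restrict_mono_set _ (Metric.closedBall_subset_closedBall ht.2.le)) h)

lemma IsEssRep.upperSemicontinuous (hU : IsEssRep Ubar U) : UpperSemicontinuous U := by
  intro x c hc
  obtain ⟨c', hUc', hc'⟩ := exists_between hc
  obtain ⟨t, ht, hlt⟩ := hU.exists_ae_lt hUc'
  filter_upwards [Metric.ball_mem_nhds x (half_pos ht)] with y hy
  refine (hU.le_of_ae_le (half_pos ht) (ae_mono (Measure.restrict_mono_set _ ?_)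
    (hlt.mono fun z hz => hz.le))).trans_lt hc'
  exact Metric.closedBall_subset_closedBall' (by linarith [Metric.mem_ball.1 hy])

lemma tendsto_two_inv_pow_div_atTop_nhds_zero (c : ℝ) :
    Tendsto (fun k : ℕ => (2⁻¹ : ℝ) ^ k / c) atTop (𝓝 0) := by
  simpa using (tendsto_pow_atTop_nhds_zero_of_lt_one (r := (2⁻¹ : ℝ)) (by norm_num)
    (by norm_num)).div_const c

lemma IsFastSeq.ae_le_setAverage (h : IsFastSeq F uk Ubar) (hF : IsRieszCone F p) {s : ℝ}
    (hs : 0 < s) : ∀ᵐ y, Ubar y ≤ ⨍ z in Metric.closedBall y s, Ubar z := by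
  filter_upwards [h.ae_tendsto] with y hy
  have hlim := (continuous_coe_real_ereal.tendsto _).comp
    ((tendsto_two_inv_pow_div_atTop_nhds_zero
      (volume.real (Metric.closedBall (0 : Euc n) s))).const_add
        (⨍ z in Metric.closedBall y s, Ubar z))
  rw [add_zero] at hlim
  refine EReal.coe_le_coe_iff.1 (le_of_tendsto_of_tendsto hy hlim ?_)
  filter_upwards [eventually_norm_add_le y s] with k hk using h.le_setAverage_add hF hs hk

lemma IsFastSeq.le_setAverage (h : IsFastSeq F uk Ubar) (hF : IsRieszCone F p)
    (hU : IsEssRep Ubar U) (x : Euc n) {s : ℝ} (hs : 0 < s) :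
    U x ≤ ((⨍ z in Metric.closedBall x s, Ubar z : ℝ) : EReal) := by
  refine le_of_forall_gt fun c hc => ?_
  obtain ⟨c', hc', hcc'⟩ := EReal.lt_iff_exists_real_btwn.1 hc
  obtain ⟨δ, hδ, hδc⟩ := Metric.nhds_basis_closedBall.eventually_iff.1
    ((continuous_setAverage_closedBall h.locallyIntegrable hs.ne').continuousAt.eventually
      (gt_mem_nhds (EReal.coe_lt_coe_iff.1 hc')))
  refine (hU.le_of_ae_le hδ ?_).trans_lt hcc'
  filter_upwards [ae_restrict_of_ae (h.ae_le_setAverage hF hs),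
    ae_restrict_mem measurableSet_closedBall] with y hy hyB
  exact EReal.coe_le_coe_iff.2 (hy.trans (hδc hyB).le)

lemma IsFastSeq.ne_top (h : IsFastSeq F uk Ubar) (hF : IsRieszCone F p)
    (hU : IsEssRep Ubar U) (x : Euc n) : U x ≠ ⊤ :=
  ((h.le_setAverage hF hU x one_pos).trans_lt (EReal.coe_lt_top _)).ne

/-- Hartogs' lemma for a fast sequence. -/
lemma IsFastSeq.eventually_lt (h : IsFastSeq F uk Ubar) (hF : IsRieszCone F p)
    (hU : IsEssRep Ubar U) {x : Euc n} {c : EReal} (hc : U x < c) :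
    ∃ δ > 0, ∀ᶠ k in atTop, ∀ y ∈ Metric.closedBall x δ, uk k y < c := by
  obtain ⟨c₁, hUc₁, hc₁⟩ := EReal.lt_iff_exists_real_btwn.1 hc
  obtain ⟨c₂, hc₁₂, hc₂⟩ := EReal.lt_iff_exists_real_btwn.1 hc₁
  obtain ⟨t, ht, hlt⟩ := hU.exists_ae_lt hUc₁
  have hs : 0 < t / 2 := half_pos ht
  refine ⟨t / 2, hs, ?_⟩
  filter_upwards [(tendsto_two_inv_pow_div_atTop_nhds_zero
      (volume.real (Metric.closedBall (0 : Euc n) (t / 2)))).eventually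
        (gt_mem_nhds (sub_pos.2 (EReal.coe_lt_coe_iff.1 hc₁₂))),
    eventually_norm_add_le x t] with k hsmall hkx y hy
  have hyk : ‖y‖ + t / 2 ≤ k := by
    rw [mem_closedBall_iff_norm] at hy
    linarith [norm_le_norm_add_norm_sub' y x]
  have hsub : Metric.closedBall y (t / 2) ⊆ Metric.closedBall x t :=
    Metric.closedBall_subset_closedBall' (by linarith [Metric.mem_closedBall.1 hy])
  have hlt' : ∀ᵐ z ∂volume.restrict (Metric.closedBall y (t / 2)), (Ubar z : EReal) < c₁ :=
    ae_mono (Measure.restrict_mono_set _ hsub) hlt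
  have havg : ⨍ z in Metric.closedBall y (t / 2), Ubar z ∈ Iic c₁ :=
    (convex_Iic c₁).set_average_mem isClosed_Iic (Metric.measure_closedBall_pos volume y hs).ne'
      measure_closedBall_lt_top.ne
      (hlt'.mono fun z hz => (EReal.coe_lt_coe_iff.1 hz).le)
      (h.locallyIntegrable.integrableOn_isCompact (isCompact_closedBall y (t / 2)))
  refine (h.le_setAverage_add hF hs hyk).trans_lt ((EReal.coe_lt_coe_iff.2 ?_).trans hc₂)
  linarith [mem_Iic.1 havg]

lemma IsFastSeq.eventually_lt_of_isCompact (h : IsFastSeq F uk Ubar) (hF : IsRieszCone F p)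
    (hU : IsEssRep Ubar U) {K : Set (Euc n)} (hK : IsCompact K) {ψ : Euc n → ℝ}
    (hψ : ContinuousOn ψ K) (hlt : ∀ y ∈ K, U y < ψ y) :
    ∀ᶠ k in atTop, ∀ y ∈ K, uk k y < ψ y := by
  have hlocal : ∀ y ∈ K, ∃ S ∈ 𝓝[K] y, ∀ᶠ k in atTop, ∀ z ∈ S, uk k z < ψ z := fun y hy => by
    obtain ⟨c, hUc, hcψ⟩ := EReal.lt_iff_exists_real_btwn.1 (hlt y hy)
    obtain ⟨δ, hδ, hk⟩ := h.eventually_lt hF hU hUc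
    refine ⟨Metric.closedBall y δ ∩ {z | c < ψ z},
      inter_mem (mem_nhdsWithin_of_mem_nhds (Metric.closedBall_mem_nhds y hδ))
        ((hψ y hy).eventually (lt_mem_nhds (EReal.coe_lt_coe_iff.1 hcψ))), ?_⟩
    filter_upwards [hk] with k hk z hz
    exact (hk z hz.1).trans (EReal.coe_lt_coe_iff.2 hz.2)
  refine hK.induction_on (p := fun S => ∀ᶠ k in atTop, ∀ y ∈ S, uk k y < ψ y) (by simp)
    (fun S T hST hT => hT.mono fun k hk y hy => hk y (hST hy)) (fun S T hS hT => ?_) hlocal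
  filter_upwards [hS, hT] with k hkS hkT y hy using hy.elim (hkS y) (hkT y)

lemma IsFastSeq.ae_eq (h : IsFastSeq F uk Ubar) (hF : IsRieszCone F p) (hU : IsEssRep Ubar U) :
    ∀ᵐ x, U x = (Ubar x : EReal) := by
  filter_upwards [h.ae_tendsto, (Besicovitch.vitaliFamily
    (volume : Measure (Euc n))).ae_tendsto_average h.locallyIntegrable] with x hx havg
  refine le_antisymm ?_ ?_
  · refine ge_of_tendsto ((continuous_coe_real_ereal.tendsto _).comp
      (havg.comp (Besicovitch.tendsto_filterAt volume x))) ?_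
    filter_upwards [self_mem_nhdsWithin] with s hs using h.le_setAverage hF hU x hs
  · by_contra! hlt
    obtain ⟨c, hUc, hc⟩ := exists_between hlt
    obtain ⟨δ, hδ, hk⟩ := h.eventually_lt hF hU hUc
    obtain ⟨k, hk₁, hk₂⟩ := (hk.and (hx.eventually (lt_mem_nhds hc))).exists
    exact lt_asymm (hk₁ x (Metric.mem_closedBall_self hδ.le)) hk₂

lemma IsFastSeq.exists_eventually_gt (h : IsFastSeq F uk Ubar) (hU : IsEssRep Ubar U) {x : Euc n}
    {c : EReal} (hc : c < U x) {N : Set (Euc n)} (hN : N ∈ 𝓝 x) :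
    ∃ y ∈ N, ∀ᶠ k in atTop, c < uk k y := by
  by_contra hcon
  obtain ⟨δ, hδ, hδN⟩ := Metric.nhds_basis_closedBall.mem_iff.1 hN
  refine hc.not_ge (hU.le_of_ae_le hδ ?_)
  filter_upwards [ae_restrict_of_ae h.ae_tendsto, ae_restrict_mem measurableSet_closedBall]
    with z hz hzB
  by_contra! hlt
  exact hcon ⟨z, hδN hzB, hz.eventually (lt_mem_nhds hlt)⟩

lemma IsFastSeq.exists_hessian_mem (h : IsFastSeq F uk Ubar) (hF : IsRieszCone F p)
    (hU : IsEssRep Ubar U) {C V : Set (Euc n)} (hC : IsCompact C) (hV : IsOpen V) (hVC : V ⊆ C)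
    {ψ : Euc n → ℝ} (hψ : ContinuousOn ψ C) (hψ₂ : ∀ y ∈ V, ContDiffAt ℝ 2 ψ y)
    (hbd : ∀ y ∈ C \ V, U y < ψ y) {x : Euc n} (hx : x ∈ V) (hlt : ψ x < U x) :
    ∃ z ∈ V, hessian ψ z ∈ F := by
  obtain ⟨c, hψc, hcU⟩ := EReal.lt_iff_exists_real_btwn.1 hlt
  have hnear : ∀ᶠ y in 𝓝 x, y ∈ V ∧ ψ y < c :=
    (hV.eventually_mem hx).and
      ((hψ₂ x hx).continuousAt.eventually (gt_mem_nhds (EReal.coe_lt_coe_iff.1 hψc)))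
  obtain ⟨y, ⟨hyV, hyc⟩, hgt⟩ := h.exists_eventually_gt hU hcU hnear
  obtain ⟨R, hR⟩ := hC.isBounded.subset_ball 0
  obtain ⟨k, hbd, hky, hkR⟩ :=
    ((h.eventually_lt_of_isCompact hF hU (hC.diff hV) (hψ.mono sdiff_subset) hbd).and
      (hgt.and (tendsto_natCast_atTop_atTop.eventually_ge_atTop R))).exists
  by_contra! hnot
  have hle := ((h.isSubharmonicOn k).mono
    (hR.trans (Metric.ball_subset_ball (by linarith)))).le_of_hessian_notMem hC hV hVC hψ hψ₂ hnot
      (fun z hz => (hbd z hz).le) y (hVC hyV)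
  exact (hky.trans_le hle).not_gt (EReal.coe_lt_coe_iff.2 hyc)

lemma IsFastSeq.frequently_hessian_add_mem (h : IsFastSeq F uk Ubar) (hF : IsRieszCone F p)
    (hU : IsEssRep Ubar U) {x : Euc n} {φ : Euc n → ℝ} (hφ : ContDiffAt ℝ 2 φ x)
    (hx : U x = φ x) (hle : ∀ᶠ y in 𝓝 x, U y ≤ φ y) {η : ℝ} (hη : 0 < η) :
    ∃ᶠ y in 𝓝 x, hessian φ y + (2 * η) • (1 : Mat n) ∈ F := by
  refine frequently_iff.2 fun {N} hN => ?_
  obtain ⟨s, hs, hsN⟩ := Metric.nhds_basis_closedBall.eventually_iff.1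
    ((hφ.eventually (by simp)).and (hle.and hN))
  have hsub : Metric.ball x (s / 2) ⊆ Metric.closedBall x s :=
    Metric.ball_subset_closedBall.trans (Metric.closedBall_subset_closedBall (by linarith))
  -- `ψ` lies strictly above `U` away from `x`, and below `U` at `x`.
  set ψ : Euc n → ℝ := fun y => φ y + η * ‖y - x‖ ^ 2 + -(η * (s ^ 2 / 8)) with hψ
  have hψ₂ : ∀ y ∈ Metric.closedBall x s, ContDiffAt ℝ 2 ψ y := fun y hy =>
    ((hsN hy).1.add (contDiffAt_const_mul_normSq_sub η x y)).add contDiffAt_const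
  have hshell : ∀ y ∈ Metric.closedBall x s \ Metric.ball x (s / 2), U y < ψ y := by
    intro y hy
    refine (hsN hy.1).2.1.trans_lt (EReal.coe_lt_coe_iff.2 ?_)
    have hdist : s / 2 ≤ ‖y - x‖ := by simpa [dist_eq_norm] using hy.2
    have hsq : s ^ 2 / 8 < ‖y - x‖ ^ 2 := by nlinarith
    simp only [hψ]
    linarith [mul_lt_mul_of_pos_left hsq hη]
  have hψx : (ψ x : EReal) < U x := by
    have : 0 < η * (s ^ 2 / 8) := by positivity
    rw [hx]
    exact EReal.coe_lt_coe_iff.2 (by simpa [hψ] using this)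
  obtain ⟨z, hz, hmem⟩ := h.exists_hessian_mem hF hU (isCompact_closedBall x s) Metric.isOpen_ball
    hsub (fun y hy => (hψ₂ y hy).continuousAt.continuousWithinAt) (fun y hy => hψ₂ y (hsub hy))
    hshell (Metric.mem_ball_self (half_pos hs)) hψx
  refine ⟨z, (hsN (hsub hz)).2.2, ?_⟩
  rwa [hψ, hessian_add_const, hessian_add (hsN (hsub hz)).1
    (contDiffAt_const_mul_normSq_sub η x z), hessian_const_mul_normSq_sub] at hmem

theorem IsFastSeq.isSubharmonicOn_univ (h : IsFastSeq F uk Ubar) (hF : IsRieszCone F p)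
    (hU : IsEssRep Ubar U) : IsSubharmonicOn F univ U := by
  refine ⟨hU.upperSemicontinuous.upperSemicontinuousOn _, fun x _ => h.ne_top hF hU x,
    fun x _ φ hφ hx hle => ?_⟩
  have hmem : ∀ η : ℝ, 0 < η → hessian φ x + (2 * η) • (1 : Mat n) ∈ F := fun η hη =>
    hF.isSubequation.closed.mem_of_frequently_of_tendsto
      (h.frequently_hessian_add_mem hF hU hφ hx hle hη)
      ((continuousAt_hessian hφ).add continuousAt_const)
  have hcont : Continuous fun η : ℝ => hessian φ x + (2 * η) • (1 : Mat n) := by fun_prop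
  have hlim := (hcont.tendsto 0).mono_left (nhdsWithin_le_nhds (s := Ioi 0))
  rw [mul_zero, zero_smul, add_zero] at hlim
  refine hF.isSubequation.closed.mem_of_tendsto hlim ?_
  filter_upwards [self_mem_nhdsWithin] with η hη using hmem η hη

end EssRep

/-! ### Tangents as fast limits -/

lemma ereal_coe_mul_sub_coe {a : ℝ} (ha : 0 < a) (c : ℝ) (x : EReal) :
    (a : EReal) * (x - c) = (a : EReal) * x + (-(a * c) : ℝ) := by
  induction x with
  | bot => simp [EReal.coe_mul_bot_of_pos ha]
  | top => rw [EReal.top_sub_coe, EReal.coe_mul_top_of_pos ha, EReal.top_add_coe]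
  | coe t => norm_cast; ring

lemma ereal_coe_mul_sub_bot {a : ℝ} (ha : 0 < a) (x : EReal) :
    (a : EReal) * (x - ⊥) = ⊥ ∨ (a : EReal) * (x - ⊥) = ⊤ := by
  induction x <;> simp [EReal.coe_mul_bot_of_pos ha, EReal.coe_mul_top_of_pos ha]

lemma exists_tangentialFlow_eq_mul_sub {u : Euc n → EReal} {ρ : ℝ}
    (hu : IsSubharmonicOn F (Metric.ball 0 ρ) u) {r : ℝ} (hr : 0 < r) (hrρ : r < ρ) :
    ∃ c : EReal, c ≠ ⊤ ∧
      ∀ x, tangentialFlow p u r x = ((r ^ (p - 2) : ℝ) : EReal) * (u (r • x) - c) := by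
  rcases lt_trichotomy p 2 with hp | rfl | hp
  · refine ⟨u 0, hu.ne_top 0 (Metric.mem_ball_self (hr.trans hrρ)), fun x => ?_⟩
    rw [tangentialFlow, if_neg hp.not_gt, if_pos hp, one_div, ← Real.rpow_neg hr.le, neg_sub]
  · have hsub : Metric.closedBall (0 : Euc n) r ⊆ Metric.ball 0 ρ :=
      Metric.closedBall_subset_ball hrρ
    obtain ⟨M, hM⟩ := exists_real_upper_bound (isCompact_closedBall (0 : Euc n) r)
      (hu.usc.mono hsub) fun x hx => hu.ne_top x (hsub hx)
    refine ⟨ballMax u r, ((iSup₂_le hM : ballMax u r ≤ M).trans_lt (EReal.coe_lt_top M)).ne,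
      fun x => ?_⟩
    rw [tangentialFlow, if_neg (lt_irrefl _), if_neg (lt_irrefl _)]
    simp
  · exact ⟨0, EReal.zero_ne_top, fun x => by rw [tangentialFlow, if_pos hp, sub_zero]⟩

lemma exists_tangentialFlow_eq_mul_add {u : Euc n → EReal} {ρ : ℝ}
    (hu : IsSubharmonicOn F (Metric.ball 0 ρ) u) {r : ℝ} (hr : 0 < r) (hrρ : r < ρ)
    (hfin : ∃ x, tangentialFlow p u r x ≠ ⊥ ∧ tangentialFlow p u r x ≠ ⊤) :
    ∃ b : ℝ, ∀ x, tangentialFlow p u r x = ((r ^ (p - 2) : ℝ) : EReal) * u (r • x) + b := by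
  have ha : 0 < r ^ (p - 2) := Real.rpow_pos_of_pos hr _
  obtain ⟨c, hc, hflow⟩ := exists_tangentialFlow_eq_mul_sub (p := p) hu hr hrρ
  induction c with
  | bot =>
    obtain ⟨x, hx⟩ := hfin
    rw [hflow] at hx
    exact ((ereal_coe_mul_sub_bot ha (u (r • x))).elim hx.1 hx.2).elim
  | top => exact absurd rfl hc
  | coe c => exact ⟨_, fun x => by rw [hflow, ereal_coe_mul_sub_coe ha]⟩

lemma exists_ne_bot_ne_top_of_setLIntegral_abs_sub_lt_top {α : Type*} [MeasurableSpace α]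
    {μ : Measure α} {s : Set α} (hs : μ s ≠ 0) {f : α → EReal} {g : α → ℝ}
    (h : ∫⁻ x in s, (f x - (g x : EReal)).abs ∂μ < ⊤) : ∃ x, f x ≠ ⊥ ∧ f x ≠ ⊤ := by
  by_contra! hcon
  have habs (x : α) : (f x - (g x : EReal)).abs = ⊤ := by
    rw [ereal_abs_sub_coe, if_pos (or_iff_not_imp_left.2 (hcon x))]
  simp [habs, ENNReal.top_mul hs] at h

theorem IsTangentAtZero.exists_isFastSeq (hF : IsConeSet F) {u U : Euc n → EReal} {ρ : ℝ}
    (hρ : 0 < ρ) (hu : IsSubharmonicOn F (Metric.ball 0 ρ) u) (hU : IsTangentAtZero p u U) :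
    ∃ (Ubar : Euc n → ℝ) (r b : ℕ → ℝ), IsEssRep Ubar U ∧ (∀ k, 0 < r k) ∧
      Tendsto r atTop (𝓝 0) ∧
      IsFastSeq F (fun k x => ((r k ^ (p - 2) : ℝ) : EReal) * u (r k • x) + b k) Ubar := by
  obtain ⟨r, Ubar, hr, hr₀, ⟨hloc, hconv⟩, hrep⟩ := hU
  have hsubseq (k : ℕ) : ∃ j, r j * (k + 1) < ρ ∧ r j < 1 / (k + 1) ∧
      ∫⁻ x in Metric.closedBall (0 : Euc n) (k + 1 : ℝ),
        (tangentialFlow p u (r j) x - (Ubar x : EReal)).abs < (2⁻¹ : ℝ≥0∞) ^ k := by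
    have hlim : Tendsto (fun j => r j * (k + 1)) atTop (𝓝 0) := by
      simpa using hr₀.mul_const (k + 1 : ℝ)
    exact ((hlim.eventually (gt_mem_nhds hρ)).and ((hr₀.eventually
      (gt_mem_nhds Nat.one_div_pos_of_nat)).and ((hconv (k + 1) (by positivity)).eventually
        (gt_mem_nhds (ENNReal.pow_pos (by simp) k))))).exists
  choose j hjρ hjk hjL using hsubseq
  have hflow (k : ℕ) : ∃ b : ℝ, ∀ x, tangentialFlow p u (r (j k)) x =
      ((r (j k) ^ (p - 2) : ℝ) : EReal) * u (r (j k) • x) + b := by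
    refine exists_tangentialFlow_eq_mul_add hu (hr _) ((le_mul_of_one_le_right (hr _).le
      (by simp)).trans_lt (hjρ k)) ?_
    exact exists_ne_bot_ne_top_of_setLIntegral_abs_sub_lt_top
      (Metric.measure_closedBall_pos volume 0 (by positivity)).ne' ((hjL k).trans_le le_top)
  choose b hb using hflow
  refine ⟨Ubar, fun k => r (j k), b, hrep, fun k => hr _, squeeze_zero (fun k => (hr _).le)
    (fun k => (hjk k).le) tendsto_one_div_add_atTop_nhds_zero_nat, hloc, fun k => ?_, fun k => ?_⟩
  · have hscaled := (hu.comp_smul_add hF (hr (j k)).ne' 0).mul_add_const hF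
      (Real.rpow_pos_of_pos (hr (j k)) (p - 2)) (b k)
    simp only [add_zero] at hscaled
    refine hscaled.mono fun x hx => ?_
    rw [mem_ball_zero_iff] at hx
    rw [mem_preimage, mem_ball_zero_iff, norm_smul_of_nonneg (hr _).le]
    exact (mul_lt_mul_of_pos_left hx (hr _)).trans (hjρ k)
  · simp_rw [← hb]
    exact (lintegral_mono_set (Metric.closedBall_subset_closedBall (by linarith))).trans (hjL k).le

/-! ### Orbit means of subharmonic functions -/

section OrbitNull

variable {ν : Measure (orthogonalStabilizer F)} [IsProbabilityMeasure ν]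

lemma ae_prod_rot {P : Euc n → Prop} (h : ∀ᵐ x, P x) :
    ∀ᵐ q : Euc n × orthogonalStabilizer F ∂volume.prod ν, P (rot q.2.1 q.1) :=
  (measurePreserving_rot_apply ν).quasiMeasurePreserving.ae h

lemma ae_ae_rot {P : Euc n → Prop} (h : ∀ᵐ x, P x) :
    ∀ᵐ x, ∀ᵐ g : orthogonalStabilizer F ∂ν, P (rot g.1 x) :=
  Measure.ae_ae_of_ae_prod (p := fun q : Euc n × orthogonalStabilizer F => P (rot q.2.1 q.1))
    (ae_prod_rot h)

lemma ae_integrable_rot {f : Euc n → ℝ} (hf : LocallyIntegrable f) :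
    ∀ᵐ x, Integrable (fun g : orthogonalStabilizer F => f (rot g.1 x)) ν := by
  have hball : ∀ k : ℕ, ∀ᵐ x, Integrable (fun g : orthogonalStabilizer F =>
      (Metric.closedBall (0 : Euc n) k).indicator f (rot g.1 x)) ν := fun k =>
    ((measurePreserving_rot_apply ν).integrable_comp_of_integrable <|
      (integrable_indicator_iff measurableSet_closedBall).2 <|
        hf.integrableOn_isCompact (isCompact_closedBall 0 (k : ℝ))).prod_right_ae
  filter_upwards [ae_all_iff.2 hball] with x hx
  obtain ⟨k, hk⟩ := exists_nat_ge ‖x‖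
  refine (hx k).congr (.of_forall fun g => indicator_of_mem ?_ f)
  rwa [mem_closedBall_zero_iff, LinearIsometryEquiv.norm_map]

lemma aemeasurable_orbitAvg {v : Euc n → ℝ≥0∞} (hv : AEMeasurable v) :
    AEMeasurable (orbitAvg ν v) :=
  (hv.comp_quasiMeasurePreserving
    (measurePreserving_rot_apply ν).quasiMeasurePreserving).lintegral_prod_right'

end OrbitNull

section AbsSub

variable {α : Type*} [MeasurableSpace α] {μ : Measure α} {f : α → EReal} {g : α → ℝ}

lemma ae_ne_bot_and_ne_top_of_lintegral_abs_sub_ne_top (hf : AEMeasurable f μ)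
    (hg : AEMeasurable g μ) (h : ∫⁻ x, (f x - (g x : EReal)).abs ∂μ ≠ ⊤) :
    ∀ᵐ x ∂μ, f x ≠ ⊥ ∧ f x ≠ ⊤ := by
  filter_upwards [ae_lt_top' (measurable_ereal_abs_sub_coe.comp_aemeasurable (hf.prodMk hg)) h]
    with x hx
  by_contra hnot
  rw [Function.comp_apply, ereal_abs_sub_coe, if_pos (by tauto)] at hx
  exact lt_irrefl _ hx

lemma lintegral_enorm_toReal_sub (hf : AEMeasurable f μ) (hg : AEMeasurable g μ)
    (h : ∫⁻ x, (f x - (g x : EReal)).abs ∂μ ≠ ⊤) :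
    ∫⁻ x, ‖(f x).toReal - g x‖ₑ ∂μ = ∫⁻ x, (f x - (g x : EReal)).abs ∂μ := by
  refine lintegral_congr_ae ?_
  filter_upwards [ae_ne_bot_and_ne_top_of_lintegral_abs_sub_ne_top hf hg h] with x hx
  rw [ereal_abs_sub_coe, if_neg (by tauto), Real.enorm_eq_ofReal_abs]

lemma integrable_toReal_sub (hf : AEMeasurable f μ) (hg : AEMeasurable g μ)
    (h : ∫⁻ x, (f x - (g x : EReal)).abs ∂μ ≠ ⊤) : Integrable (fun x => (f x).toReal - g x) μ := by
  refine ⟨(hf.ereal_toReal.sub hg).aestronglyMeasurable, ?_⟩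
  rw [hasFiniteIntegral_iff_enorm, lintegral_enorm_toReal_sub hf hg h]
  exact lt_top_iff_ne_top.2 h

lemma integrable_toReal_of_abs_sub (hf : AEMeasurable f μ) (hg : Integrable g μ)
    (h : ∫⁻ x, (f x - (g x : EReal)).abs ∂μ ≠ ⊤) : Integrable (fun x => (f x).toReal) μ :=
  ((integrable_toReal_sub hf hg.aemeasurable h).add hg).congr
    (.of_forall fun x => sub_add_cancel _ (g x))

lemma norm_integral_toReal_sub_le (hf : AEMeasurable f μ) (hg : Integrable g μ)
    (h : ∫⁻ x, (f x - (g x : EReal)).abs ∂μ ≠ ⊤) :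
    ‖(∫ x, (f x).toReal ∂μ) - ∫ x, g x ∂μ‖ ≤ (∫⁻ x, (f x - (g x : EReal)).abs ∂μ).toReal := by
  have hsub := integrable_toReal_sub hf hg.aemeasurable h
  rw [← integral_sub (integrable_toReal_of_abs_sub hf hg h) hg,
    ← lintegral_enorm_toReal_sub hf hg.aemeasurable h,
    ← integral_norm_eq_lintegral_enorm hsub.aestronglyMeasurable]
  exact norm_integral_le_integral_norm _

end AbsSub

section OrbitMean

/-- The mean of `f` over the orbit of `x` is an absolutely convergent integral. -/
structure HasOrbitMean (ν : Measure (orthogonalStabilizer F)) (f : Euc n → EReal) (x : Euc n) :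
    Prop where
  integrable : Integrable (fun g : orthogonalStabilizer F => (f (rot g.1 x)).toReal) ν
  finite : ∀ᵐ g : orthogonalStabilizer F ∂ν, f (rot g.1 x) ≠ ⊥ ∧ f (rot g.1 x) ≠ ⊤

/-- The mean of `f` over the orbit of `x`, with the junk value of the Bochner integral unless
`HasOrbitMean ν f x`. -/
noncomputable def orbitMean (ν : Measure (orthogonalStabilizer F)) (f : Euc n → EReal)
    (x : Euc n) : ℝ := ∫ g, (f (rot g.1 x)).toReal ∂ν

variable {ν : Measure (orthogonalStabilizer F)} {uk : ℕ → Euc n → EReal} {Ubar : Euc n → ℝ}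

lemma IsSubharmonicOn.measurable_rot_apply {Ω : Set (Euc n)} {u : Euc n → EReal}
    (hu : IsSubharmonicOn F Ω u) {x : Euc n} (hx : ∀ g ∈ orthogonalStabilizer F, rot g x ∈ Ω) :
    Measurable fun g : orthogonalStabilizer F => u (rot g.1 x) := by
  have hrot : Continuous fun g : orthogonalStabilizer F => rot g.1 x :=
    continuous_rot_apply continuous_subtype_val continuous_const
  refine UpperSemicontinuous.measurable (upperSemicontinuousOn_univ_iff.1 ?_)
  exact hu.usc.comp hrot.continuousOn fun g _ => hx g.1 g.2

lemma orbitAvg_truncError {k : ℕ} {x : Euc n} (hx : ‖x‖ ≤ k) :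
    orbitAvg ν (truncError uk Ubar k) x =
      ∫⁻ g, (uk k (rot g.1 x) - (Ubar (rot g.1 x) : EReal)).abs ∂ν :=
  lintegral_congr fun g => truncError_of_norm_le (by rwa [LinearIsometryEquiv.norm_map])

lemma IsFastSeq.measurable_rot_apply (h : IsFastSeq F uk Ubar) {k : ℕ} {x : Euc n}
    (hx : ‖x‖ ≤ k) : Measurable fun g : orthogonalStabilizer F => uk k (rot g.1 x) :=
  (h.isSubharmonicOn k).measurable_rot_apply fun g _ => by
    rw [mem_ball_zero_iff, LinearIsometryEquiv.norm_map]
    linarith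

lemma IsFastSeq.hasOrbitMean (h : IsFastSeq F uk Ubar) {k : ℕ} {x : Euc n} (hx : ‖x‖ ≤ k)
    (hU : Integrable (fun g : orthogonalStabilizer F => Ubar (rot g.1 x)) ν)
    (herr : orbitAvg ν (truncError uk Ubar k) x ≠ ⊤) : HasOrbitMean ν (uk k) x := by
  rw [orbitAvg_truncError hx] at herr
  have hmeas := (h.measurable_rot_apply hx).aemeasurable (μ := ν)
  exact ⟨integrable_toReal_of_abs_sub hmeas hU herr,
    ae_ne_bot_and_ne_top_of_lintegral_abs_sub_ne_top hmeas hU.aemeasurable herr⟩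

lemma IsFastSeq.norm_orbitMean_sub_le (h : IsFastSeq F uk Ubar) {k : ℕ} {x : Euc n}
    (hx : ‖x‖ ≤ k) (hU : Integrable (fun g : orthogonalStabilizer F => Ubar (rot g.1 x)) ν)
    (herr : orbitAvg ν (truncError uk Ubar k) x ≠ ⊤) :
    ‖orbitMean ν (uk k) x - ∫ g, Ubar (rot g.1 x) ∂ν‖ ≤
      (orbitAvg ν (truncError uk Ubar k) x).toReal := by
  rw [orbitAvg_truncError hx] at herr ⊢
  exact norm_integral_toReal_sub_le (h.measurable_rot_apply hx).aemeasurable hU herr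

variable {f : Euc n → EReal} {x : Euc n} {r₁ r₂ M : ℝ}

lemma HasOrbitMean.ae_toReal_le (h : HasOrbitMean ν f x) (hx : x ∈ annulus r₁ r₂)
    (hM : ∀ y ∈ annulus r₁ r₂, f y ≤ M) : ∀ᵐ g ∂ν, (f (rot g.1 x)).toReal ≤ M := by
  filter_upwards [h.finite] with g hg
  rw [← EReal.coe_le_coe_iff, EReal.coe_toReal hg.2 hg.1]
  exact hM _ (by rwa [annulus, mem_ofPred_eq, LinearIsometryEquiv.norm_map])

variable [IsProbabilityMeasure ν]

theorem IsFastSeq.ae_tendsto_orbitMean (h : IsFastSeq F uk Ubar) :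
    ∀ᵐ x, (∀ᶠ k in atTop, HasOrbitMean ν (uk k) x) ∧
      Tendsto (fun k => orbitMean ν (uk k) x) atTop (𝓝 (∫ g, Ubar (rot g.1 x) ∂ν)) := by
  have herr : ∀ᵐ x, Tendsto (fun k => orbitAvg ν (truncError uk Ubar k) x) atTop (𝓝 0) :=
    ae_tendsto_zero_of_lintegral_le_two_inv_pow
      (fun k => aemeasurable_orbitAvg (ν := ν) (h.aemeasurable_truncError k))
      fun k => (lintegral_orbitAvg (ν := ν) (h.aemeasurable_truncError k)).trans_le
        (h.lintegral_truncError_le k)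
  filter_upwards [herr, ae_integrable_rot (ν := ν) h.locallyIntegrable] with x hx hU
  have hgood : ∀ᶠ k : ℕ in atTop, ‖x‖ ≤ k ∧ orbitAvg ν (truncError uk Ubar k) x ≠ ⊤ := by
    filter_upwards [eventually_norm_add_le x 0,
      hx.eventually (gt_mem_nhds ENNReal.zero_lt_top)] with k hk hfin
    exact ⟨by linarith, ne_of_lt hfin⟩
  refine ⟨hgood.mono fun k hk => h.hasOrbitMean hk.1 hU hk.2,
    tendsto_iff_norm_sub_tendsto_zero.2 ?_⟩
  refine squeeze_zero' (.of_forall fun k => norm_nonneg _)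
    (hgood.mono fun k hk => h.norm_orbitMean_sub_le hk.1 hU hk.2) ?_
  exact (ENNReal.tendsto_toReal ENNReal.zero_ne_top).comp hx

lemma HasOrbitMean.orbitMean_le (h : HasOrbitMean ν f x) (hx : x ∈ annulus r₁ r₂)
    (hM : ∀ y ∈ annulus r₁ r₂, f y ≤ M) : orbitMean ν f x ≤ M := by
  simpa [orbitMean] using
    integral_mono_ae h.integrable (integrable_const M) (h.ae_toReal_le hx hM)

lemma HasOrbitMean.orbitAvg_deficit (h : HasOrbitMean ν f x) (hx : x ∈ annulus r₁ r₂)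
    (hM : ∀ y ∈ annulus r₁ r₂, f y ≤ M) :
    orbitAvg ν (deficit (annulus r₁ r₂) M f) x = ENNReal.ofReal (M - orbitMean ν f x) := by
  have hint : Integrable (fun g : orthogonalStabilizer F => M - (f (rot g.1 x)).toReal) ν :=
    (integrable_const M).sub h.integrable
  have hmean : ∫ g, (M - (f (rot g.1 x)).toReal) ∂ν = M - orbitMean ν f x := by
    rw [integral_sub (integrable_const M) h.integrable, orbitMean]
    simp
  have hnonneg : 0 ≤ᵐ[ν] fun g => M - (f (rot g.1 x)).toReal :=
    (h.ae_toReal_le hx hM).mono fun g hg => sub_nonneg.2 hg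
  rw [← hmean, ofReal_integral_eq_lintegral_ofReal hint hnonneg]
  refine lintegral_congr_ae (h.finite.mono fun g hg => ?_)
  refine deficit_of_eq_coe ?_ (EReal.coe_toReal hg.2 hg.1).symm
  rwa [annulus, mem_ofPred_eq, LinearIsometryEquiv.norm_map]

end OrbitMean

section Convexity

variable {ν : Measure (orthogonalStabilizer F)} [IsProbabilityMeasure ν] [ν.IsMulRightInvariant]
  {u : Euc n → EReal} {ρ : ℝ} {a x b : Euc n}

theorem IsRieszCone.orbitMean_convex (h : IsRieszCone F p)
    (hu : IsSubharmonicOn F (Metric.ball 0 ρ) u) (ha₀ : a ≠ 0) (hax : ‖a‖ < ‖x‖)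
    (hxb : ‖x‖ < ‖b‖) (hbρ : ‖b‖ < ρ) (ha : HasOrbitMean ν u a) (hx : HasOrbitMean ν u x)
    (hb : HasOrbitMean ν u b) {α β : ℝ} (hαa : orbitMean ν u a ≤ α * rieszKernel p ‖a‖ + β)
    (hαb : orbitMean ν u b ≤ α * rieszKernel p ‖b‖ + β) :
    orbitMean ν u x ≤ α * rieszKernel p ‖x‖ + β := by
  obtain ⟨r, hbr, hrρ⟩ := exists_between hbρ
  have hsub : Metric.closedBall (0 : Euc n) r ⊆ Metric.ball 0 ρ :=
    Metric.closedBall_subset_ball hrρ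
  have hann : annulus 0 r ⊆ Metric.closedBall (0 : Euc n) r := fun y hy =>
    mem_closedBall_zero_iff.2 hy.2.le
  obtain ⟨M, hM⟩ := exists_real_upper_bound (isCompact_closedBall (0 : Euc n) r)
    (hu.usc.mono hsub) fun y hy => hu.ne_top y (hsub hy)
  have hMr : ∀ y ∈ annulus 0 r, u y ≤ M := fun y hy => hM y (hann hy)
  have haΩ : a ∈ annulus 0 r := ⟨norm_pos_iff.2 ha₀, (hax.trans hxb).trans hbr⟩
  have hxΩ : x ∈ annulus 0 r := ⟨haΩ.1.trans hax, hxb.trans hbr⟩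
  have hbΩ : b ∈ annulus 0 r := ⟨hxΩ.1.trans hxb, hbr⟩
  have hconcave := h.orbitAvg_deficit_concave (ν := ν) le_rfl (hu.mono (hann.trans hsub)) hMr
    (α := -α) (β := M - β) haΩ.1 hax hxb hbr
    (by rw [ha.orbitAvg_deficit haΩ hMr]; exact ENNReal.ofReal_le_ofReal (by linarith))
    (by rw [hb.orbitAvg_deficit hbΩ hMr]; exact ENNReal.ofReal_le_ofReal (by linarith))
  rw [hx.orbitAvg_deficit hxΩ hMr,
    ENNReal.ofReal_le_ofReal_iff (sub_nonneg.2 (hx.orbitMean_le hxΩ hMr))] at hconcave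
  linarith

/-- The difference quotient of `A` with respect to the radial function `rieszKernel p ‖·‖`; it is
`0` by convention when the two kernel values agree. -/
noncomputable def rieszSlope (p : ℝ) (A : Euc n → ℝ) (x y : Euc n) : ℝ :=
  (A y - A x) / (rieszKernel p ‖y‖ - rieszKernel p ‖x‖)

lemma rieszKernel_lt_rieszKernel_iff (ha₀ : a ≠ 0) (hb₀ : b ≠ 0) :
    rieszKernel p ‖a‖ < rieszKernel p ‖b‖ ↔ ‖a‖ < ‖b‖ :=
  (strictMonoOn_rieszKernel p).lt_iff_lt (norm_pos_iff.2 ha₀) (norm_pos_iff.2 hb₀)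

lemma IsRieszCone.rieszSlope_le_adjacent (h : IsRieszCone F p)
    (hu : IsSubharmonicOn F (Metric.ball 0 ρ) u) (ha₀ : a ≠ 0) (hax : ‖a‖ < ‖x‖)
    (hxb : ‖x‖ < ‖b‖) (hbρ : ‖b‖ < ρ) (ha : HasOrbitMean ν u a) (hx : HasOrbitMean ν u x)
    (hb : HasOrbitMean ν u b) :
    rieszSlope p (orbitMean ν u) a x ≤ rieszSlope p (orbitMean ν u) x b := by
  have hx₀ : x ≠ 0 := norm_pos_iff.1 ((norm_nonneg a).trans_lt hax)
  have hb₀ : b ≠ 0 := norm_pos_iff.1 ((norm_nonneg x).trans_lt hxb)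
  have hKax := (rieszKernel_lt_rieszKernel_iff (p := p) ha₀ hx₀).2 hax
  have hKxb := (rieszKernel_lt_rieszKernel_iff (p := p) hx₀ hb₀).2 hxb
  set α := rieszSlope p (orbitMean ν u) a b with hα
  have hchord : α * (rieszKernel p ‖b‖ - rieszKernel p ‖a‖) =
      orbitMean ν u b - orbitMean ν u a := by
    rw [hα, rieszSlope, div_mul_cancel₀ _ (by linarith)]
  have hconvex := h.orbitMean_convex hu ha₀ hax hxb hbρ ha hx hb (α := α)
    (β := orbitMean ν u a - α * rieszKernel p ‖a‖) (by linarith) (by linarith)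
  calc rieszSlope p (orbitMean ν u) a x ≤ α := by
        rw [rieszSlope, div_le_iff₀ (sub_pos.2 hKax)]; linarith
    _ ≤ rieszSlope p (orbitMean ν u) x b := by
        rw [rieszSlope, le_div_iff₀ (sub_pos.2 hKxb)]; linarith

lemma IsRieszCone.rieszSlope_le (h : IsRieszCone F p)
    (hu : IsSubharmonicOn F (Metric.ball 0 ρ) u) {c d : Euc n} (ha₀ : a ≠ 0)
    (hab : ‖a‖ < ‖b‖) (hbc : ‖b‖ < ‖c‖) (hcd : ‖c‖ < ‖d‖) (hdρ : ‖d‖ < ρ)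
    (ha : HasOrbitMean ν u a) (hb : HasOrbitMean ν u b) (hc : HasOrbitMean ν u c)
    (hd : HasOrbitMean ν u d) :
    rieszSlope p (orbitMean ν u) a b ≤ rieszSlope p (orbitMean ν u) c d :=
  (h.rieszSlope_le_adjacent hu ha₀ hab hbc (hcd.trans hdρ) ha hb hc).trans
    (h.rieszSlope_le_adjacent hu (norm_pos_iff.1 ((norm_nonneg a).trans_lt hab)) hbc hcd hdρ
      hb hc hd)

end Convexity

section Scaling

variable {ν : Measure (orthogonalStabilizer F)} {u : Euc n → EReal} {r b t : ℝ} {x y : Euc n}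

lemma HasOrbitMean.ae_toReal_scale (ht : 0 < t)
    (h : HasOrbitMean ν (fun x => (t : EReal) * u (r • x) + b) x) :
    ∀ᵐ g ∂ν, (u (rot g.1 (r • x)) ≠ ⊥ ∧ u (rot g.1 (r • x)) ≠ ⊤) ∧
      ((t : EReal) * u (r • rot g.1 x) + b).toReal = t * (u (rot g.1 (r • x))).toReal + b := by
  filter_upwards [h.finite] with g hg
  rw [map_smul]
  induction hu : u (r • rot g.1 x) with
  | bot => simp [hu, EReal.coe_mul_bot_of_pos ht] at hg
  | top => simp [hu, EReal.coe_mul_top_of_pos ht] at hg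
  | coe s =>
    refine ⟨⟨EReal.coe_ne_bot s, EReal.coe_ne_top s⟩, ?_⟩
    rw [← EReal.coe_mul, ← EReal.coe_add, EReal.toReal_coe, EReal.toReal_coe]

variable [IsProbabilityMeasure ν]

lemma HasOrbitMean.of_scale (ht : 0 < t)
    (h : HasOrbitMean ν (fun x => (t : EReal) * u (r • x) + b) x) : HasOrbitMean ν u (r • x) := by
  have hscale := h.ae_toReal_scale ht
  have hint := ((h.integrable.congr (hscale.mono fun g hg => hg.2)).sub
    (integrable_const b)).const_mul t⁻¹
  refine ⟨hint.congr (.of_forall fun g => ?_), hscale.mono fun g hg => hg.1⟩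
  simp only [Pi.sub_apply, add_sub_cancel_right]
  exact inv_mul_cancel_left₀ ht.ne' _

lemma HasOrbitMean.orbitMean_scale (ht : 0 < t)
    (h : HasOrbitMean ν (fun x => (t : EReal) * u (r • x) + b) x) :
    orbitMean ν (fun x => (t : EReal) * u (r • x) + b) x = t * orbitMean ν u (r • x) + b := by
  rw [orbitMean, integral_congr_ae ((h.ae_toReal_scale ht).mono fun g hg => hg.2),
    integral_add ((h.of_scale ht).integrable.const_mul t) (integrable_const b),
    integral_const_mul, orbitMean]
  simp

lemma rieszSlope_orbitMean_scale (hr : 0 < r) (hx₀ : x ≠ 0) (hy₀ : y ≠ 0)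
    (hx : HasOrbitMean ν (fun x => ((r ^ (p - 2) : ℝ) : EReal) * u (r • x) + b) x)
    (hy : HasOrbitMean ν (fun x => ((r ^ (p - 2) : ℝ) : EReal) * u (r • x) + b) y) :
    rieszSlope p (orbitMean ν (fun x => ((r ^ (p - 2) : ℝ) : EReal) * u (r • x) + b)) x y =
      rieszSlope p (orbitMean ν u) (r • x) (r • y) := by
  have ht : 0 < r ^ (p - 2) := Real.rpow_pos_of_pos hr _
  have hinv : r ^ (2 - p) = (r ^ (p - 2))⁻¹ := by rw [← Real.rpow_neg hr.le, neg_sub]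
  rw [rieszSlope, rieszSlope, hx.orbitMean_scale ht, hy.orbitMean_scale ht, norm_smul, norm_smul,
    Real.norm_of_nonneg hr.le,
    rieszKernel_mul_sub p hr (norm_pos_iff.2 hy₀) (norm_pos_iff.2 hx₀), hinv]
  field_simp
  ring

end Scaling

section TangentMean

lemma exists_mem_annulus_of_ae (hn : 0 < n) {P : Euc n → Prop} (hP : ∀ᵐ x, P x) {s t : ℝ}
    (hs : 0 ≤ s) (hst : s < t) : ∃ x ∈ annulus s t, P x := by
  obtain ⟨e, he⟩ := exists_norm_eq_one hn
  have hmid : ((s + t) / 2) • e ∈ annulus s t := by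
    rw [annulus, mem_ofPred_eq, norm_smul, he, mul_one, Real.norm_of_nonneg (by linarith)]
    constructor <;> linarith
  obtain ⟨x, hx, hPx⟩ := (Measure.dense_of_ae hP).inter_open_nonempty _ (isOpen_annulus s t)
    ⟨_, hmid⟩
  exact ⟨x, hx, hPx⟩

lemma exists_eq_mul_add_of_slope_le {α : Type*} {S : Set α} {κ A : α → ℝ} {x₀ x₁ : α}
    (hx₀ : x₀ ∈ S) (hx₁ : x₁ ∈ S) (h₀₁ : κ x₀ < κ x₁)
    (hslope : ∀ a ∈ S, ∀ b ∈ S, ∀ c ∈ S, ∀ d ∈ S, κ a < κ b → κ c < κ d →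
      (A b - A a) / (κ b - κ a) ≤ (A d - A c) / (κ d - κ c)) :
    ∃ m c : ℝ, ∀ x ∈ S, A x = m * κ x + c := by
  set m := (A x₁ - A x₀) / (κ x₁ - κ x₀)
  have hconst : ∀ a ∈ S, ∀ b ∈ S, κ a < κ b → A b - A a = m * (κ b - κ a) := by
    intro a ha b hb hab
    rw [← div_eq_iff (sub_pos.2 hab).ne']
    exact le_antisymm (hslope a ha b hb x₀ hx₀ x₁ hx₁ hab h₀₁)
      (hslope x₀ hx₀ x₁ hx₁ a ha b hb h₀₁ hab)
  refine ⟨m, A x₀ - m * κ x₀, fun x hx => ?_⟩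
  have h := hconst x₀ hx₀ x₁ hx₁ h₀₁
  rcases lt_or_ge (κ x) (κ x₁) with hlt | hge
  · linarith [hconst x hx x₁ hx₁ hlt]
  · linarith [hconst x₀ hx₀ x hx (h₀₁.trans_le hge)]

variable {ν : Measure (orthogonalStabilizer F)} [IsProbabilityMeasure ν]
  {u : Euc n → EReal} {ρ : ℝ} {r b : ℕ → ℝ} {Ubar : Euc n → ℝ}

-- Two slopes of the limit are limits of slopes of `u` at two different scales, and the scale of
-- the first can be taken much finer than that of the second.
lemma IsRieszCone.rieszSlope_tangent_le [ν.IsMulRightInvariant] (hF : IsRieszCone F p)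
    (hρ : 0 < ρ) (hu : IsSubharmonicOn F (Metric.ball 0 ρ) u) (hr : ∀ k, 0 < r k)
    (hr₀ : Tendsto r atTop (𝓝 0)) {A : Euc n → ℝ} {S : Set (Euc n)} (hS : 0 ∉ S)
    (hA : ∀ x ∈ S, (∀ᶠ k in atTop,
        HasOrbitMean ν (fun x => ((r k ^ (p - 2) : ℝ) : EReal) * u (r k • x) + b k) x) ∧
      Tendsto (fun k => orbitMean ν
        (fun x => ((r k ^ (p - 2) : ℝ) : EReal) * u (r k • x) + b k) x) atTop (𝓝 (A x)))
    {x y z w : Euc n} (hx : x ∈ S) (hy : y ∈ S) (hz : z ∈ S) (hw : w ∈ S) (hxy : ‖x‖ < ‖y‖)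
    (hzw : ‖z‖ < ‖w‖) : rieszSlope p A x y ≤ rieszSlope p A z w := by
  have hne : ∀ {x}, x ∈ S → x ≠ 0 := fun hx => ne_of_mem_of_not_mem hx hS
  have hlim : ∀ {x y}, x ∈ S → y ∈ S → Tendsto (fun k => rieszSlope p (orbitMean ν
      (fun x => ((r k ^ (p - 2) : ℝ) : EReal) * u (r k • x) + b k)) x y) atTop
      (𝓝 (rieszSlope p A x y)) :=
    fun hx hy => ((hA _ hy).2.sub (hA _ hx).2).div_const _
  have hnorm : ∀ k (x : Euc n), ‖r k • x‖ = r k * ‖x‖ := fun k x => by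
    rw [norm_smul, Real.norm_of_nonneg (hr k).le]
  have hsmall : ∀ (x : Euc n) {ε : ℝ}, 0 < ε → ∀ᶠ k in atTop, ‖r k • x‖ < ε := fun x ε hε => by
    have htend : Tendsto (fun k => ‖r k • x‖) atTop (𝓝 0) := by
      simpa only [hnorm, zero_mul] using hr₀.mul_const ‖x‖
    exact htend.eventually (gt_mem_nhds hε)
  refine ge_of_tendsto (hlim hz hw) ?_
  filter_upwards [(hA z hz).1, (hA w hw).1, hsmall w hρ] with k hzk hwk hwρ
  refine le_of_tendsto (hlim hx hy) ?_
  filter_upwards [(hA x hx).1, (hA y hy).1,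
    hsmall y (norm_pos_iff.2 (smul_ne_zero (hr k).ne' (hne hz)))] with l hxl hyl hlk
  rw [rieszSlope_orbitMean_scale (hr l) (hne hx) (hne hy) hxl hyl,
    rieszSlope_orbitMean_scale (hr k) (hne hz) (hne hw) hzk hwk]
  have ht : ∀ k, 0 < r k ^ (p - 2) := fun k => Real.rpow_pos_of_pos (hr k) _
  refine hF.rieszSlope_le hu (smul_ne_zero (hr l).ne' (hne hx)) ?_ hlk ?_ hwρ
    (hxl.of_scale (ht l)) (hyl.of_scale (ht l)) (hzk.of_scale (ht k)) (hwk.of_scale (ht k))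
  · rw [hnorm, hnorm]
    exact mul_lt_mul_of_pos_left hxy (hr l)
  · rw [hnorm, hnorm]
    exact mul_lt_mul_of_pos_left hzw (hr k)

theorem IsRieszCone.exists_integral_rot_eq [ν.IsMulRightInvariant] (hF : IsRieszCone F p)
    (hρ : 0 < ρ) (hu : IsSubharmonicOn F (Metric.ball 0 ρ) u) (hr : ∀ k, 0 < r k)
    (hr₀ : Tendsto r atTop (𝓝 0))
    (h : IsFastSeq F (fun k x => ((r k ^ (p - 2) : ℝ) : EReal) * u (r k • x) + b k) Ubar) :
    ∃ Θ c : ℝ, ∀ᵐ x, ∫ g, Ubar (rot g.1 x) ∂ν = Θ * rieszKernel p ‖x‖ + c := by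
  have : Nonempty (Fin n) := Fin.pos_iff_nonempty.1 hF.dim_pos
  set A : Euc n → ℝ := fun x => ∫ g, Ubar (rot g.1 x) ∂ν
  set uk : ℕ → Euc n → EReal := fun k x => ((r k ^ (p - 2) : ℝ) : EReal) * u (r k • x) + b k
  set S : Set (Euc n) := {x | ((∀ᶠ k in atTop, HasOrbitMean ν (uk k) x) ∧
    Tendsto (fun k => orbitMean ν (uk k) x) atTop (𝓝 (A x))) ∧ x ≠ 0}
  have hne : ∀ᵐ x : Euc n, x ≠ 0 :=
    measure_eq_zero_iff_ae_notMem.1 (measure_singleton (0 : Euc n))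
  have hS : ∀ᵐ x, x ∈ S := h.ae_tendsto_orbitMean.and hne
  obtain ⟨x₀, hx₀, hx₀S⟩ := exists_mem_annulus_of_ae hF.dim_pos hS zero_le_one one_lt_two
  obtain ⟨x₁, hx₁, hx₁S⟩ := exists_mem_annulus_of_ae hF.dim_pos hS zero_le_two
    (show (2 : ℝ) < 3 by norm_num)
  have hslope : ∀ x ∈ S, ∀ y ∈ S, ∀ z ∈ S, ∀ w ∈ S, rieszKernel p ‖x‖ < rieszKernel p ‖y‖ →
      rieszKernel p ‖z‖ < rieszKernel p ‖w‖ → rieszSlope p A x y ≤ rieszSlope p A z w :=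
    fun x hx y hy z hz w hw hxy hzw =>
      hF.rieszSlope_tangent_le hρ hu hr hr₀ (fun h₀ => h₀.2 rfl) (fun x hx => hx.1) hx hy hz hw
        ((rieszKernel_lt_rieszKernel_iff hx.2 hy.2).1 hxy)
        ((rieszKernel_lt_rieszKernel_iff hz.2 hw.2).1 hzw)
  obtain ⟨Θ, c, hΘ⟩ := exists_eq_mul_add_of_slope_le hx₀S hx₁S
    ((rieszKernel_lt_rieszKernel_iff hx₀S.2 hx₁S.2).2 (hx₀.2.trans hx₁.1)) hslope
  exact ⟨Θ, c, hS.mono hΘ⟩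

end TangentMean

/-! ### Maximality -/

section Maximal

variable {ν : Measure (orthogonalStabilizer F)} {U w : Euc n → EReal} {a b x : Euc n}
  {r₁ r₂ M Θ c : ℝ}

lemma orbitAvg_indicator_annulus (v : Euc n → ℝ≥0∞) (x : Euc n) :
    orbitAvg ν ((annulus r₁ r₂).indicator v) x = (annulus r₁ r₂).indicator (orbitAvg ν v) x := by
  have hrot : ∀ g : orthogonalStabilizer F, rot g.1 x ∈ annulus r₁ r₂ ↔ x ∈ annulus r₁ r₂ :=
    fun g => by rw [annulus, mem_ofPred_eq, LinearIsometryEquiv.norm_map, mem_ofPred_eq]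
  by_cases hx : x ∈ annulus r₁ r₂
  · rw [indicator_of_mem hx]
    exact lintegral_congr fun g => indicator_of_mem ((hrot g).2 hx) v
  · rw [indicator_of_notMem hx]
    exact (lintegral_congr fun g => indicator_of_notMem (mt (hrot g).1 hx) v).trans lintegral_zero

lemma orbitAvg_deficit_congr (hwU : ∀ y, ‖y‖ = ‖x‖ → w y = U y) :
    orbitAvg ν (deficit (annulus r₁ r₂) M w) x = orbitAvg ν (deficit (annulus r₁ r₂) M U) x :=
  lintegral_congr fun g => by
    have hg := hwU (rot g.1 x) (LinearIsometryEquiv.norm_map _ _)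
    exact le_antisymm (deficit_anti fun _ => hg.ge) (deficit_anti fun _ => hg.le)

variable [IsProbabilityMeasure ν]

lemma setLIntegral_annulus_orbitAvg {v : Euc n → ℝ≥0∞} (hv : Measurable v) :
    ∫⁻ x in annulus r₁ r₂, orbitAvg ν v x = ∫⁻ x in annulus r₁ r₂, v x := by
  have hmeas : MeasurableSet (annulus r₁ r₂ : Set (Euc n)) := (isOpen_annulus r₁ r₂).measurableSet
  rw [← lintegral_indicator hmeas, ← lintegral_indicator hmeas,
    ← lintegral_orbitAvg (ν := ν) (hv.indicator hmeas).aemeasurable]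
  exact lintegral_congr fun x => (orbitAvg_indicator_annulus v x).symm

lemma IsRieszCone.le_of_ae_deficit_le (h : IsRieszCone F p) {Ω D : Set (Euc n)} (hΩ : IsOpen Ω)
    (hD : IsOpen D) (hDΩ : D ⊆ Ω) (hw : IsSubharmonicOn F Ω w)
    (hwM : ∀ x ∈ Ω, w x ≤ M) (hU : UpperSemicontinuousOn U Ω) (hUM : ∀ x ∈ Ω, U x ≤ M)
    (hae : ∀ᵐ x ∂volume.restrict D, deficit Ω M U x ≤ deficit Ω M w x) :
    ∀ x ∈ D, w x ≤ U x := by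
  intro x hx
  by_contra! hlt
  obtain ⟨c, hUc, hcw⟩ := EReal.lt_iff_exists_real_btwn.1 hlt
  have hnear : ∀ᶠ y in 𝓝 x, U y < c ∧ y ∈ D := by
    have hUx := hU x (hDΩ hx) c hUc
    rw [hΩ.nhdsWithin_eq (hDΩ hx)] at hUx
    exact hUx.and (hD.mem_nhds hx)
  obtain ⟨s, hs, hball⟩ := Metric.nhds_basis_closedBall.eventually_iff.1 hnear
  have hlower : volume (Metric.closedBall x s) * ENNReal.ofReal (M - c) ≤
      ∫⁻ z in Metric.closedBall x s, deficit Ω M w z := by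
    rw [mul_comm, ← setLIntegral_const]
    have haeB := ae_restrict_of_ae_restrict_of_subset (fun y hy => (hball hy).2) hae
    refine lintegral_mono_ae ?_
    filter_upwards [haeB, ae_restrict_mem measurableSet_closedBall] with y hy hyB
    refine le_trans ?_ hy
    rw [ofReal_le_deficit_iff (hDΩ (hball hyB).2) (hUM y (hDΩ (hball hyB).2)), sub_sub_cancel]
    exact (hball hyB).1.le
  have hupper := h.setLIntegral_deficit_le hΩ hw hwM (x := x) (s := s) fun y hy =>
    hDΩ (hball hy).2
  have hdef : ENNReal.ofReal (M - c) ≤ deficit Ω M w x :=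
    (ENNReal.mul_le_mul_iff_right (Metric.measure_closedBall_pos volume x hs).ne'
      measure_closedBall_lt_top.ne).1 (hlower.trans hupper)
  rw [ofReal_le_deficit_iff (hDΩ hx) (hwM x (hDΩ hx)), sub_sub_cancel] at hdef
  exact hdef.not_gt hcw

lemma HasOrbitMean.orbitAvg_deficit_eq (hx : HasOrbitMean ν U x)
    (hmean : orbitMean ν U x = Θ * rieszKernel p ‖x‖ + c) (hxΩ : x ∈ annulus r₁ r₂)
    (hM : ∀ y ∈ annulus r₁ r₂, U y ≤ M) :
    orbitAvg ν (deficit (annulus r₁ r₂) M U) x =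
      ENNReal.ofReal (-Θ * rieszKernel p ‖x‖ + (M - c)) := by
  rw [hx.orbitAvg_deficit hxΩ hM, hmean]
  congr 1
  ring

lemma setLIntegral_annulus_rieszKernel_ne_top (ha : a ≠ 0) (α β : ℝ) :
    ∫⁻ z in (annulus ‖a‖ ‖b‖ : Set (Euc n)), ENNReal.ofReal (α * rieszKernel p ‖z‖ + β) ≠ ⊤ := by
  have ha₀ : 0 < ‖a‖ := norm_pos_iff.2 ha
  set B := |α| * (|rieszKernel p ‖a‖| + |rieszKernel p ‖b‖|) + β
  have hbound : ∀ z ∈ (annulus ‖a‖ ‖b‖ : Set (Euc n)), α * rieszKernel p ‖z‖ + β ≤ B := by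
    intro z hz
    have hz₀ : 0 < ‖z‖ := ha₀.trans hz.1
    have hKa := strictMonoOn_rieszKernel p ha₀ hz₀ hz.1
    have hKb := strictMonoOn_rieszKernel p hz₀ (hz₀.trans hz.2) hz.2
    have hK : |rieszKernel p ‖z‖| ≤ |rieszKernel p ‖a‖| + |rieszKernel p ‖b‖| :=
      (abs_le_max_abs_abs hKa.le hKb.le).trans
        (max_le_add_of_nonneg (abs_nonneg _) (abs_nonneg _))
    have hα := mul_le_mul_of_nonneg_left hK (abs_nonneg α)
    rw [← abs_mul] at hα
    linarith [le_abs_self (α * rieszKernel p ‖z‖)]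
  have hfin : volume (annulus ‖a‖ ‖b‖ : Set (Euc n)) ≠ ⊤ :=
    ne_top_of_le_ne_top (measure_closedBall_lt_top (x := 0) (r := ‖b‖)).ne
      (measure_mono fun z hz => mem_closedBall_zero_iff.2 hz.2.le)
  exact (setLIntegral_lt_top_of_le_nnreal hfin
    ⟨B.toNNReal, fun z hz => ENNReal.ofReal_le_ofReal (hbound z hz)⟩).ne

-- By concavity the orbit mean of `w` lies below the extremal profile that `U` attains; since
-- `U ≤ w`, both have the same integral.
theorem IsRieszCone.le_of_orbitMean_eq [ν.IsMulRightInvariant] (h : IsRieszCone F p)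
    (hr₁ : 0 ≤ r₁) (hU : IsSubharmonicOn F (annulus r₁ r₂) U)
    (hw : IsSubharmonicOn F (annulus r₁ r₂) w) (hUw : ∀ y ∈ annulus r₁ r₂, U y ≤ w y)
    (hM : ∀ y ∈ annulus r₁ r₂, w y ≤ M)
    (hmean : ∀ᵐ y, HasOrbitMean ν U y ∧ orbitMean ν U y = Θ * rieszKernel p ‖y‖ + c)
    (ha : a ∈ annulus r₁ r₂) (hb : b ∈ annulus r₁ r₂)
    (hUa : HasOrbitMean ν U a ∧ orbitMean ν U a = Θ * rieszKernel p ‖a‖ + c)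
    (hUb : HasOrbitMean ν U b ∧ orbitMean ν U b = Θ * rieszKernel p ‖b‖ + c)
    (hwa : ∀ y, ‖y‖ = ‖a‖ → w y = U y) (hwb : ∀ y, ‖y‖ = ‖b‖ → w y = U y) :
    ∀ x ∈ annulus ‖a‖ ‖b‖, w x ≤ U x := by
  set Ω : Set (Euc n) := annulus r₁ r₂
  set D : Set (Euc n) := annulus ‖a‖ ‖b‖
  have hΩ : IsOpen Ω := isOpen_annulus r₁ r₂
  have hD : IsOpen D := isOpen_annulus ‖a‖ ‖b‖
  have hDΩ : D ⊆ Ω := fun y hy => ⟨ha.1.trans hy.1, hy.2.trans hb.2⟩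
  have hUM : ∀ y ∈ Ω, U y ≤ M := fun y hy => (hUw y hy).trans (hM y hy)
  have hmU := (lowerSemicontinuous_deficit hΩ M hU.usc).measurable
  have hmw := (lowerSemicontinuous_deficit hΩ M hw.usc).measurable
  have hdef : ∀ y, deficit Ω M w y ≤ deficit Ω M U y := fun y => deficit_anti (hUw y)
  have hmean_le : ∀ᵐ z ∂volume.restrict D,
      orbitAvg ν (deficit Ω M U) z ≤ ENNReal.ofReal (-Θ * rieszKernel p ‖z‖ + (M - c)) ∧
        orbitAvg ν (deficit Ω M U) z ≤ orbitAvg ν (deficit Ω M w) z := by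
    filter_upwards [ae_restrict_of_ae hmean, ae_restrict_mem hD.measurableSet] with z hUz hz
    rw [hUz.1.orbitAvg_deficit_eq hUz.2 (hDΩ hz) hUM]
    refine ⟨le_rfl, h.orbitAvg_deficit_concave hr₁ hw hM ha.1 hz.1 hz.2 hb.2 ?_ ?_⟩
    · rw [orbitAvg_deficit_congr hwa, hUa.1.orbitAvg_deficit_eq hUa.2 ha hUM]
    · rw [orbitAvg_deficit_congr hwb, hUb.1.orbitAvg_deficit_eq hUb.2 hb hUM]
  have hfin : ∫⁻ z in D, deficit Ω M U z ≠ ⊤ := by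
    rw [← setLIntegral_annulus_orbitAvg (ν := ν) hmU]
    exact ne_top_of_le_ne_top
      (setLIntegral_annulus_rieszKernel_ne_top (norm_pos_iff.1 (hr₁.trans_lt ha.1)) _ _)
      (lintegral_mono_ae (hmean_le.mono fun z hz => hz.1))
  have hint : ∫⁻ z in D, deficit Ω M U z ≤ ∫⁻ z in D, deficit Ω M w z := by
    rw [← setLIntegral_annulus_orbitAvg (ν := ν) hmU,
      ← setLIntegral_annulus_orbitAvg (ν := ν) hmw]
    exact lintegral_mono_ae (hmean_le.mono fun z hz => hz.2)
  have hae := ae_eq_of_ae_le_of_lintegral_le (.of_forall hdef)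
    (ne_top_of_le_ne_top hfin (lintegral_mono hdef)) hmU.aemeasurable hint
  exact h.le_of_ae_deficit_le hΩ hD hDΩ hw hM hU.usc hUM (hae.mono fun z hz => hz.ge)

theorem IsRieszCone.isMaximalOn_of_orbitMean_eq [ν.IsMulRightInvariant] (h : IsRieszCone F p)
    (hU : IsSubharmonicOn F {(0 : Euc n)}ᶜ U)
    (hmean : ∀ᵐ y, HasOrbitMean ν U y ∧ orbitMean ν U y = Θ * rieszKernel p ‖y‖ + c) :
    IsMaximalOn F {(0 : Euc n)}ᶜ U := by
  refine ⟨hU, fun v hv K hK hK₀ hvU x hx => ?_⟩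
  set w : Euc n → EReal := fun y => max (U y) (v y)
  have hw : IsSubharmonicOn F {(0 : Euc n)}ᶜ w := hU.sup hv
  suffices hwx : w x ≤ U x from (le_max_right _ _).trans hwx
  have hxK : insert x K ⊆ {(0 : Euc n)}ᶜ := insert_subset hx hK₀
  have hcomp : IsCompact (insert x K) := hK.insert x
  obtain ⟨y₀, hy₀, hmin⟩ := hcomp.exists_isMinOn ⟨x, mem_insert x K⟩ continuous_norm.continuousOn
  obtain ⟨y₁, hy₁, hmax⟩ := hcomp.exists_isMaxOn ⟨x, mem_insert x K⟩ continuous_norm.continuousOn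
  have hy₀_pos : 0 < ‖y₀‖ := norm_pos_iff.2 (hxK hy₀)
  have hy₀₁ : ‖y₀‖ ≤ ‖y₁‖ := hmin hy₁
  obtain ⟨a, ha, hUa⟩ := exists_mem_annulus_of_ae h.dim_pos hmean (s := ‖y₀‖ / 2) (t := ‖y₀‖)
    (by positivity) (by linarith)
  obtain ⟨b, hb, hUb⟩ := exists_mem_annulus_of_ae h.dim_pos hmean (s := ‖y₁‖) (t := ‖y₁‖ + 1)
    (by positivity) (by linarith)
  have hC₀ : {y : Euc n | ‖y₀‖ / 2 ≤ ‖y‖ ∧ ‖y‖ ≤ ‖y₁‖ + 1} ⊆ {(0 : Euc n)}ᶜ := fun y hy =>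
    norm_pos_iff.1 (by linarith [hy.1])
  have hΩ : annulus (‖y₀‖ / 2) (‖y₁‖ + 1) ⊆ {y : Euc n | ‖y₀‖ / 2 ≤ ‖y‖ ∧ ‖y‖ ≤ ‖y₁‖ + 1} :=
    fun y hy => ⟨hy.1.le, hy.2.le⟩
  obtain ⟨M, hM⟩ := exists_real_upper_bound (isCompact_closedAnnulus (‖y₀‖ / 2) (‖y₁‖ + 1))
    (hw.usc.mono hC₀) fun y hy => hw.ne_top y (hC₀ hy)
  have hoff : ∀ y : Euc n, y ≠ 0 → y ∉ insert x K → w y = U y := fun y hy hyK =>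
    max_eq_left (hvU y ⟨hy, fun hy' => hyK (mem_insert_of_mem x hy')⟩)
  refine h.le_of_orbitMean_eq (by positivity) (hU.mono (hΩ.trans hC₀)) (hw.mono (hΩ.trans hC₀))
    (fun y _ => le_max_left _ _) (fun y hy => hM y (hΩ hy)) hmean ⟨ha.1, by linarith [ha.2]⟩
    ⟨by linarith [hb.1], hb.2⟩ hUa hUb (fun y hy => ?_) (fun y hy => ?_) x
    ⟨ha.2.trans_le (hmin (mem_insert x K)), (hmax (mem_insert x K)).trans_lt hb.1⟩
  · exact hoff y (norm_pos_iff.1 (by linarith [ha.1])) fun hyK =>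
      (hy.trans_lt ha.2).not_ge (hmin hyK)
  · exact hoff y (norm_pos_iff.1 (by linarith [hb.1])) fun hyK =>
      (hb.1.trans_eq hy.symm).not_ge (hmax hyK)

lemma IsFastSeq.ae_hasOrbitMean_essRep {uk : ℕ → Euc n → EReal} {Ubar : Euc n → ℝ}
    (h : IsFastSeq F uk Ubar) (hF : IsRieszCone F p) (hU : IsEssRep Ubar U) :
    ∀ᵐ x, HasOrbitMean ν U x ∧ orbitMean ν U x = ∫ g, Ubar (rot g.1 x) ∂ν := by
  filter_upwards [ae_ae_rot (ν := ν) (h.ae_eq hF hU),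
    ae_integrable_rot (ν := ν) h.locallyIntegrable] with x hx hint
  have hreal : (fun g : orthogonalStabilizer F => (U (rot g.1 x)).toReal) =ᵐ[ν]
      fun g => Ubar (rot g.1 x) := hx.mono fun g hg => by simp only [hg, EReal.toReal_coe]
  exact ⟨⟨hint.congr hreal.symm, hx.mono fun g hg => hg ▸ ⟨EReal.coe_ne_bot _, EReal.coe_ne_top _⟩⟩,
    integral_congr_ae hreal⟩

end Maximal

section Harmonic

variable {X : Set (Euc n)} {U : Euc n → EReal} {φ : Euc n → ℝ} {x : Euc n} {η s : ℝ}

lemma exists_isSubharmonicOn_add_neg_normSq (hF : IsSubequation F) (hφ : ContDiffAt ℝ 2 φ x)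
    (hint : F ∈ 𝓝[symMat n] (hessian φ x)) :
    ∃ η > 0, ∀ᶠ s in 𝓝[>] (0 : ℝ), ∀ d : ℝ, IsSubharmonicOn F (Metric.ball x s)
      (fun y => ((φ y + -η * ‖y - x‖ ^ 2 + d : ℝ) : EReal)) := by
  obtain ⟨O, hO, hxO, hOF⟩ := mem_nhdsWithin.1 hint
  have hlim : Tendsto (fun η : ℝ => hessian φ x + (2 * -η) • (1 : Mat n)) (𝓝[>] 0)
      (𝓝 (hessian φ x)) := by
    have hcont : Continuous fun η : ℝ => hessian φ x + (2 * -η) • (1 : Mat n) := by fun_prop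
    simpa using (hcont.tendsto 0).mono_left nhdsWithin_le_nhds
  obtain ⟨η, hηO, hη⟩ := ((hlim.eventually (hO.mem_nhds hxO)).and self_mem_nhdsWithin).exists
  refine ⟨η, hη, ?_⟩
  have hnear : ∀ᶠ y in 𝓝 x, ContDiffAt ℝ 2 φ y ∧ hessian φ y + (2 * -η) • (1 : Mat n) ∈ O :=
    (hφ.eventually (by simp)).and
      (((continuousAt_hessian hφ).add continuousAt_const).eventually (hO.mem_nhds hηO))
  obtain ⟨s₀, hs₀, hball⟩ := Metric.nhds_basis_ball.eventually_iff.1 hnear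
  filter_upwards [Ioo_mem_nhdsGT hs₀] with s hs d
  have hquad := contDiffAt_const_mul_normSq_sub (n := n) (-η) x
  have hφs : ∀ y ∈ Metric.ball x s, ContDiffAt ℝ 2 φ y ∧
      hessian φ y + (2 * -η) • (1 : Mat n) ∈ O := fun y hy =>
    hball (Metric.ball_subset_ball hs.2.le hy)
  have hsmooth : ∀ y ∈ Metric.ball x s,
      ContDiffAt ℝ 2 (fun y => φ y + -η * ‖y - x‖ ^ 2 + d) y := fun y hy =>
    ((hφs y hy).1.add (hquad y)).add contDiffAt_const
  refine isSubharmonicOn_of_hessian_mem hF hsmooth fun y hy =>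
    hOF ⟨?_, isSymm_hessian (hsmooth y hy)⟩
  rw [hessian_add_const, hessian_add (hφs y hy).1 (hquad y), hessian_const_mul_normSq_sub]
  exact (hφs y hy).2

open scoped Classical in
/-- The competitor obtained by raising `U` to `φ - η ‖· - x‖² + η s² / 8` inside the ball of
radius `s`. If `φ ≤ U` on that ball, it agrees with `U` at all points at distance more than
`s / 2` from `x`. -/
noncomputable def bumped (U : Euc n → EReal) (φ : Euc n → ℝ) (x : Euc n) (η s : ℝ) :
    Euc n → EReal :=
  fun y => if y ∈ Metric.ball x s then
    max (U y) ((φ y + -η * ‖y - x‖ ^ 2 + η * (s ^ 2 / 8) : ℝ) : EReal) else U y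

lemma bumped_of_half_lt (hη : 0 < η) (hs : 0 < s) (hφU : ∀ y ∈ Metric.ball x s, φ y ≤ U y)
    {y : Euc n} (hy : s / 2 < ‖y - x‖) : bumped U φ x η s y = U y := by
  by_cases hyB : y ∈ Metric.ball x s
  · rw [bumped, if_pos hyB]
    refine max_eq_left (le_trans (EReal.coe_le_coe_iff.2 ?_) (hφU y hyB))
    have hsq : (s / 2) ^ 2 ≤ ‖y - x‖ ^ 2 := by gcongr
    nlinarith
  · exact if_neg hyB

lemma IsSubharmonicOn.bumped (hU : IsSubharmonicOn F X U) (hX : IsOpen X) (hη : 0 < η)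
    (hs : 0 < s) (hball : Metric.ball x s ⊆ X) (hφU : ∀ y ∈ Metric.ball x s, φ y ≤ U y)
    (hsub : ∀ d : ℝ, IsSubharmonicOn F (Metric.ball x s)
      (fun y => ((φ y + -η * ‖y - x‖ ^ 2 + d : ℝ) : EReal))) :
    IsSubharmonicOn F X (bumped U φ x η s) := by
  refine IsSubharmonicOn.of_locally_eq fun y hy => ?_
  by_cases hyB : y ∈ Metric.ball x s
  · have hnear : Metric.ball x s ∈ 𝓝 y := Metric.isOpen_ball.mem_nhds hyB
    refine ⟨_, _, hnear, (hU.mono hball).sup (hsub (η * (s ^ 2 / 8))), ?_⟩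
    filter_upwards [hnear] with z hz using if_pos hz
  · refine ⟨U, X, hX.mem_nhds hy, hU, ?_⟩
    have hy' : s / 2 < ‖y - x‖ := by
      rw [mem_ball_iff_norm, not_lt] at hyB
      linarith
    have hcont : ContinuousAt (fun z : Euc n => ‖z - x‖) y := by fun_prop
    filter_upwards [hcont.eventually (lt_mem_nhds hy')] with z hz
      using bumped_of_half_lt hη hs hφU hz

theorem IsMaximalOn.hessian_notMem_interior (h : IsMaximalOn F X U) (hF : IsSubequation F)
    (hX : IsOpen X) (hx : x ∈ X) (hφ : ContDiffAt ℝ 2 φ x) (hUx : U x = φ x)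
    (hφU : ∀ᶠ y in 𝓝 x, φ y ≤ U y) : F ∉ 𝓝[symMat n] (hessian φ x) := by
  intro hint
  obtain ⟨η, hη, hsub⟩ := exists_isSubharmonicOn_add_neg_normSq hF hφ hint
  obtain ⟨s₀, hs₀, hball₀⟩ := Metric.nhds_basis_ball.eventually_iff.1 (hφU.and (hX.mem_nhds hx))
  obtain ⟨s, hsub, hs, hss₀⟩ := (hsub.and (Ioo_mem_nhdsGT hs₀)).exists
  have hball : ∀ y ∈ Metric.ball x s, φ y ≤ U y ∧ y ∈ X := fun y hy =>
    hball₀ (Metric.ball_subset_ball hss₀.le hy)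
  have hle : bumped U φ x η s x ≤ U x :=
    h.2 _ (h.1.bumped hX hη hs (fun y hy => (hball y hy).2) (fun y hy => (hball y hy).1) hsub)
      (Metric.closedBall x (s / 2)) (isCompact_closedBall _ _)
      (fun y hy => (hball y (Metric.closedBall_subset_ball (by linarith) hy)).2)
      (fun y hy => (bumped_of_half_lt hη hs (fun y hy => (hball y hy).1)
        (by simpa [dist_eq_norm] using hy.2)).le) x hx
  rw [bumped, if_pos (Metric.mem_ball_self hs), hUx] at hle
  have hcenter := EReal.coe_le_coe_iff.1 ((le_max_right _ _).trans hle)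
  simp only [sub_self, norm_zero] at hcenter
  nlinarith [mul_pos hη (pow_pos hs 2)]

theorem IsMaximalOn.isHarmonicOn (h : IsMaximalOn F X U) (hF : IsSubequation F) (hX : IsOpen X)
    (hbot : ∀ x ∈ X, U x ≠ ⊥) (hcont : ContinuousOn U X) : IsHarmonicOn F X U := by
  refine ⟨h.1, (continuous_neg.comp_continuousOn hcont).upperSemicontinuousOn,
    fun x hx => by simpa [EReal.neg_eq_top_iff] using hbot x hx,
    fun x hx φ hφ hUx hUφ => ⟨isSymm_hessian hφ, ?_⟩⟩
  rw [← hessian_neg]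
  refine h.hessian_notMem_interior hF hX hx hφ.neg ?_ (hUφ.mono fun y hy => ?_)
  · rw [EReal.coe_neg, ← hUx, neg_neg]
  · rw [EReal.coe_neg]
    exact EReal.neg_le.1 hy

end Harmonic

/-! ### Continuity below exponent two -/

section Continuity

variable {q : ℝ}

lemma rieszProfile_of_lt_two (hq : q < 2) (t : ℝ) :
    rieszProfile q t = t ^ (1 - q / 2) / (1 - q / 2) := by
  rw [rieszProfile, if_neg hq.ne]

lemma continuous_rieszKernel (hq : q < 2) : Continuous (rieszKernel q) := by
  have hprofile : Continuous (rieszProfile q) := by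
    simp_rw [funext (rieszProfile_of_lt_two hq)]
    exact (Real.continuous_rpow_const (by linarith)).div_const _
  exact hprofile.comp (continuous_pow 2)

lemma rieszKernel_zero (hq : q < 2) : rieszKernel q 0 = 0 := by
  rw [rieszKernel, rieszProfile_of_lt_two hq, zero_pow two_ne_zero, Real.zero_rpow (by linarith),
    zero_div]

lemma rieszKernel_pos (hq : q < 2) {r : ℝ} (hr : 0 < r) : 0 < rieszKernel q r := by
  rw [rieszKernel, rieszProfile_of_lt_two hq]
  exact div_pos (Real.rpow_pos_of_pos (by positivity) _) (by linarith)

lemma tendsto_rieszKernel_norm_sub_div (hq : q < 2) (x : Euc n) (R : ℝ) :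
    Tendsto (fun y => rieszKernel q ‖x - y‖ / rieszKernel q R) (𝓝 x) (𝓝 0) := by
  have hcont : Continuous fun y => rieszKernel q ‖x - y‖ / rieszKernel q R :=
    ((continuous_rieszKernel hq).comp (by fun_prop)).div_const _
  simpa [rieszKernel_zero hq] using hcont.tendsto x

lemma contDiffAt_rieszKernel_norm_sub (q : ℝ) {x y : Euc n} (hxy : x ≠ y) :
    ContDiffAt ℝ 2 (fun z => rieszKernel q ‖z - y‖) x :=
  contDiffAt_rieszProfile_normSq_sub q hxy

lemma IsRieszCone.hessian_rieszKernel_notMem (h : IsRieszCone F p) (hpq : p < q) {C : ℝ}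
    (hC : 0 < C) {x y : Euc n} (hxy : x ≠ y) :
    hessian (fun z => C * rieszKernel q ‖z - y‖) x ∉ F := by
  intro hmem
  have hpos : 0 < ‖x - y‖ := norm_pos_iff.2 (sub_ne_zero.2 hxy)
  have hθ : 0 < C * (2 * (‖x - y‖ ^ 2) ^ (-(q / 2))) := by positivity
  unfold rieszKernel at hmem
  rw [hessian_const_mul (contDiffAt_rieszProfile_normSq_sub q hxy),
    hessian_rieszProfile_normSq_sub q hxy, smul_smul] at hmem
  have hscaled := h.isConeSet _ (inv_nonneg.2 hθ.le) _ hmem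
  rw [inv_smul_smul₀ hθ.ne'] at hscaled
  exact h.rieszMat_notMem hpq (norm_smul_inv_norm (𝕜 := ℝ) (sub_ne_zero.2 hxy)) hscaled

variable {U : Euc n → EReal} {X : Set (Euc n)}

-- `C * rieszKernel q ‖· - y‖` has Hessian outside `F` off its vertex, so `F`-subharmonic functions
-- cannot touch it from below there.
lemma IsRieszCone.le_add_rieszKernel (h : IsRieszCone F p) (hpq : p < q) (hq : q < 2) {y : Euc n}
    {R M N : ℝ} (hR : 0 < R) (hU : IsSubharmonicOn F (Metric.closedBall y R) U)
    (hM : ∀ x ∈ Metric.closedBall y R, U x ≤ M) (hy : U y ≤ N) (hNM : N < M) :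
    ∀ x ∈ Metric.closedBall y R,
      U x ≤ (((M - N) * (rieszKernel q ‖x - y‖ / rieszKernel q R) + N : ℝ) : EReal) := by
  have hKR := rieszKernel_pos hq hR
  have hC : 0 < (M - N) / rieszKernel q R := div_pos (sub_pos.2 hNM) hKR
  have hcont : Continuous fun x => (M - N) / rieszKernel q R * rieszKernel q ‖x - y‖ + N :=
    (((continuous_rieszKernel hq).comp (by fun_prop)).const_mul _).add continuous_const
  have hcomp := hU.le_of_hessian_notMem (isCompact_closedBall y R)
    (V := Metric.ball y R \ {y}) (Metric.isOpen_ball.sdiff isClosed_singleton)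
    (sdiff_subset.trans Metric.ball_subset_closedBall) hcont.continuousOn
    (fun x hx => (contDiffAt_const.mul (contDiffAt_rieszKernel_norm_sub q hx.2)).add
      contDiffAt_const)
    (fun x hx => by
      rw [hessian_add_const]
      exact h.hessian_rieszKernel_notMem hpq hC hx.2)
    (fun x hx => ?_)
  · intro x hx
    convert hcomp x hx using 3
    ring
  · by_cases hxy : x = y
    · simpa [hxy, rieszKernel_zero hq] using hy
    · have hxR : ‖x - y‖ = R :=
        (mem_closedBall_iff_norm.1 hx.1).antisymm (not_lt.1 fun hlt =>
          hx.2 ⟨mem_ball_iff_norm.2 hlt, hxy⟩)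
      rw [hxR, div_mul_cancel₀ _ hKR.ne', sub_add_cancel]
      exact hM x hx.1

lemma IsRieszCone.eventually_lt (h : IsRieszCone F p) (hp : p < 2) (hX : IsOpen X)
    (hU : IsSubharmonicOn F X U) {x : Euc n} (hx : x ∈ X) {c : EReal} (hc : c < U x) :
    ∀ᶠ y in 𝓝 x, c < U y := by
  obtain ⟨q, hpq, hq⟩ := exists_between hp
  obtain ⟨c₁, hc₁, hc₁x⟩ := EReal.lt_iff_exists_real_btwn.1 hc
  obtain ⟨c₂, hc₁₂, hc₂x⟩ := EReal.lt_iff_exists_real_btwn.1 hc₁x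
  obtain ⟨R, hR, hball⟩ := Metric.nhds_basis_closedBall.mem_iff.1 (hX.mem_nhds hx)
  obtain ⟨M, hM⟩ := exists_real_upper_bound (isCompact_closedBall x R) (hU.usc.mono hball)
    fun y hy => hU.ne_top y (hball hy)
  have hcM : c₁ < M :=
    EReal.coe_lt_coe_iff.1 (hc₁x.trans_le (hM x (Metric.mem_closedBall_self hR.le)))
  have hlim : Tendsto (fun y => (M - c₁) * (rieszKernel q ‖x - y‖ / rieszKernel q (R / 2)) + c₁)
      (𝓝 x) (𝓝 c₁) := by
    simpa using ((tendsto_rieszKernel_norm_sub_div hq x (R / 2)).const_mul (M - c₁)).add_const c₁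
  filter_upwards [hlim.eventually (gt_mem_nhds (EReal.coe_lt_coe_iff.1 hc₁₂)),
    Metric.ball_mem_nhds x (half_pos hR)] with y hy hyB
  by_contra! hcy
  have hsub : Metric.closedBall y (R / 2) ⊆ Metric.closedBall x R :=
    Metric.closedBall_subset_closedBall' (by linarith [Metric.mem_ball.1 hyB])
  have hUx := h.le_add_rieszKernel hpq hq (half_pos hR) (hU.mono (hsub.trans hball))
    (fun z hz => hM z (hsub hz)) (hcy.trans hc₁.le) hcM x
    (Metric.mem_closedBall'.2 (Metric.mem_ball.1 hyB).le)
  exact (hUx.trans_lt (EReal.coe_lt_coe_iff.2 hy)).not_gt hc₂x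

theorem IsRieszCone.continuousOn (h : IsRieszCone F p) (hp : p < 2) (hX : IsOpen X)
    (hU : IsSubharmonicOn F X U) : ContinuousOn U X := fun x hx =>
  tendsto_order.2 ⟨fun _ hc => mem_nhdsWithin_of_mem_nhds (h.eventually_lt hp hX hU hx hc),
    hU.usc x hx⟩

lemma IsRieszCone.eventually_eq_bot (h : IsRieszCone F p) (hp : p < 2) (hX : IsOpen X)
    (hU : IsSubharmonicOn F X U) {y : Euc n} (hyX : y ∈ X) (hy : U y = ⊥) :
    ∀ᶠ x in 𝓝 y, U x = ⊥ := by
  obtain ⟨q, hpq, hq⟩ := exists_between hp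
  obtain ⟨R, hR, hball⟩ := Metric.nhds_basis_closedBall.mem_iff.1 (hX.mem_nhds hyX)
  obtain ⟨M, hM⟩ := exists_real_upper_bound (isCompact_closedBall y R) (hU.usc.mono hball)
    fun y hy => hU.ne_top y (hball hy)
  filter_upwards [(tendsto_rieszKernel_norm_sub_div hq y R).eventually (gt_mem_nhds one_half_pos),
    Metric.closedBall_mem_nhds y hR] with x hx hxB
  refine (EReal.eq_bot_iff_forall_lt _).2 fun d => ?_
  obtain ⟨N, hN⟩ := exists_lt (min M (2 * d - M))
  have hNM : N < M := hN.trans_le (min_le_left _ _)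
  have hNd : N < 2 * d - M := hN.trans_le (min_le_right _ _)
  refine (h.le_add_rieszKernel hpq hq hR (hU.mono hball) hM (N := N) (by simp [hy]) hNM x
    hxB).trans_lt (EReal.coe_lt_coe_iff.2 ?_)
  rw [norm_sub_rev] at hx
  nlinarith

lemma IsRieszCone.ne_bot_of_ae (h : IsRieszCone F p) (hp : p < 2) (hX : IsOpen X)
    (hU : IsSubharmonicOn F X U) (hae : ∀ᵐ x, U x ≠ ⊥) : ∀ x ∈ X, U x ≠ ⊥ := by
  intro x hx hbot
  obtain ⟨y, hy, hy'⟩ := (Measure.dense_of_ae hae).inter_nhds_nonempty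
    (h.eventually_eq_bot hp hX hU hx hbot)
  exact hy hy'

end Continuity

theorem theorem10p2 {n : ℕ} (F : Set (Mat n)) (hF : IsSubequation F) (hcone : IsConeSet F)
    (hST : IsSTInvariant F) (hconv : Convex ℝ F)
    (p : ℝ) (hp : rieszChar F = (p : EReal))
    (ρ : ℝ) (hρ : 0 < ρ) (u : Euc n → EReal)
    (hu : IsSubharmonicOn F (Metric.ball (0 : Euc n) ρ) u)
    (U : Euc n → EReal) (hU : IsTangentAtZero p u U) :
    IsMaximalOn F {(0 : Euc n)}ᶜ U ∧
    ((∀ x : Euc n, x ≠ 0 → U x ≠ ⊥) → ContinuousOn U {(0 : Euc n)}ᶜ →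
      IsHarmonicOn F {(0 : Euc n)}ᶜ U) ∧
    (p < 2 → ContinuousOn U {(0 : Euc n)}ᶜ ∧ IsHarmonicOn F {(0 : Euc n)}ᶜ U) := by
  have h : IsRieszCone F p := ⟨hF, hcone, hST, hconv, hp⟩
  obtain ⟨ν, _, _⟩ := exists_isMulRightInvariant hF.closed
  obtain ⟨Ubar, r, b, hrep, hr, hr₀, hfast⟩ := hU.exists_isFastSeq hcone hρ hu
  obtain ⟨Θ, c, hΘ⟩ := h.exists_integral_rot_eq (ν := ν) hρ hu hr hr₀ hfast
  have hmean : ∀ᵐ x, HasOrbitMean ν U x ∧ orbitMean ν U x = Θ * rieszKernel p ‖x‖ + c := by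
    filter_upwards [hfast.ae_hasOrbitMean_essRep (ν := ν) h hrep, hΘ] with x hx hΘx
    exact ⟨hx.1, hx.2.trans hΘx⟩
  have hsub : IsSubharmonicOn F {(0 : Euc n)}ᶜ U :=
    (hfast.isSubharmonicOn_univ h hrep).mono (subset_univ _)
  have hmax := h.isMaximalOn_of_orbitMean_eq hsub hmean
  have hopen : IsOpen {(0 : Euc n)}ᶜ := isOpen_compl_singleton
  refine ⟨hmax, hmax.isHarmonicOn hF hopen, fun hp₂ => ?_⟩
  have hcont := h.continuousOn hp₂ hopen hsub
  have hfin := h.ne_bot_of_ae hp₂ hopen hsub <|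
    (hfast.ae_eq h hrep).mono fun x hx => hx ▸ EReal.coe_ne_bot _
  exact ⟨hcont, hmax.isHarmonicOn hF hopen hfin hcont⟩
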